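/- Let $k$ be an algebraically closed field of characteristic zero. All operads are non-symmetric $k$-linear operads. For a finite-dimensional space $\Omega$ of binary operations and a subspace $\Lambda\subseteq\Omega^{\otimes 2}\oplus\Omega^{\otimes 2}$, let $\mathcal P(\Omega,\Lambda)$ be the quotient of the free operad on $\Omega$ by the operadic ideal generated by $\Lambda$, where $\left(\sum\circ_1\otimes\circ_2,\ \sum\circ_3\otimes\circ_4\right)\in\Lambda$ stands for the relation $\sum (x\circ_1 y)\circ_2 z=\sum x\circ_3(y\circ_4 z)$. Put $$\mathcal P(\Omega,\Lambda)\,\blacksquare\,\mathcal P(\Omega',\Lambda')=\mathcal P\big(\Omega\otimes\Omega',\,S_{23}(\Lambda\otimes\Lambda')\big),$$ where $S_{23}(\Lambda\otimes\Lambda')$ is spanned by the pairs $(u\otimes u',v\otimes v')$ with $(u,v)\in\Lambda$, $(u',v')\in\Lambda'$ and the middle tensor factors switched. The quadratic dual is $\mathcal P(\Omega,\Lambda)^!=\mathcal P(\Omega^\vee,\Lambda^\perp)$, where $\Omega^\vee$ is the linear dual and $\perp$ refers to the pairing $\langle (f,g),(u,v)\rangle=f(u)-g(v)$. For such an operad $\mathcal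 P$, let $\mathcal D(\mathcal P)$ be its (dual) bar complex, i.e. the free operad on the linear duals $\mathcal P(l)^*$, $l\ge 2$, with $\mathcal P(l)^*$ placed in homological degree $l-2$: in arity $n$ and degree $i$ it is $\bigoplus_T\big(\bigotimes_{v}\mathcal P(l_v)\big)^*$, where $T$ runs over the planar trees with $n$ leaves and $n-1-i$ vertices, every vertex $v$ having $l_v\ge 2$ inputs; its differential, of degree $-1$, is dual to the signed sum of the contractions of single internal edges by the partial compositions of $\mathcal P$ (with the usual signs of the free graded operad). In degree $0$ it is the free operad on $\Omega^\vee$, which projects onto $\mathcal P^!$. The operad $\mathcal P$ is called Koszul if $\mathcal D(\mathcal P)$ is a resolution of $\mathcal P^!$, i.e. if for every $n$ the complex $$\cdots\to\mathcal D(\mathcal P)(n)_2\to\mathcal D(\mathcal P)(n)_1\to\mathcal D(\mathcal P)(n)_0\to\mathcal P^!(n)\to 0$$ is exact. Let $\mathcal Dend$ be the operad of dendriform algebras, generated by two binary operations $\prec,\succ$ with the relations $(x\prec y)\prec z=x\prec(y\prec z+y\succ z)$, $(x\succ y)\prec z=x\succ(y\prec z)$ and $(x\prec y+x\succ y)\succ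 z=x\succ(y\succ z)$, and let $\mathcal Quad=\mathcal Dend\,\blacksquare\,\mathcal Dend$ be the operad of quadri-algebras. **Theorem.** The operad $\mathcal Quad$ is Koszul. -/

import Mathlib

universe u w

/-! ### Non-symmetric operads -/

/-- A non-symmetric `k`-linear operad, presented by its partial compositions
`p ∘ᵢ q ∈ P(m + n - 1)` for `p ∈ P(m)`, `q ∈ P(n)`.  Inputs are numbered from `0`, and the arity
`l = m + n - 1` of a composite is passed together with a proof of `l + 1 = m + n`. -/
structure NSOperad (k : Type u) [Field k] where
  obj : ℕ → Type w
  [addCommGroup : ∀ n, AddCommGroup (obj n)]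
  [module : ∀ n, Module k (obj n)]
  one : obj 1
  comp : ∀ {m n l : ℕ} (i : ℕ), i < m → l + 1 = m + n → (obj m →ₗ[k] obj n →ₗ[k] obj l)
  one_comp : ∀ {n : ℕ} (q : obj n), comp 0 one_pos (add_comm n 1) one q = q
  comp_one : ∀ {m : ℕ} (i : ℕ) (hi : i < m) (p : obj m), comp i hi rfl p one = p
  comp_seq : ∀ {a b c ab bc abc : ℕ} (i j : ℕ) (hi : i < a) (hj : j < b)
    (h₁ : ab + 1 = a + b) (h₂ : abc + 1 = ab + c) (h₃ : bc + 1 = b + c) (h₄ : abc + 1 = a + bc)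
    (hij : i + j < ab) (p : obj a) (q : obj b) (r : obj c),
    comp (i + j) hij h₂ (comp i hi h₁ p q) r = comp i hi h₄ p (comp j hj h₃ q r)
  comp_par : ∀ {a b c ab ac abc : ℕ} (i j j' : ℕ) (hij : i < j) (hj : j < a) (_hj' : j' + 1 = j + b)
    (h₁ : ab + 1 = a + b) (h₂ : abc + 1 = ab + c) (h₃ : ac + 1 = a + c) (h₄ : abc + 1 = ac + b)
    (hjab : j' < ab) (hiac : i < ac) (p : obj a) (q : obj b) (r : obj c),
    comp j' hjab h₂ (comp i (hij.trans hj) h₁ p q) r = comp i hiac h₄ (comp j hj h₃ p r) q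

attribute [instance] NSOperad.addCommGroup NSOperad.module

/-! ### The free operad on binary generators -/

/-- Planar binary trees with vertices labelled by `X`. -/
inductive BTree (X : Type w) : Type w
  | leaf : BTree X
  | node (x : X) (l r : BTree X) : BTree X

namespace BTree

variable {X : Type w}

/-- The number of leaves. -/
def leaves : BTree X → ℕ
  | leaf => 1
  | node _ l r => l.leaves + r.leaves

/-- `graft t i s` replaces the `i`-th leaf of `t` (from the left, starting at `0`) by `s`. -/
def graft : BTree X → ℕ → BTree X → BTree X
  | leaf, _, s => s
  | node x l r, i, s =>
    if i < l.leaves then node x (graft l i s) r else node x l (graft r (i - l.leaves) s)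

lemma leaves_pos (t : BTree X) : 0 < t.leaves := by
  induction t with
  | leaf => exact one_pos
  | node x l r hl hr => simp only [leaves]; omega

lemma leaves_graft (t s : BTree X) (i : ℕ) (hi : i < t.leaves) :
    (t.graft i s).leaves + 1 = t.leaves + s.leaves := by
  induction t generalizing i with
  | leaf => simp only [graft, leaves]; omega
  | node x l r hl hr =>
    simp only [leaves] at hi
    simp only [graft]
    split_ifs with h
    · have := hl i h
      simp only [leaves]; omega
    · have := hr (i - l.leaves) (by omega)
      simp only [leaves]; omega

lemma graft_leaf (t : BTree X) (i : ℕ) (hi : i < t.leaves) : t.graft i leaf = t := by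
  induction t generalizing i with
  | leaf => rfl
  | node x l r hl hr =>
    simp only [leaves] at hi
    simp only [graft]
    split_ifs with h
    · rw [hl i h]
    · rw [hr _ (by omega)]

lemma graft_seq (p q r : BTree X) (i j : ℕ) (hi : i < p.leaves) (hj : j < q.leaves) :
    (p.graft i q).graft (i + j) r = p.graft i (q.graft j r) := by
  induction p generalizing i with
  | leaf =>
    simp only [leaves] at hi
    obtain rfl : i = 0 := by omega
    simp only [graft, zero_add]
  | node x l r' hl hr =>
    simp only [leaves] at hi
    by_cases h : i < l.leaves
    · have e := leaves_graft l q i h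
      simp only [graft, h, if_true]
      rw [if_pos (by omega), hl i h]
    · simp only [graft, h, if_false]
      rw [if_neg (by omega), ← hr _ (by omega)]
      congr 2
      omega

lemma graft_par (p q r : BTree X) (i j j' : ℕ) (hij : i < j) (hj : j < p.leaves)
    (hj' : j' + 1 = j + q.leaves) :
    (p.graft i q).graft j' r = (p.graft j r).graft i q := by
  have hq := q.leaves_pos
  have hr' := r.leaves_pos
  induction p generalizing i j j' with
  | leaf => simp only [leaves] at hj; omega
  | node x l s hl hs =>
    simp only [leaves] at hj
    by_cases h : i < l.leaves
    · have e := leaves_graft l q i h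
      by_cases h2 : j < l.leaves
      · have e2 := leaves_graft l r j h2
        simp only [graft, h, h2, if_true]
        rw [if_pos (by omega), if_pos (by omega), hl i j j' hij h2 hj']
      · simp only [graft, h, h2, if_true, if_false]
        rw [if_neg (by omega)]
        congr 2
        omega
    · have h2 : ¬ j < l.leaves := by omega
      simp only [graft, h, h2, if_false]
      rw [if_neg (by omega), hs (i - l.leaves) (j - l.leaves) (j' - l.leaves) (by omega)
        (by omega) (by omega)]

lemma finite_leaves_le [Finite X] (n : ℕ) : {t : BTree X | t.leaves ≤ n}.Finite := by
  induction n with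
  | zero =>
    convert Set.finite_empty (α := BTree X)
    ext t
    have := t.leaves_pos
    simp only [Set.mem_ofPred_eq, Set.mem_empty_iff_false, iff_false]
    omega
  | succ n ih =>
    have h : ((fun a : X × BTree X × BTree X => node a.1 a.2.1 a.2.2) ''
        (Set.univ ×ˢ {t : BTree X | t.leaves ≤ n} ×ˢ {t : BTree X | t.leaves ≤ n})).Finite :=
      (Set.finite_univ.prod (ih.prod ih)).image _
    refine (h.insert leaf).subset ?_
    intro t ht
    cases t with
    | leaf => exact Set.mem_insert _ _
    | node x l r =>
      have h1 := l.leaves_pos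
      have h2 := r.leaves_pos
      simp only [Set.mem_ofPred_eq, leaves] at ht
      refine Set.mem_insert_of_mem _ ⟨(x, l, r), ?_, rfl⟩
      simp only [Set.mem_prod, Set.mem_univ, Set.mem_ofPred_eq, true_and]
      omega

instance [Finite X] (n : ℕ) : Finite {t : BTree X // t.leaves = n} :=
  ((finite_leaves_le n).subset fun _ ht => le_of_eq ht).to_subtype

end BTree

noncomputable section

namespace FreeOp

variable (k : Type u) [Field k] (X : Type w)

/-- Arity `n` of the free non-symmetric operad on the space of binary operations with basis `X`:
it has as basis the planar binary trees with `n` leaves and with vertices labelled by `X`. -/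
abbrev Obj (n : ℕ) : Type (max u w) := {t : BTree X // t.leaves = n} →₀ k

variable {X}

/-- The basis vector of a labelled tree. -/
def mono {n : ℕ} (t : BTree X) (h : t.leaves = n) : Obj k X n := Finsupp.single ⟨t, h⟩ 1

variable {k}

/-- Partial composition: the bilinear extension of grafting. -/
def comp {m n l : ℕ} (i : ℕ) (hi : i < m) (h : l + 1 = m + n) :
    Obj k X m →ₗ[k] Obj k X n →ₗ[k] Obj k X l :=
  Finsupp.linearCombination k fun t => Finsupp.linearCombination k fun s =>
    mono k (t.1.graft i s.1) (by
      have := BTree.leaves_graft t.1 s.1 i (t.2.symm ▸ hi)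
      rw [t.2, s.2] at this
      omega)

lemma comp_single {m n l : ℕ} (i : ℕ) (hi : i < m) (h : l + 1 = m + n)
    (t : {t : BTree X // t.leaves = m}) (s : {t : BTree X // t.leaves = n}) (a b : k)
    (h' : (t.1.graft i s.1).leaves = l) :
    comp i hi h (Finsupp.single t a) (Finsupp.single s b) =
      Finsupp.single ⟨t.1.graft i s.1, h'⟩ (a * b) := by
  simp [comp, mono, Finsupp.linearCombination_single]

lemma leaves_graft' {m n l : ℕ} {i : ℕ} (hi : i < m) (h : l + 1 = m + n)
    (t : {t : BTree X // t.leaves = m}) (s : {t : BTree X // t.leaves = n}) :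
    (t.1.graft i s.1).leaves = l := by
  have := BTree.leaves_graft t.1 s.1 i (t.2.symm ▸ hi)
  rw [t.2, s.2] at this
  omega

end FreeOp

/-! ### Binary quadratic operads -/

/-- The data `(Ω, Λ)` of a binary quadratic operad whose space `Ω` of binary operations has the
basis `X`.  The space `rel = Λ ⊆ Ω^{⊗2} ⊕ Ω^{⊗2}` consists of pairs `(u, v)`, written in the
coordinates `X × X`; such a pair stands for the relation
`∑ u(a, b) (x a y) b z = ∑ v(a, b) x a (y b z)`. -/
structure BinQuadData (k : Type u) [Field k] (X : Type w) where
  rel : Submodule k ((X × X → k) × (X × X → k))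

namespace BinQuadData

variable {k : Type u} [Field k] {X : Type w}

/-- The black square product `P(Ω ⊗ Ω', S₂₃(Λ ⊗ Λ'))`: pairs of operations, with pairs of
relations imposed on them. -/
def blackSquare {Y : Type w} (Q : BinQuadData k X) (Q' : BinQuadData k Y) :
    BinQuadData k (X × Y) where
  rel := Submodule.span k {f | ∃ r ∈ Q.rel, ∃ r' ∈ Q'.rel,
    f = (fun ab => r.1 (ab.1.1, ab.2.1) * r'.1 (ab.1.2, ab.2.2),
      fun ab => r.2 (ab.1.1, ab.2.1) * r'.2 (ab.1.2, ab.2.2))}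

variable [Fintype X]

/-- The element `∑ u(a, b) (x a y) b z - ∑ v(a, b) x a (y b z)` of the free operad. -/
def relator (u v : X × X → k) : FreeOp.Obj k X 3 :=
  ∑ ab : X × X, (u ab • FreeOp.mono (n := 3) k (.node ab.2 (.node ab.1 .leaf .leaf) .leaf) rfl -
    v ab • FreeOp.mono (n := 3) k (.node ab.1 .leaf (.node ab.2 .leaf .leaf)) rfl)

/-- Membership in the operadic ideal generated by the relations. -/
inductive MemIdeal (Q : BinQuadData k X) : ∀ n : ℕ, FreeOp.Obj k X n → Prop
  | rel (u v : X × X → k) (h : (u, v) ∈ Q.rel) : MemIdeal Q 3 (relator u v)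
  | zero (n : ℕ) : MemIdeal Q n 0
  | add {n : ℕ} {p q : FreeOp.Obj k X n} : MemIdeal Q n p → MemIdeal Q n q → MemIdeal Q n (p + q)
  | smul {n : ℕ} (a : k) {p : FreeOp.Obj k X n} : MemIdeal Q n p → MemIdeal Q n (a • p)
  | comp_left {m n l : ℕ} (i : ℕ) (hi : i < m) (h : l + 1 = m + n) {p : FreeOp.Obj k X m}
      (q : FreeOp.Obj k X n) : MemIdeal Q m p → MemIdeal Q l (FreeOp.comp i hi h p q)
  | comp_right {m n l : ℕ} (i : ℕ) (hi : i < m) (h : l + 1 = m + n) (p : FreeOp.Obj k X m)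
      {q : FreeOp.Obj k X n} : MemIdeal Q n q → MemIdeal Q l (FreeOp.comp i hi h p q)

variable (Q : BinQuadData k X)

/-- The operadic ideal generated by the relations, in arity `n`. -/
def ideal (n : ℕ) : Submodule k (FreeOp.Obj k X n) where
  carrier := {p | MemIdeal Q n p}
  add_mem' := MemIdeal.add
  zero_mem' := MemIdeal.zero n
  smul_mem' a _ := MemIdeal.smul a

/-- Partial composition in the quotient of the free operad by the ideal of relations. -/
def quotComp {m n l : ℕ} (i : ℕ) (hi : i < m) (h : l + 1 = m + n) :
    (FreeOp.Obj k X m ⧸ Q.ideal m) →ₗ[k] (FreeOp.Obj k X n ⧸ Q.ideal n) →ₗ[k]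
      (FreeOp.Obj k X l ⧸ Q.ideal l) :=
  (Q.ideal m).liftQ
    { toFun := fun p => (Q.ideal n).mapQ (Q.ideal l) (FreeOp.comp i hi h p)
        fun _ hq => MemIdeal.comp_right i hi h p hq
      map_add' := fun p p' => by
        refine LinearMap.ext fun q => ?_
        obtain ⟨q, rfl⟩ := Submodule.Quotient.mk_surjective _ q
        simp
        rfl
      map_smul' := fun a p => by
        refine LinearMap.ext fun q => ?_
        obtain ⟨q, rfl⟩ := Submodule.Quotient.mk_surjective _ q
        simp
        rfl }
    (by
      intro p hp
      rw [LinearMap.mem_ker]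
      refine LinearMap.ext fun q => ?_
      obtain ⟨q, rfl⟩ := Submodule.Quotient.mk_surjective _ q
      exact (Submodule.Quotient.mk_eq_zero _).2 (MemIdeal.comp_left i hi h q hp))

lemma quotComp_mk {m n l : ℕ} (i : ℕ) (hi : i < m) (h : l + 1 = m + n)
    (p : FreeOp.Obj k X m) (q : FreeOp.Obj k X n) :
    Q.quotComp i hi h (Submodule.Quotient.mk p) (Submodule.Quotient.mk q) =
      Submodule.Quotient.mk (FreeOp.comp i hi h p q) := rfl

/-- The binary quadratic operad `P(Ω, Λ)`: the free operad on `Ω` modulo the operadic ideal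
generated by `Λ`. -/
def operad : NSOperad.{u, max u w} k where
  obj n := FreeOp.Obj k X n ⧸ Q.ideal n
  one := Submodule.Quotient.mk (FreeOp.mono k .leaf rfl)
  comp := Q.quotComp
  one_comp := by
    intro n q
    obtain ⟨q, rfl⟩ := Submodule.Quotient.mk_surjective _ q
    rw [quotComp_mk]
    congr 1
    induction q using Finsupp.induction_linear with
    | zero => simp
    | add f g hf hg => rw [map_add, hf, hg]
    | single s b =>
      refine (FreeOp.comp_single 0 _ _ ⟨.leaf, rfl⟩ s 1 b s.2).trans ?_
      rw [one_mul]
      rfl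
  comp_one := by
    intro m i hi p
    obtain ⟨p, rfl⟩ := Submodule.Quotient.mk_surjective _ p
    rw [quotComp_mk]
    congr 1
    induction p using Finsupp.induction_linear with
    | zero => simp
    | add f g hf hg => rw [map_add, LinearMap.add_apply, hf, hg]
    | single s b =>
      have e : s.1.graft i .leaf = s.1 := BTree.graft_leaf s.1 i (s.2.symm ▸ hi)
      refine (FreeOp.comp_single i hi _ s ⟨.leaf, rfl⟩ b 1 (by rw [e, s.2])).trans ?_
      rw [mul_one]
      congr 1
      exact Subtype.ext e
  comp_seq := by
    intro a b c ab bc abc i j hi hj h₁ h₂ h₃ h₄ hij p q r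
    obtain ⟨p, rfl⟩ := Submodule.Quotient.mk_surjective _ p
    obtain ⟨q, rfl⟩ := Submodule.Quotient.mk_surjective _ q
    obtain ⟨r, rfl⟩ := Submodule.Quotient.mk_surjective _ r
    simp only [quotComp_mk]
    congr 1
    induction p using Finsupp.induction_linear with
    | zero => simp
    | add f g hf hg => simp only [map_add, LinearMap.add_apply, hf, hg]
    | single p x =>
      induction q using Finsupp.induction_linear with
      | zero => simp
      | add f g hf hg => simp only [map_add, LinearMap.add_apply, hf, hg]
      | single q y =>
        induction r using Finsupp.induction_linear with
        | zero => simp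
        | add f g hf hg => simp only [map_add, hf, hg]
        | single r z =>
          rw [FreeOp.comp_single i hi h₁ p q x y (FreeOp.leaves_graft' hi h₁ p q),
            FreeOp.comp_single j hj h₃ q r y z (FreeOp.leaves_graft' hj h₃ q r),
            FreeOp.comp_single (i + j) hij h₂ _ r _ z (FreeOp.leaves_graft' hij h₂ _ r),
            FreeOp.comp_single i hi h₄ p _ x _ (FreeOp.leaves_graft' hi h₄ p _), mul_assoc]
          congr 1
          exact Subtype.ext (BTree.graft_seq p.1 q.1 r.1 i j (p.2.symm ▸ hi) (q.2.symm ▸ hj))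
  comp_par := by
    intro a b c ab ac abc i j j' hij hj hj' h₁ h₂ h₃ h₄ hjab hiac p q r
    obtain ⟨p, rfl⟩ := Submodule.Quotient.mk_surjective _ p
    obtain ⟨q, rfl⟩ := Submodule.Quotient.mk_surjective _ q
    obtain ⟨r, rfl⟩ := Submodule.Quotient.mk_surjective _ r
    simp only [quotComp_mk]
    congr 1
    induction p using Finsupp.induction_linear with
    | zero => simp
    | add f g hf hg => simp only [map_add, LinearMap.add_apply, hf, hg]
    | single p x =>
      induction q using Finsupp.induction_linear with
      | zero => simp
      | add f g hf hg => simp only [map_add, LinearMap.add_apply, hf, hg]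
      | single q y =>
        induction r using Finsupp.induction_linear with
        | zero => simp
        | add f g hf hg => simp only [map_add, LinearMap.add_apply, hf, hg]
        | single r z =>
          have hi : i < a := hij.trans hj
          rw [FreeOp.comp_single i hi h₁ p q x y (FreeOp.leaves_graft' hi h₁ p q),
            FreeOp.comp_single j hj h₃ p r x z (FreeOp.leaves_graft' hj h₃ p r),
            FreeOp.comp_single j' hjab h₂ _ r _ z (FreeOp.leaves_graft' hjab h₂ _ r),
            FreeOp.comp_single i hiac h₄ _ q _ y (FreeOp.leaves_graft' hiac h₄ _ q),
            mul_right_comm]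
          congr 1
          exact Subtype.ext (BTree.graft_par p.1 q.1 r.1 i j j' hij (p.2.symm ▸ hj)
            (q.2.symm ▸ hj'))

/-- The quadratic dual `P(Ω^∨, Λ^⊥)`, in the basis of `Ω^∨` dual to `X`.  The pairing of
`Ω^{⊗2} ⊕ Ω^{⊗2}` with its dual is the evaluation pairing on the first summand and minus the
evaluation pairing on the second one. -/
def dual : BinQuadData k X where
  rel :=
    { carrier := {f | ∀ r ∈ Q.rel, ∑ ab, f.1 ab * r.1 ab - ∑ ab, f.2 ab * r.2 ab = 0}
      add_mem' := fun {f g} hf hg r hr => by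
        have h1 := hf r hr
        have h2 := hg r hr
        simp only [Prod.fst_add, Prod.snd_add, Pi.add_apply, add_mul, Finset.sum_add_distrib]
        linear_combination h1 + h2
      zero_mem' := fun r _ => by simp
      smul_mem' := fun a f hf r hr => by
        have h1 := hf r hr
        simp only [Prod.smul_fst, Prod.smul_snd, Pi.smul_apply, smul_eq_mul, mul_assoc,
          ← Finset.mul_sum]
        linear_combination a * h1 }

end BinQuadData

/-! ### The bar complex -/

/-- Reduced planar trees (all vertices have at least two inputs) in which every vertex with `l`
inputs is decorated by an element of `P(l)`. -/
inductive DTree {k : Type u} [Field k] (P : NSOperad.{u, w} k) : Type w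
  | leaf : DTree P
  | node (m : ℕ) (p : P.obj (m + 2)) (c : Fin (m + 2) → DTree P) : DTree P

namespace DTree

variable {k : Type u} [Field k] {P : NSOperad.{u, w} k}

/-- The number of leaves. -/
def leaves : DTree P → ℕ
  | leaf => 1
  | node _ _ c => ∑ i, (c i).leaves

/-- The number of vertices. -/
def vertices : DTree P → ℕ
  | leaf => 0
  | node _ _ c => 1 + ∑ i, (c i).vertices

/-- The degree of a tree; a vertex with `l` inputs has degree `l - 2`. -/
def deg : DTree P → ℕ
  | leaf => 0
  | node m _ c => m + ∑ i, (c i).deg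

/-- `IsLinComb a b t t₁ t₂`: the three trees agree except for the decorations `p, p₁, p₂` of one
vertex, and these satisfy `p = a p₁ + b p₂`. -/
inductive IsLinComb (a b : k) : DTree P → DTree P → DTree P → Prop
  | root (m : ℕ) (p₁ p₂ : P.obj (m + 2)) (c : Fin (m + 2) → DTree P) :
      IsLinComb a b (node m (a • p₁ + b • p₂) c) (node m p₁ c) (node m p₂ c)
  | child (m : ℕ) (p : P.obj (m + 2)) (c : Fin (m + 2) → DTree P) (i : Fin (m + 2))
      {t t₁ t₂ : DTree P} : IsLinComb a b t t₁ t₂ →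
      IsLinComb a b (node m p (Function.update c i t)) (node m p (Function.update c i t₁))
        (node m p (Function.update c i t₂))

/-- The inputs of the vertex obtained by contracting the edge that joins a vertex with inputs `c`
to its `i`-th input, when the latter is a vertex with inputs `e`: the `i`-th entry of `c` is
replaced by the sequence `e`. -/
def mergeInputs {α : Type w} {m s : ℕ} (c : Fin (m + 2) → α) (i : Fin (m + 2))
    (e : Fin (s + 2) → α) : Fin (m + s + 1 + 2) → α := fun j =>
  if h₁ : j.1 < i.1 then c ⟨j.1, h₁.trans i.2⟩
  else if h₂ : j.1 < i.1 + (s + 2) then e ⟨j.1 - i.1, by omega⟩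
  else c ⟨j.1 - (s + 1), by omega⟩

/-- Contraction of the edge between the root (with decoration `p` and inputs `c`) and the vertex
(with decoration `q` and inputs `e`) that is its `i`-th input. -/
def contractRoot {m s : ℕ} (p : P.obj (m + 2)) (c : Fin (m + 2) → DTree P) (i : Fin (m + 2))
    (q : P.obj (s + 2)) (e : Fin (s + 2) → DTree P) : DTree P :=
  node (m + s + 1) (P.comp i.1 i.2 (by omega) p q) (mergeInputs c i e)

/-- The total degree of the inputs to the left of the `i`-th one. -/
def degBefore {m : ℕ} (c : Fin (m + 2) → DTree P) (i : Fin (m + 2)) : ℕ :=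
  ∑ j ∈ Finset.univ.filter (· < i), (c j).deg

/-- The value at the tree `t` of the differential of `φ`: the signed sum of the values of `φ` at
the trees obtained from `t` by contracting one internal edge.

The signs are those of the free graded operad on `P(l)^*`, placed in degree `l - 2`, with the
derivation given on generators by the dual of
`∑ (-1)^(r + s t) (p ∘_r q)`, where `p` has `r + 1 + t` inputs and `q` has `s` inputs. -/
def dEval : DTree P → (DTree P → k) → k
  | leaf, _ => 0
  | node m p c, φ => ∑ i : Fin (m + 2),
      ((match c i with
        | leaf => 0
        | node s q e => (-1) ^ (i.1 + (s + 2) * (m + 1 - i.1) + s * degBefore c i) *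
            φ (contractRoot p c i q e)) +
        (-1) ^ (m + degBefore c i) * dEval (c i) fun t => φ (node m p (Function.update c i t)))

lemma dEval_add (t : DTree P) (φ ψ : DTree P → k) :
    dEval t (φ + ψ) = dEval t φ + dEval t ψ := by
  induction t generalizing φ ψ with
  | leaf => simp [dEval]
  | node m p c ih =>
    simp only [dEval]
    rw [← Finset.sum_add_distrib]
    refine Finset.sum_congr rfl fun i _ => ?_
    have h := ih i (fun t => φ (node m p (Function.update c i t)))
      (fun t => ψ (node m p (Function.update c i t)))
    have h' : dEval (c i) (fun t => (φ + ψ) (node m p (Function.update c i t))) = _ := h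
    rw [h']
    cases c i with
    | leaf => simp only; ring
    | node s q e => simp only [Pi.add_apply]; ring

lemma dEval_smul (t : DTree P) (a : k) (φ : DTree P → k) :
    dEval t (a • φ) = a * dEval t φ := by
  induction t generalizing φ with
  | leaf => simp [dEval]
  | node m p c ih =>
    simp only [dEval]
    rw [Finset.mul_sum]
    refine Finset.sum_congr rfl fun i _ => ?_
    have h := ih i (fun t => φ (node m p (Function.update c i t)))
    have h' : dEval (c i) (fun t => (a • φ) (node m p (Function.update c i t))) = _ := h
    rw [h']
    cases c i with
    | leaf => simp only; ring
    | node s q e => simp only [Pi.smul_apply, smul_eq_mul]; ring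

/-- A function on decorated trees is multilinear if it is linear in the decoration of each
vertex. -/
def IsMultilin (φ : DTree P → k) : Prop :=
  ∀ (a b : k) (t t₁ t₂ : DTree P), IsLinComb a b t t₁ t₂ → φ t = a * φ t₁ + b * φ t₂

lemma IsLinComb.deg_eq {a b : k} {t t₁ t₂ : DTree P} (h : IsLinComb a b t t₁ t₂) :
    t₁.deg = t.deg ∧ t₂.deg = t.deg := by
  induction h with
  | root m p₁ p₂ c => simp [deg]
  | child m p c i h ih =>
    simp only [deg]
    constructor <;> congr 1 <;> refine Finset.sum_congr rfl fun j _ => ?_ <;>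
      by_cases hj : j = i
    · subst hj; simp [ih.1]
    · simp [hj]
    · subst hj; simp [ih.2]
    · simp [hj]

lemma degBefore_update_eq {m : ℕ} (c : Fin (m + 2) → DTree P) (i j : Fin (m + 2))
    {t t' : DTree P} (h : t'.deg = t.deg) :
    degBefore (Function.update c i t') j = degBefore (Function.update c i t) j := by
  refine Finset.sum_congr rfl fun l _ => ?_
  by_cases hl : l = i
  · subst hl; simp [h]
  · simp [hl]

lemma mergeInputs_update_right {α : Type w} {m s : ℕ} (c : Fin (m + 2) → α) (i : Fin (m + 2))
    (e : Fin (s + 2) → α) (j : Fin (s + 2)) (t : α) :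
    mergeInputs c i (Function.update e j t) =
      Function.update (mergeInputs c i e) ⟨i.1 + j.1, by omega⟩ t := by
  funext x
  simp only [mergeInputs, Function.update_apply, Fin.ext_iff]
  grind

lemma mergeInputs_update_same {α : Type w} {m s : ℕ} (c : Fin (m + 2) → α) (i : Fin (m + 2))
    (e : Fin (s + 2) → α) (t : α) :
    mergeInputs (Function.update c i t) i e = mergeInputs c i e := by
  funext x
  simp only [mergeInputs, Function.update_apply, Fin.ext_iff]
  grind

lemma mergeInputs_update_ne {α : Type w} {m s : ℕ} (c : Fin (m + 2) → α) (i j : Fin (m + 2))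
    (hij : j ≠ i) (e : Fin (s + 2) → α) :
    ∃ j', ∀ t : α, mergeInputs (Function.update c j t) i e =
      Function.update (mergeInputs c i e) j' t := by
  have hij' : j.1 ≠ i.1 := fun h => hij (Fin.ext h)
  refine ⟨if j.1 < i.1 then ⟨j.1, by omega⟩ else ⟨j.1 + (s + 1), by omega⟩, fun t => ?_⟩
  funext x
  simp only [mergeInputs, Function.update_apply, Fin.ext_iff]
  grind

lemma IsMultilin.dEval {φ : DTree P → k} (hφ : IsMultilin φ) :
    IsMultilin fun t => DTree.dEval t φ := by
  intro a b t t₁ t₂ h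
  show DTree.dEval t φ = a * DTree.dEval t₁ φ + b * DTree.dEval t₂ φ
  induction h generalizing φ with
  | root m p₁ p₂ c =>
    simp only [DTree.dEval]
    rw [Finset.mul_sum, Finset.mul_sum, ← Finset.sum_add_distrib]
    refine Finset.sum_congr rfl fun i _ => ?_
    have e : (fun t => φ (node m (a • p₁ + b • p₂) (Function.update c i t))) =
        a • (fun t => φ (node m p₁ (Function.update c i t))) +
          b • (fun t => φ (node m p₂ (Function.update c i t))) := by
      funext t
      exact hφ a b _ _ _ (IsLinComb.root m p₁ p₂ _)
    rw [e, dEval_add, dEval_smul, dEval_smul]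
    cases c i with
    | leaf => simp only; ring
    | node s q e =>
      have e' : φ (contractRoot (a • p₁ + b • p₂) c i q e) =
          a * φ (contractRoot p₁ c i q e) + b * φ (contractRoot p₂ c i q e) := by
        simp only [contractRoot, map_add, map_smul, LinearMap.add_apply, LinearMap.smul_apply]
        exact hφ a b _ _ _ (IsLinComb.root _ _ _ _)
      simp only [e']; ring
  | @child m p c i t t₁ t₂ h ih =>
    simp only [DTree.dEval]
    rw [Finset.mul_sum, Finset.mul_sum, ← Finset.sum_add_distrib]
    refine Finset.sum_congr rfl fun j _ => ?_
    rw [degBefore_update_eq c i j h.deg_eq.1, degBefore_update_eq c i j h.deg_eq.2]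
    generalize degBefore (Function.update c i t) j = D
    by_cases hj : j = i
    · subst hj
      simp only [Function.update_self, Function.update_idem]
      rw [ih (φ := fun t => φ (node m p (Function.update c j t)))
        fun a b t t₁ t₂ h => hφ a b _ _ _ (IsLinComb.child m p c j h)]
      cases h with
      | root s q₁ q₂ e =>
        have e' : φ (contractRoot p (Function.update c j (node s (a • q₁ + b • q₂) e)) j
            (a • q₁ + b • q₂) e) =
            a * φ (contractRoot p (Function.update c j (node s q₁ e)) j q₁ e) +
            b * φ (contractRoot p (Function.update c j (node s q₂ e)) j q₂ e) := by
          simp only [contractRoot, map_add, map_smul, mergeInputs_update_same]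
          exact hφ a b _ _ _ (IsLinComb.root _ _ _ _)
        simp only [e']; ring
      | @child s q e x t t₁ t₂ h =>
        have e' : φ (contractRoot p (Function.update c j (node s q (Function.update e x t))) j
            q (Function.update e x t)) =
            a * φ (contractRoot p (Function.update c j (node s q (Function.update e x t₁))) j
              q (Function.update e x t₁)) +
            b * φ (contractRoot p (Function.update c j (node s q (Function.update e x t₂))) j
              q (Function.update e x t₂)) := by
          simp only [contractRoot, mergeInputs_update_same, mergeInputs_update_right]
          exact hφ a b _ _ _ (IsLinComb.child _ _ _ _ h)
        simp only [e']; ring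
    · have hji : i ≠ j := fun h => hj h.symm
      simp only [Function.update_of_ne hj]
      have e : (fun u => φ (node m p (Function.update (Function.update c i t) j u))) =
          a • (fun u => φ (node m p (Function.update (Function.update c i t₁) j u))) +
          b • (fun u => φ (node m p (Function.update (Function.update c i t₂) j u))) := by
        funext u
        simp only [Pi.add_apply, Pi.smul_apply, smul_eq_mul, Function.update_comm hji]
        exact hφ a b _ _ _ (IsLinComb.child _ _ _ _ h)
      rw [e, dEval_add, dEval_smul, dEval_smul]
      cases c j with
      | leaf => simp only; ring
      | node s q e =>
        obtain ⟨j', hj'⟩ := mergeInputs_update_ne c j i hji e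
        have e' : φ (contractRoot p (Function.update c i t) j q e) =
            a * φ (contractRoot p (Function.update c i t₁) j q e) +
            b * φ (contractRoot p (Function.update c i t₂) j q e) := by
          simp only [contractRoot, hj']
          exact hφ a b _ _ _ (IsLinComb.child _ _ _ _ h)
        simp only [e']; ring

lemma sum_mergeInputs {α : Type w} {m s : ℕ} (f : α → ℕ) (c : Fin (m + 2) → α)
    (i : Fin (m + 2)) (e : Fin (s + 2) → α) :
    ∑ j, f (mergeInputs c i e j) + f (c i) = ∑ j, f (c j) + ∑ j, f (e j) := by
  obtain ⟨i, hi⟩ := i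
  obtain ⟨r, hr⟩ : ∃ r, m + 2 = i + 1 + r := ⟨m + 1 - i, by omega⟩
  let C : ℕ → ℕ := fun j => if h : j < m + 2 then f (c ⟨j, h⟩) else 0
  let E : ℕ → ℕ := fun j => if h : j < s + 2 then f (e ⟨j, h⟩) else 0
  let G : ℕ → ℕ := fun j => if j < i then C j else if j < i + (s + 2) then E (j - i)
    else C (j - (s + 1))
  have hC : ∑ j, f (c j) = ∑ j ∈ Finset.range (m + 2), C j := by
    rw [← Fin.sum_univ_eq_sum_range]
    exact Finset.sum_congr rfl fun j _ => by simp [C]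
  have hE : ∑ j, f (e j) = ∑ j ∈ Finset.range (s + 2), E j := by
    rw [← Fin.sum_univ_eq_sum_range]
    exact Finset.sum_congr rfl fun j _ => by simp [E]
  have hG : ∑ j, f (mergeInputs c ⟨i, hi⟩ e j) = ∑ j ∈ Finset.range (m + s + 1 + 2), G j := by
    rw [← Fin.sum_univ_eq_sum_range]
    refine Finset.sum_congr rfl fun j _ => ?_
    simp only [mergeInputs, G, C, E]
    grind
  have hCi : f (c ⟨i, hi⟩) = C i := by simp [C, hi]
  rw [hC, hE, hG, hCi, show m + s + 1 + 2 = i + (s + 2) + r by omega, hr,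
    Finset.sum_range_add, Finset.sum_range_add, Finset.sum_range_add C, Finset.sum_range_succ C]
  have h1 : ∑ x ∈ Finset.range i, G x = ∑ x ∈ Finset.range i, C x :=
    Finset.sum_congr rfl fun x hx => by simp [G, Finset.mem_range.1 hx]
  have h2 : ∑ x ∈ Finset.range (s + 2), G (i + x) = ∑ x ∈ Finset.range (s + 2), E x :=
    Finset.sum_congr rfl fun x hx => by simp [G, Finset.mem_range.1 hx]
  have h3 : ∑ x ∈ Finset.range r, G (i + (s + 2) + x) = ∑ x ∈ Finset.range r, C (i + 1 + x) :=
    Finset.sum_congr rfl fun x hx => by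
      simp only [G]
      rw [if_neg (by omega), if_neg (by omega)]
      congr 1
      omega
  omega

lemma dEval_eq_zero (t : DTree P) (φ : DTree P → k)
    (h : ∀ t', t'.leaves = t.leaves → t'.vertices + 1 = t.vertices → φ t' = 0) :
    dEval t φ = 0 := by
  induction t generalizing φ with
  | leaf => rfl
  | node m p c ih =>
    simp only [dEval]
    refine Finset.sum_eq_zero fun i _ => ?_
    rw [ih i, mul_zero, add_zero]
    · have hc : ∀ s q e, c i = node s q e → φ (contractRoot p c i q e) = 0 := by
        intro s q e hi
        have h1 := sum_mergeInputs leaves c i e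
        have h2 := sum_mergeInputs vertices c i e
        rw [hi] at h1 h2
        simp only [leaves, vertices] at h1 h2
        refine h _ ?_ ?_ <;> simp only [contractRoot, leaves, vertices] <;> omega
      revert hc
      cases c i with
      | leaf => intro _; rfl
      | node s q e => intro hc; simp only [hc s q e rfl, mul_zero]
    · intro t' h1 h2
      have key : ∀ f : DTree P → ℕ, ∑ j, f (Function.update c i t' j) + f (c i) =
          ∑ j, f (c j) + f t' := by
        intro f
        rw [← Finset.add_sum_erase _ _ (Finset.mem_univ i),
          ← Finset.add_sum_erase _ (fun j => f (c j)) (Finset.mem_univ i)]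
        rw [Finset.sum_congr rfl fun j hj => by
          rw [Function.update_of_ne (Finset.ne_of_mem_erase hj)]]
        rw [Function.update_self]
        omega
      have k1 := key leaves
      have k2 := key vertices
      refine h _ ?_ ?_ <;> simp only [leaves, vertices] <;> omega

end DTree

namespace NSOperad

variable {k : Type u} [Field k] (P : NSOperad.{u, w} k)

/-- The part of arity `n` and homological degree `i` of the (dual) bar complex of `P`, that is of
the free operad on the linear duals of the `P(l)`, `l ≥ 2`: the direct sum over the reduced planar
trees `T` with `n` leaves and `n - 1 - i` vertices of the spaces `(⨂_v P(l_v))^*`, where `v` runs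
over the vertices of `T` and `l_v` is the number of inputs of `v`.  Its elements are described as
the functions on decorated trees that are multilinear in the decorations and vanish on the trees
with another number of leaves or vertices. -/
def bar (n i : ℕ) : Submodule k (DTree P → k) where
  carrier := {φ | DTree.IsMultilin φ ∧
    ∀ t, ¬ (t.leaves = n ∧ t.vertices + i + 1 = n) → φ t = 0}
  add_mem' := fun {φ ψ} hφ hψ => ⟨fun a b t t₁ t₂ h => by
      simp only [Pi.add_apply, hφ.1 a b t t₁ t₂ h, hψ.1 a b t t₁ t₂ h]; ring,
    fun t ht => by simp only [Pi.add_apply, hφ.2 t ht, hψ.2 t ht, add_zero]⟩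
  zero_mem' := ⟨fun a b t t₁ t₂ _ => by simp, fun t _ => rfl⟩
  smul_mem' := fun x φ hφ => ⟨fun a b t t₁ t₂ h => by
      simp only [Pi.smul_apply, smul_eq_mul, hφ.1 a b t t₁ t₂ h]; ring,
    fun t ht => by simp only [Pi.smul_apply, hφ.2 t ht, smul_zero]⟩

/-- The differential of the bar complex. -/
def barD (n i : ℕ) : P.bar n (i + 1) →ₗ[k] P.bar n i where
  toFun φ := ⟨fun t => t.dEval φ.1, φ.2.1.dEval, fun t ht => DTree.dEval_eq_zero t φ.1
    fun t' h₁ h₂ => φ.2.2 t' fun h => ht ⟨by omega, by omega⟩⟩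
  map_add' φ ψ := Subtype.ext (funext fun t => DTree.dEval_add t φ.1 ψ.1)
  map_smul' a φ := Subtype.ext (funext fun t => DTree.dEval_smul t a φ.1)

end NSOperad

/-! ### Koszulness -/

namespace BinQuadData

variable {k : Type u} [Field k] {X : Type w} [Fintype X] (Q : BinQuadData k X)

/-- A binary tree with vertices labelled by `X`, seen as a tree decorated by the binary operations
of the operad. -/
def toDTree : BTree X → DTree Q.operad
  | .leaf => .leaf
  | .node x l r => .node 0
      (Submodule.Quotient.mk (FreeOp.mono (n := 2) k (.node x .leaf .leaf) rfl) :
        FreeOp.Obj k X 2 ⧸ Q.ideal 2)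
      ![toDTree l, toDTree r]

/-- The augmentation of the bar complex.  In degree `0` the bar complex is the free operad on the
dual `Ω^∨` of the space of binary operations, and the augmentation is its projection onto the
quadratic dual operad `P(Ω^∨, Λ^⊥)`. -/
def barAug (n : ℕ) : Q.operad.bar n 0 →ₗ[k] Q.dual.operad.obj n :=
  (Q.dual.ideal n).mkQ ∘ₗ
    (Finsupp.linearEquivFunOnFinite k k {t : BTree X // t.leaves = n}).symm.toLinearMap ∘ₗ
    { toFun := fun φ t => φ.1 (Q.toDTree t.1)
      map_add' := fun _ _ => rfl
      map_smul' := fun _ _ => rfl }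

/-- A binary quadratic operad is Koszul if its bar complex is a resolution of the quadratic dual
operad: in every arity `n` the augmented complex
`⋯ → D(P)(n)₂ → D(P)(n)₁ → D(P)(n)₀ → P^!(n) → 0` is exact. -/
def IsKoszul : Prop :=
  ∀ n : ℕ, (∀ i : ℕ, Function.Exact (Q.operad.barD n (i + 1)) (Q.operad.barD n i)) ∧
    Function.Exact (Q.operad.barD n 0) (Q.barAug n) ∧ Function.Surjective (Q.barAug n)

end BinQuadData

/-! ### Dendriform algebras and quadri-algebras -/

/-- The two operations `≺` and `≻` of a dendriform algebra. -/
inductive DendOp : Type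
  | prec : DendOp
  | succ : DendOp
  deriving DecidableEq

instance : Fintype DendOp := ⟨{.prec, .succ}, fun x => by cases x <;> decide⟩

/-- The pair `(a, b)` of operations, as a basis vector of `Ω^{⊗2}`. -/
def opPair {k : Type u} [Field k] {X : Type w} [DecidableEq X] (a b : X) : X × X → k :=
  Pi.single (a, b) 1

/-- The operad of dendriform algebras, with the relations
`(x ≺ y) ≺ z = x ≺ (y ≺ z + y ≻ z)`, `(x ≻ y) ≺ z = x ≻ (y ≺ z)`,
`(x ≺ y + x ≻ y) ≻ z = x ≻ (y ≻ z)`. -/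
def dend (k : Type u) [Field k] : BinQuadData k DendOp where
  rel := Submodule.span k {
    (opPair .prec .prec, opPair .prec .prec + opPair .prec .succ),
    (opPair .succ .prec, opPair .succ .prec),
    (opPair .prec .succ + opPair .succ .succ, opPair .succ .succ)}

/-- The operad of quadri-algebras: the black square product of the dendriform operad with
itself. -/
def quad (k : Type u) [Field k] : BinQuadData k (DendOp × DendOp) :=
  (dend k).blackSquare (dend k)

end

/-! The proof is a PBW argument combined with an acyclic matching. In the dendriform operad the
basis `≺, ≻` is replaced by `≺` and `* = ≺ + ≻`. All left combs except `(x ≺ y) * z` then become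
combinations of right combs: `(x * y) * z = x * (y * z)`, `(x ≺ y) ≺ z = x ≺ (y * z)` and `(x * y) ≺
z = x ≺ (y * z) + x * (y ≺ z) - x ≺ (y ≺ z)`. This rewriting is confluent, and the identities
expressing this are sums of products of coefficients that factor over tensor products. They
therefore pass to the black square, where a pair of operations is bad if both of its components are
bad. Thus Quad has as basis the normal trees, those without bad left edges. Spanning comes from
rewriting; independence comes from an action of Quad on the span of all trees
(`CombRewriting.mul_mulTree`, `satisfiesRel_quadMul`). The outcome is `quadPBW`.

An element of the bar complex is determined by its values at trees whose vertices carry normal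
monomials. Composing all the monomials flattens such a tree to one binary tree. Contractions
preserve the flattened tree, while rewriting lowers its `weight`. The relation `MTree.Match` pairs a
decorated tree with the result of contracting one of its edges. To leading order for the weight the
differential is invertible along these pairs (`dEval_of_match`). The unpaired normal trees are the
left combs of binary vertices whose successive labels are all bad (`match_or_crit`), and these lie
in degree 0. Hence the complex is exact in positive degrees (`exact_barD`), and in degree 0 every
class has a representative that vanishes at all noncritical normal trees (`exists_sub_barD`).

Only the comparison with the quadratic dual remains. The augmentation kills boundaries because
linear forms on the arity 3 part are exactly what is orthogonal to the relations
(`sum_dEval_mem_totalIdeal`), and it is onto because the generators are independent. For injectivity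
on the critical trees, the dual acts on rows of leaves with two marked positions: each dendriform
relation collects the products whose mark lies in a given factor (`dend_rel_indicator`). In arity
`n` there are `n ^ 2` pairs of marks and as many critical trees, and the forms `markForm` separate
the latter (`LeftComb.markForm_algEval`). So a critical representative in the kernel of the
augmentation is zero (`eq_zero_of_barAug_eq_zero`). -/

/-! ### Monomials in the binary operations of an operad. -/

namespace NSOperad

variable {k : Type u} [Field k] (P : NSOperad.{u, w} k) {X : Type*}

lemma comp_congr {m n l i j : ℕ} (hij : i = j) (hi : i < m) (hj : j < m) (h : l + 1 = m + n)
    (p : P.obj m) (q : P.obj n) : P.comp i hi h p q = P.comp j hj h p q := by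
  subst hij; rfl

/-- The operation defined by a binary tree whose vertices are labelled by binary operations
of an operad. -/
def eval (ω : X → P.obj 2) : (t : BTree X) → (n : ℕ) → t.leaves = n → P.obj n
  | .leaf, _, h => h ▸ P.one
  | .node x l r, n, h =>
    P.comp (m := r.leaves + 1) (n := l.leaves) 0 (Nat.succ_pos _)
      (by simp only [BTree.leaves] at h; omega)
      (P.comp (n := r.leaves) 1 one_lt_two (by omega) (ω x) (eval ω r r.leaves rfl))
      (eval ω l l.leaves rfl)

lemma eval_node (ω : X → P.obj 2) (x : X) (l r : BTree X) {a b n : ℕ} (hl : l.leaves = a)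
    (hr : r.leaves = b) (h : (BTree.node x l r).leaves = n) :
    P.eval ω (.node x l r) n h = P.comp (m := b + 1) (n := a) 0 (Nat.succ_pos _)
      (by simp only [BTree.leaves] at h; omega)
      (P.comp (n := b) 1 one_lt_two (by omega) (ω x) (P.eval ω r b hr)) (P.eval ω l a hl) := by
  subst hl hr
  rfl

/-- For a graft into the left subtree `comp_seq` suffices; for one into the right subtree the
insertion must also be moved past the left subtree, which is `comp_par`. -/
lemma eval_graft (ω : X → P.obj 2) (t s : BTree X) {m n l : ℕ} (i : ℕ) (hi : i < m)
    (h : l + 1 = m + n) (ht : t.leaves = m) (hs : s.leaves = n)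
    (h' : (t.graft i s).leaves = l) :
    P.eval ω (t.graft i s) l h' = P.comp i hi h (P.eval ω t m ht) (P.eval ω s n hs) := by
  induction t generalizing m l i with
  | leaf =>
    subst ht
    simp only [BTree.leaves] at hi
    obtain rfl : i = 0 := by omega
    obtain rfl : l = n := by simp only [BTree.leaves] at h; omega
    exact (P.one_comp _).symm
  | node x a b iha ihb =>
    subst ht
    subst hs
    simp only [BTree.leaves] at hi h
    by_cases hia : i < a.leaves
    · have e1 := BTree.leaves_graft a s i hia
      have e : (BTree.node x a b).graft i s = .node x (a.graft i s) b := by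
        simp [BTree.graft, hia]
      revert h'
      rw [e]
      intro h'
      simp only [eval]
      rw [iha i hia e1 rfl rfl]
      rw [← P.comp_seq 0 i (Nat.succ_pos _) hia (ab := a.leaves + b.leaves) (by omega) h e1 _
        (by omega)]
      exact P.comp_congr (zero_add i) _ _ _ _ _
    · obtain ⟨j, rfl⟩ : ∃ j, i = a.leaves + j := ⟨i - a.leaves, by omega⟩
      have hj : j < b.leaves := by omega
      have e1 := BTree.leaves_graft b s j hj
      have e : (BTree.node x a b).graft (a.leaves + j) s = .node x a (b.graft j s) := by
        simp [BTree.graft]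
      revert h'
      rw [e]
      intro h'
      have ha := a.leaves_pos
      simp only [eval]
      rw [ihb j hj e1 rfl rfl]
      rw [← P.comp_seq 1 j one_lt_two hj (ab := b.leaves + 1) (by omega) (by omega) e1 _
        (by omega)]
      exact (P.comp_par 0 (1 + j) (a.leaves + j) (by omega) (by omega) (by omega) (by omega) h
        (by omega) _ (by omega) (by omega) _ _ _).symm

lemma eval_corolla (ω : X → P.obj 2) (x : X) (h : (BTree.node x .leaf .leaf).leaves = 2) :
    P.eval ω (.node x .leaf .leaf) 2 h = ω x := by
  have h1 : P.comp 1 one_lt_two rfl (ω x) P.one = ω x := P.comp_one 1 one_lt_two (ω x)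
  have h2 : P.comp 0 two_pos rfl (ω x) P.one = ω x := P.comp_one 0 two_pos (ω x)
  exact (congrArg (fun y => P.comp 0 two_pos rfl y P.one) h1).trans h2

/-- Trees with three subtrees grafted on two vertices. -/
lemma eval_comb (ω : X → P.obj 2) {ι : Type*} (s : Finset ι) (f : ι → k) (a b : X)
    (c d : ι → X)
    (h : P.eval ω (.node b (.node a .leaf .leaf) .leaf) 3 rfl =
      ∑ i ∈ s, f i • P.eval ω (.node (c i) .leaf (.node (d i) .leaf .leaf)) 3 rfl)
    (t₁ t₂ t₃ : BTree X) (n : ℕ) (hn : t₁.leaves + t₂.leaves + t₃.leaves = n)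
    (hn' : t₁.leaves + (t₂.leaves + t₃.leaves) = n) :
    P.eval ω (.node b (.node a t₁ t₂) t₃) n hn =
      ∑ i ∈ s, f i • P.eval ω (.node (c i) t₁ (.node (d i) t₂ t₃)) n hn' := by
  have h1 := t₁.leaves_pos
  have h2 := t₂.leaves_pos
  have h3 := t₃.leaves_pos
  -- The value depends linearly on the value of the ternary tree. Grafting at positions 2, 1, 0 in
  -- this order leaves the positions still to be used unchanged.
  have key : ∀ t : BTree X, ∀ ht : t.leaves = 3,
      ∀ hl : (((t.graft 2 t₃).graft 1 t₂).graft 0 t₁).leaves = n,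
      P.eval ω (((t.graft 2 t₃).graft 1 t₂).graft 0 t₁) n hl =
      P.comp (m := t₃.leaves + t₂.leaves + 1) 0 (by omega) (by omega)
        (P.comp (m := t₃.leaves + 2) 1 (by omega) (by omega)
          (P.comp 2 (by omega) (by omega) (P.eval ω t 3 ht) (P.eval ω t₃ _ rfl))
          (P.eval ω t₂ _ rfl)) (P.eval ω t₁ _ rfl) := by
    intro t ht hl
    have l1 := BTree.leaves_graft t t₃ 2 (by omega)
    have l2 := BTree.leaves_graft (t.graft 2 t₃) t₂ 1 (by omega)
    rw [P.eval_graft ω _ t₁ (m := t₃.leaves + t₂.leaves + 1) 0 (by omega) (by omega) (by omega) rfl,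
      P.eval_graft ω _ t₂ (m := t₃.leaves + 2) 1 (by omega) (by omega) (by omega) rfl,
      P.eval_graft ω _ t₃ 2 (by omega) (by omega) ht rfl]
  have kl := key (.node b (.node a .leaf .leaf) .leaf) rfl
  simp only [BTree.graft, BTree.leaves] at kl
  have kr := fun x y => key (.node x .leaf (.node y .leaf .leaf)) rfl
  simp only [BTree.graft, BTree.leaves] at kr
  norm_num [BTree.graft, BTree.leaves] at kl kr
  rw [kl hn, h]
  simp only [map_sum, LinearMap.sum_apply, map_smul, LinearMap.smul_apply]
  exact Finset.sum_congr rfl fun i _ => by rw [kr _ _ hn']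

end NSOperad

noncomputable section

/-! ### Rewriting of left combs into right combs -/

/-- A system of rewriting rules `(x a y) b z → ∑ R(a, b, c, d) x c (y d z)`, one for every pair
`(a, b)` with `bad a b`, subject to the conditions which make it confluent. -/
structure CombRewriting (k : Type u) [Field k] (X : Type w) [Fintype X] where
  bad : X → X → Prop
  coeff : X → X → X → X → k
  -- The overlap to resolve is `((x e y) a z) b w` with both pairs bad. Whichever comb is rewritten
  -- first, the next pair, `(c, b)` or `(e, c)`, must again be bad so that the rewriting can go on.
  bad_of_left : ∀ {e a b c d}, bad e a → bad a b → coeff e a c d ≠ 0 → bad c b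
  bad_of_right : ∀ {e a b c d}, bad e a → bad a b → coeff a b c d ≠ 0 → bad e c
  -- Two steps on the first route lead to `x f ((y d z) g w)`. Single terms may have `(d, g)` not
  -- bad; only their total coefficient is required to vanish.
  sum_eq_zero : ∀ {e a b d f g}, bad e a → bad a b → ¬ bad d g →
    ∑ c, coeff e a c d * coeff c b f g = 0
  -- Both sides are the coefficient of `x f (y h (z i w))`, reached in three steps on one route and
  -- in two on the other.
  pentagon : ∀ {e a b f h i}, bad e a → bad a b →
    ∑ d, ∑ g, (∑ c, coeff e a c d * coeff c b f g) * coeff d g h i =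
      ∑ c, coeff a b c i * coeff e c f h

lemma sum_sum_comm {X : Type*} [Fintype X] {M : Type*} [AddCommMonoid M]
    (F : X → X → X → X → M) :
    ∑ d, ∑ g, ∑ x, ∑ y, F d g x y = ∑ x, ∑ y, ∑ d, ∑ g, F d g x y :=
  (Finset.sum_congr rfl fun _ _ => Finset.sum_comm).trans (Finset.sum_comm.trans
    (Finset.sum_congr rfl fun _ _ => (Finset.sum_congr rfl fun _ _ => Finset.sum_comm).trans
      Finset.sum_comm))

namespace CombRewriting

variable {k : Type u} [Field k] {X : Type w} [Fintype X] (S : CombRewriting k X)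

open Classical in
/-- The product `s b u` of a tree `s` with a linear combination of trees `u`, rewritten by the
rules. -/
def mulTree : BTree X → X → ((BTree X →₀ k) →ₗ[k] (BTree X →₀ k))
  | .leaf, b => Finsupp.lmapDomain k k fun u => .node b .leaf u
  | .node a s t, b =>
    if S.bad a b then ∑ c, ∑ d, S.coeff a b c d • (mulTree s c ∘ₗ mulTree t d)
    else Finsupp.lmapDomain k k fun u => .node b (.node a s t) u

/-- The bilinear extension of `mulTree`. -/
def mul (b : X) : (BTree X →₀ k) →ₗ[k] (BTree X →₀ k) →ₗ[k] (BTree X →₀ k) :=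
  Finsupp.linearCombination k fun s => S.mulTree s b

lemma mul_single (b : X) (s : BTree X) (u : BTree X →₀ k) :
    S.mul b (Finsupp.single s 1) u = S.mulTree s b u := by
  simp [mul, Finsupp.linearCombination_single]

lemma mulTree_of_bad {a b : X} (h : S.bad a b) (s t : BTree X) (u : BTree X →₀ k) :
    S.mulTree (.node a s t) b u =
      ∑ c, ∑ d, S.coeff a b c d • S.mulTree s c (S.mulTree t d u) := by
  simp [mulTree, h, LinearMap.sum_apply]

lemma mulTree_of_not_bad {a b : X} (h : ¬ S.bad a b) (s t u : BTree X) :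
    S.mulTree (.node a s t) b (Finsupp.single u 1) =
      Finsupp.single (.node b (.node a s t) u) 1 := by
  simp [mulTree, h, Finsupp.mapDomain_single]

/-- When no rule applies at the root of `s` under `a`, the inner product is an honest node, and the
claim is the defining clause of `mulTree` at that node. -/
lemma mul_mulTree_of_eq_node {a b : X} (h : S.bad a b) (s : BTree X)
    (hs : S.mulTree s a = Finsupp.lmapDomain k k fun u => .node a s u) (t u : BTree X →₀ k) :
    S.mul b (S.mulTree s a t) u = ∑ c, ∑ d, S.coeff a b c d • S.mulTree s c (S.mul d t u) := by
  induction t using Finsupp.induction_linear with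
  | zero => simp
  | add f g hf hg =>
    simp only [map_add, LinearMap.add_apply, hf, hg, smul_add, Finset.sum_add_distrib]
  | single t x =>
    rw [← mul_one x, ← smul_eq_mul, ← Finsupp.smul_single]
    simp only [map_smul, LinearMap.smul_apply, mul_single]
    have : S.mulTree s a (Finsupp.single t 1) = Finsupp.single (.node a s t) 1 := by
      simp [hs, Finsupp.mapDomain_single]
    rw [this, mul_single, mulTree_of_bad S h, Finset.smul_sum]
    refine Finset.sum_congr rfl fun c _ => ?_
    rw [Finset.smul_sum]
    exact Finset.sum_congr rfl fun d _ => smul_comm _ _ _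

/-- This is confluence: the rewritten products satisfy the rules as identities on all trees. In the
essential case the two sides follow the two routes of the overlap of `(e, a)` with `(a, b)`, and
`pentagon` identifies them. -/
lemma mul_mulTree {a b : X} (h : S.bad a b) (s : BTree X) (t u : BTree X →₀ k) :
    S.mul b (S.mulTree s a t) u = ∑ c, ∑ d, S.coeff a b c d • S.mulTree s c (S.mul d t u) := by
  induction s generalizing a b t u with
  | leaf => exact S.mul_mulTree_of_eq_node h _ rfl t u
  | node e s₁ s₂ ih₁ ih₂ =>
    by_cases he : S.bad e a
    swap
    · exact S.mul_mulTree_of_eq_node h _ (by simp [mulTree, he]) t u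
    -- Terms with coefficient zero are set aside because only for the others is `(c, b)` known to be
    -- bad, as the induction hypothesis demands.
    have ih₁' : ∀ c d, S.coeff e a c d •
        S.mul b (S.mulTree s₁ c (S.mulTree s₂ d t)) u = ∑ f, ∑ g,
        (S.coeff e a c d * S.coeff c b f g) •
          S.mulTree s₁ f (S.mul g (S.mulTree s₂ d t) u) := by
      intro c d
      by_cases h0 : S.coeff e a c d = 0
      · simp [h0]
      · rw [ih₁ (S.bad_of_left he h h0), Finset.smul_sum]
        simp only [Finset.smul_sum, smul_smul]
    -- If `(d, g)` is not bad there is no rule for the inner product, but then the whole term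
    -- disappears by `sum_eq_zero`.
    have ih₂' : ∀ f d g, (∑ c, S.coeff e a c d * S.coeff c b f g) •
        S.mulTree s₁ f (S.mul g (S.mulTree s₂ d t) u) = ∑ x, ∑ y,
        ((∑ c, S.coeff e a c d * S.coeff c b f g) * S.coeff d g x y) •
          S.mulTree s₁ f (S.mulTree s₂ x (S.mul y t u)) := by
      intro f d g
      by_cases hdg : S.bad d g
      · rw [ih₂ hdg]
        simp only [map_sum, map_smul, Finset.smul_sum, smul_smul]
      · simp [S.sum_eq_zero he h hdg]
    rw [S.mulTree_of_bad he]
    simp only [map_sum, LinearMap.sum_apply, map_smul, LinearMap.smul_apply]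
    simp only [ih₁']
    have r : ∀ c d, S.coeff a b c d • S.mulTree (.node e s₁ s₂) c (S.mul d t u) =
        ∑ f, ∑ g, (S.coeff a b c d * S.coeff e c f g) •
          S.mulTree s₁ f (S.mulTree s₂ g (S.mul d t u)) := by
      intro c d
      by_cases h0 : S.coeff a b c d = 0
      · simp [h0]
      · rw [S.mulTree_of_bad (S.bad_of_right he h h0), Finset.smul_sum]
        simp only [Finset.smul_sum, smul_smul]
    simp only [r]
    calc _ = ∑ f, ∑ d, ∑ g, (∑ c, S.coeff e a c d * S.coeff c b f g) •
          S.mulTree s₁ f (S.mul g (S.mulTree s₂ d t) u) := by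
          simp only [Finset.sum_smul]
          exact (Finset.sum_congr rfl fun _ _ => Finset.sum_comm).trans (Finset.sum_comm.trans
            (Finset.sum_congr rfl fun _ _ => Finset.sum_comm.trans
              (Finset.sum_congr rfl fun _ _ => Finset.sum_comm)))
      _ = ∑ f, ∑ x, ∑ y, (∑ d, ∑ g, (∑ c, S.coeff e a c d * S.coeff c b f g) *
            S.coeff d g x y) • S.mulTree s₁ f (S.mulTree s₂ x (S.mul y t u)) := by
          refine Finset.sum_congr rfl fun f _ => ?_
          simp only [ih₂']
          rw [sum_sum_comm]
          simp only [Finset.sum_smul]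
      _ = _ := by
          simp only [S.pentagon he h, Finset.sum_smul]
          exact (Finset.sum_congr rfl fun _ _ => Finset.sum_congr rfl fun _ _ =>
            Finset.sum_comm).trans (sum_sum_comm _)

end CombRewriting

end

noncomputable section

/-! ### Evaluation in algebras -/

section AlgEval

variable {k : Type u} [Field k] {X : Type w} {F : Type*} [AddCommGroup F] [Module k F]
  (o : X → F →ₗ[k] F →ₗ[k] F)

/-- The value of a tree at arguments `a 0, a 1, …` in a space with binary operations. -/
def algEval (a : ℕ → F) : BTree X → F
  | .leaf => a 0
  | .node x l r => o x (algEval a l) (algEval (fun i => a (i + l.leaves)) r)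

lemma algEval_congr {a b : ℕ → F} (t : BTree X) (h : ∀ i < t.leaves, a i = b i) :
    algEval o a t = algEval o b t := by
  induction t generalizing a b with
  | leaf => exact h 0 one_pos
  | node x l r hl hr =>
    simp only [BTree.leaves] at h
    simp only [algEval]
    rw [hl fun i hi => h i (by omega), hr fun i hi => h _ (by omega)]

/-- The arguments `a`, in which the `n` arguments from position `i` on are replaced by `v`. -/
def substArg (a : ℕ → F) (i n : ℕ) (v : F) : ℕ → F := fun j =>
  if j < i then a j else if j = i then v else a (j - 1 + n)

lemma algEval_graft (a : ℕ → F) (t s : BTree X) (i : ℕ) (hi : i < t.leaves) :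
    algEval o a (t.graft i s) =
      algEval o (substArg a i s.leaves (algEval o (fun j => a (j + i)) s)) t := by
  induction t generalizing a i with
  | leaf =>
    simp only [BTree.leaves] at hi
    obtain rfl : i = 0 := by omega
    simp [BTree.graft, algEval, substArg]
  | node x l r hl hr =>
    simp only [BTree.leaves] at hi
    by_cases h : i < l.leaves
    · have e := BTree.leaves_graft l s i h
      simp only [BTree.graft, h, if_true, algEval]
      rw [hl a i h]
      congr 1
      refine algEval_congr o r fun j _ => ?_
      simp only [substArg]
      rw [if_neg (by omega), if_neg (by omega)]
      congr 1
      omega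
    · simp only [BTree.graft, h, if_false, algEval]
      rw [hr _ _ (by omega)]
      congr 1
      · congr 1
        refine algEval_congr o l fun j hj => ?_
        simp only [substArg]
        rw [if_pos (by omega)]
      · refine algEval_congr o r fun j hj => ?_
        simp only [substArg]
        by_cases h1 : j < i - l.leaves
        · rw [if_pos h1, if_pos (by omega)]
        · rw [if_neg h1, if_neg (show ¬ j + l.leaves < i by omega)]
          by_cases h2 : j = i - l.leaves
          · rw [if_pos h2, if_pos (show j + l.leaves = i by omega)]
            congr 1
            funext y
            congr 1
            omega
          · rw [if_neg h2, if_neg (show ¬ j + l.leaves = i by omega)]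
            congr 1
            omega

/-- Linearity in the argument at one position is what extends the composition formula from trees to
linear combinations in the inserted operation. -/
lemma exists_algEval_substArg (a : ℕ → F) (t : BTree X) (i n : ℕ) (hi : i < t.leaves) :
    ∃ L : F →ₗ[k] F, ∀ v, algEval o (substArg a i n v) t = L v := by
  suffices H : ∀ (b : ℕ → F), ∃ L : F →ₗ[k] F, ∀ v,
      algEval o (Function.update b i v) t = L v by
    obtain ⟨L, hL⟩ := H (substArg a i n 0)
    refine ⟨L, fun v => ?_⟩
    rw [← hL]
    refine algEval_congr o t fun j _ => ?_
    by_cases h : j = i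
    · subst h; simp [substArg]
    · simp [substArg, h]
  induction t generalizing i with
  | leaf =>
    simp only [BTree.leaves] at hi
    obtain rfl : i = 0 := by omega
    exact fun b => ⟨LinearMap.id, fun v => by simp [algEval]⟩
  | node x l r hl hr =>
    intro b
    simp only [BTree.leaves] at hi
    by_cases h : i < l.leaves
    · obtain ⟨L, hL⟩ := hl i h b
      refine ⟨(o x).flip (algEval o (fun i => b (i + l.leaves)) r) ∘ₗ L, fun v => ?_⟩
      simp only [algEval, hL, LinearMap.comp_apply, LinearMap.flip_apply]
      congr 1
      refine algEval_congr o r fun j _ => ?_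
      rw [Function.update_of_ne (by omega)]
    · obtain ⟨L, hL⟩ := hr (i - l.leaves) (by omega) fun j => b (j + l.leaves)
      refine ⟨o x (algEval o b l) ∘ₗ L, fun v => ?_⟩
      simp only [algEval, LinearMap.comp_apply, ← hL]
      congr 1
      · congr 1
        refine algEval_congr o l fun j _ => ?_
        rw [Function.update_of_ne (by omega)]
      · refine algEval_congr o r fun j _ => ?_
        simp only [Function.update_apply]
        congr 1
        apply propext
        omega

/-- The linear extension of `algEval` to the free operad. -/
def freeEval (a : ℕ → F) (n : ℕ) : FreeOp.Obj k X n →ₗ[k] F :=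
  Finsupp.linearCombination k fun t => algEval o a t.1

lemma freeEval_single (a : ℕ → F) {n : ℕ} (t : {t : BTree X // t.leaves = n}) (x : k) :
    freeEval o a n (Finsupp.single t x) = x • algEval o a t.1 := by
  simp [freeEval, Finsupp.linearCombination_single]

lemma freeEval_comp_single_right (a : ℕ → F) {m n l : ℕ} (i : ℕ) (hi : i < m)
    (h : l + 1 = m + n) (p : FreeOp.Obj k X m) (s : {t : BTree X // t.leaves = n}) (y : k) :
    freeEval o a l (FreeOp.comp i hi h p (Finsupp.single s y)) =
      y • freeEval o (substArg a i n (algEval o (fun j => a (j + i)) s.1)) m p := by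
  induction p using Finsupp.induction_linear with
  | zero => simp
  | add f g hf hg => simp only [map_add, LinearMap.add_apply, hf, hg, smul_add]
  | single t x =>
    rw [FreeOp.comp_single i hi h t s x y (FreeOp.leaves_graft' hi h t s), freeEval_single,
      freeEval_single, algEval_graft o a t.1 s.1 i (t.2.symm ▸ hi), s.2, mul_comm, mul_smul]

lemma freeEval_comp (a : ℕ → F) {m n l : ℕ} (i : ℕ) (hi : i < m)
    (h : l + 1 = m + n) (p : FreeOp.Obj k X m) (q : FreeOp.Obj k X n) :
    freeEval o a l (FreeOp.comp i hi h p q) =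
      freeEval o (substArg a i n (freeEval o (fun j => a (j + i)) n q)) m p := by
  induction p using Finsupp.induction_linear with
  | zero => simp
  | add f g hf hg => simp only [map_add, LinearMap.add_apply, hf, hg]
  | single t x =>
    obtain ⟨L, hL⟩ := exists_algEval_substArg o a t.1 i n (t.2.symm ▸ hi)
    rw [freeEval_single, hL]
    induction q using Finsupp.induction_linear with
    | zero => simp
    | add f g hf hg => simp only [map_add, hf, hg, smul_add]
    | single s y =>
      rw [freeEval_comp_single_right, freeEval_single, freeEval_single, hL, map_smul, smul_comm]

variable [Fintype X] (Q : BinQuadData k X)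

/-- The operations `o` satisfy the relations `Q`. -/
def SatisfiesRel : Prop :=
  ∀ u v, (u, v) ∈ Q.rel → ∀ x y z : F,
    ∑ ab : X × X, u ab • o ab.2 (o ab.1 x y) z = ∑ ab : X × X, v ab • o ab.1 x (o ab.2 y z)

variable {o Q}

/-- The elements killed by evaluation at every sequence of arguments are closed under composition on
both sides, so they contain the ideal once they contain the relations. The induction needs all `a`
at once because composition changes the arguments. -/
lemma freeEval_eq_zero (hQ : SatisfiesRel o Q) {n : ℕ} {p : FreeOp.Obj k X n}
    (hp : BinQuadData.MemIdeal Q n p) (a : ℕ → F) : freeEval o a n p = 0 := by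
  induction hp generalizing a with
  | rel u v h =>
    have := hQ u v h (a 0) (a 1) (a 2)
    simp only [BinQuadData.relator, map_sum, map_sub, map_smul, FreeOp.mono, freeEval_single,
      one_smul, algEval, BTree.leaves, Finset.sum_sub_distrib]
    rw [sub_eq_zero]
    exact this
  | zero n => simp
  | add _ _ h1 h2 => rw [map_add, h1, h2, add_zero]
  | smul a _ h => rw [map_smul, h, smul_zero]
  | comp_left i hi h q _ ih => rw [freeEval_comp, ih]
  | @comp_right m n l i hi h p q _ ih =>
    rw [freeEval_comp, ih]
    induction p using Finsupp.induction_linear with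
    | zero => simp
    | add f g hf hg => rw [map_add, hf, hg, add_zero]
    | single t x =>
      obtain ⟨L, hL⟩ := exists_algEval_substArg o a t.1 i n (t.2.symm ▸ hi)
      rw [freeEval_single, hL, map_zero, smul_zero]

/-- Evaluation of the operations of a binary quadratic operad in an algebra over it. -/
def operadEval (hQ : SatisfiesRel o Q) (a : ℕ → F) (n : ℕ) : Q.operad.obj n →ₗ[k] F :=
  (Q.ideal n).liftQ (freeEval o a n) fun _ hp => freeEval_eq_zero hQ hp a

lemma operadEval_comp (hQ : SatisfiesRel o Q) (a : ℕ → F) {m n l : ℕ} (i : ℕ) (hi : i < m)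
    (h : l + 1 = m + n) (p : Q.operad.obj m) (q : Q.operad.obj n) :
    operadEval hQ a l (Q.operad.comp i hi h p q) =
      operadEval hQ (substArg a i n (operadEval hQ (fun j => a (j + i)) n q)) m p := by
  obtain ⟨p, rfl⟩ := Submodule.Quotient.mk_surjective _ p
  obtain ⟨q, rfl⟩ := Submodule.Quotient.mk_surjective _ q
  exact freeEval_comp o a i hi h p q

/-- Allows monomials in binary operations other than the presenting generators, as is needed for the
basis `≺, *`. -/
lemma operadEval_eval {Y : Type*} (hQ : SatisfiesRel o Q) (ω : Y → Q.operad.obj 2)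
    (o' : Y → F →ₗ[k] F →ₗ[k] F)
    (ho : ∀ y a, operadEval hQ a 2 (ω y) = o' y (a 0) (a 1)) (a : ℕ → F) (t : BTree Y) (n : ℕ)
    (h : t.leaves = n) : operadEval hQ a n (Q.operad.eval ω t n h) = algEval o' a t := by
  induction t generalizing a n with
  | leaf =>
    subst h
    exact (freeEval_single o a _ 1).trans (one_smul _ _)
  | node y l r hl hr =>
    subst h
    have h1 := r.leaves_pos
    simp only [NSOperad.eval, operadEval_comp, ho, hl, hr, algEval]
    simp only [substArg]
    congr 1

end AlgEval

end

/-! ### Normal trees and the rewriting rules of quadri-algebras. -/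

noncomputable section

namespace CombRewriting

variable {k : Type u} [Field k] {X : Type w} [Fintype X] (S : CombRewriting k X)

lemma mul_mul {a b : X} (h : S.bad a b) (s t u : BTree X →₀ k) :
    S.mul b (S.mul a s t) u = ∑ c, ∑ d, S.coeff a b c d • S.mul c s (S.mul d t u) := by
  induction s using Finsupp.induction_linear with
  | zero => simp
  | add f g hf hg =>
    simp only [map_add, LinearMap.add_apply, hf, hg, smul_add, Finset.sum_add_distrib]
  | single s x =>
    rw [← mul_one x, ← smul_eq_mul, ← Finsupp.smul_single]
    simp only [map_smul, LinearMap.smul_apply, mul_single]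
    rw [S.mul_mulTree h, Finset.smul_sum]
    refine Finset.sum_congr rfl fun c _ => ?_
    rw [Finset.smul_sum]
    exact Finset.sum_congr rfl fun d _ => smul_comm _ _ _

end CombRewriting

/-- A tree is normal if no vertex labelled `b` has a left input labelled `a` with `bad a b`. -/
def BTree.Normal {X : Type w} (bad : X → X → Prop) : BTree X → Prop
  | .leaf => True
  | .node b l r => l.Normal bad ∧ r.Normal bad ∧ ∀ a l₁ l₂, l = .node a l₁ l₂ → ¬ bad a b

namespace CombRewriting

variable {k : Type u} [Field k] {X : Type w} [Fintype X] (S : CombRewriting k X)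

/-- No rule ever applies while a normal tree is evaluated, so the tree is its own value. This gives
the linear independence of the normal monomials. -/
lemma algEval_of_normal (t : BTree X) (ht : t.Normal S.bad) :
    algEval S.mul (fun _ => Finsupp.single .leaf 1) t = Finsupp.single t 1 := by
  induction t with
  | leaf => rfl
  | node b l r hl hr =>
    obtain ⟨h1, h2, h3⟩ := ht
    simp only [algEval, hl h1, hr h2, mul_single]
    cases l with
    | leaf => simp [mulTree, Finsupp.mapDomain_single]
    | node a l₁ l₂ => exact S.mulTree_of_not_bad (h3 a l₁ l₂ rfl) _ _ _

end CombRewriting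

/-! ### The quadri-algebra operad -/

lemma DendOp.sum_eq {M : Type*} [AddCommMonoid M] (f : DendOp → M) :
    ∑ x, f x = f .prec + f .succ := by
  rw [show (Finset.univ : Finset DendOp) = {.prec, .succ} from rfl,
    Finset.sum_pair (by decide)]

/-- The coefficients, in the basis formed by `x ≺ y` (here `prec`) and `x ≺ y + x ≻ y`
(here `succ`), of the dendriform relations. -/
def dendCoeff : DendOp → DendOp → DendOp → DendOp → ℤ
  | .succ, .succ, .succ, .succ => 1
  | .prec, .prec, .prec, .succ => 1
  | .succ, .prec, .prec, .succ => 1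
  | .succ, .prec, .succ, .prec => 1
  | .succ, .prec, .prec, .prec => -1
  | _, _, _, _ => 0

/-- The pairs of operations whose left comb is rewritten into right combs. -/
def dendBad (a b : DendOp) : Prop := a = .succ ∨ b = .prec

instance (a b : DendOp) : Decidable (dendBad a b) := inferInstanceAs (Decidable (_ ∨ _))

/-- The expression of `≺, ≻` in terms of the new basis. -/
def dendToNew : DendOp → DendOp → ℤ
  | .prec, .prec => 1
  | .succ, .succ => 1
  | .succ, .prec => -1
  | _, _ => 0

/-- The expression of the new basis in terms of `≺, ≻`. -/
def dendOfNew : DendOp → DendOp → ℤ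
  | .prec, .succ => 0
  | _, _ => 1

/-- With two operations and integer coefficients the confluence conditions are finite decidable
checks; the coefficients are cast to the field only afterwards. -/
lemma dendBad_of_left : ∀ e a b c d, dendBad e a → dendBad a b → dendCoeff e a c d ≠ 0 →
    dendBad c b := by decide

lemma dendBad_of_right : ∀ e a b c d, dendBad e a → dendBad a b → dendCoeff a b c d ≠ 0 →
    dendBad e c := by decide

/-- The only genuine cancellation occurs for `((x * y) ≺ z) ≺ w`: the terms with `(d, g) = (≺, *)`
have coefficients `1` and `-1`. -/
lemma dendCoeff_sum_eq_zero : ∀ e a b d f g, dendBad e a → dendBad a b → ¬ dendBad d g →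
    ∑ c, dendCoeff e a c d * dendCoeff c b f g = 0 := by decide

set_option maxRecDepth 4000 in
lemma dendCoeff_pentagon : ∀ e a b f h i, dendBad e a → dendBad a b →
    ∑ d, ∑ g, (∑ c, dendCoeff e a c d * dendCoeff c b f g) * dendCoeff d g h i =
      ∑ c, dendCoeff a b c i * dendCoeff e c f h := by decide

lemma sum_prod_mul {X Y : Type*} [Fintype X] [Fintype Y] {A : Type*} [CommSemiring A] (f : X → A)
    (g : Y → A) :
    ∑ x : X × Y, f x.1 * g x.2 = (∑ x, f x) * ∑ y, g y := by
  rw [Fintype.sum_prod_type, Finset.sum_mul_sum]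

/-- The rewriting rules of the operad of quadri-algebras. -/
def quadRewriting (k : Type u) [Field k] [CharZero k] : CombRewriting k (DendOp × DendOp) where
  bad a b := dendBad a.1 b.1 ∧ dendBad a.2 b.2
  coeff a b c d := ((dendCoeff a.1 b.1 c.1 d.1 * dendCoeff a.2 b.2 c.2 d.2 : ℤ) : k)
  bad_of_left := by
    intro e a b c d h1 h2 h3
    rw [Int.cast_ne_zero, mul_ne_zero_iff] at h3
    exact ⟨dendBad_of_left _ _ _ _ _ h1.1 h2.1 h3.1, dendBad_of_left _ _ _ _ _ h1.2 h2.2 h3.2⟩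
  bad_of_right := by
    intro e a b c d h1 h2 h3
    rw [Int.cast_ne_zero, mul_ne_zero_iff] at h3
    exact ⟨dendBad_of_right _ _ _ _ _ h1.1 h2.1 h3.1, dendBad_of_right _ _ _ _ _ h1.2 h2.2 h3.2⟩
  sum_eq_zero := by
    intro e a b d f g h1 h2 h3
    norm_cast
    simp only [mul_mul_mul_comm]
    rw [sum_prod_mul (fun c => dendCoeff e.1 a.1 c d.1 * dendCoeff c b.1 f.1 g.1)
      fun c => dendCoeff e.2 a.2 c d.2 * dendCoeff c b.2 f.2 g.2]
    -- A pair that is not bad fails to be bad in some component, and that factor of the product of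
    -- sums vanishes.
    rcases not_and_or.1 h3 with h | h
    · rw [dendCoeff_sum_eq_zero _ _ _ _ _ _ h1.1 h2.1 h, zero_mul]
    · rw [dendCoeff_sum_eq_zero _ _ _ _ _ _ h1.2 h2.2 h, mul_zero]
  pentagon := by
    intro e a b f h i h1 h2
    norm_cast
    simp only [mul_mul_mul_comm]
    rw [sum_prod_mul (fun c => dendCoeff a.1 b.1 c i.1 * dendCoeff e.1 c f.1 h.1)
      fun c => dendCoeff a.2 b.2 c i.2 * dendCoeff e.2 c f.2 h.2,
      ← dendCoeff_pentagon _ _ _ _ _ _ h1.1 h2.1, ← dendCoeff_pentagon _ _ _ _ _ _ h1.2 h2.2]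
    -- A product of the two dendriform pentagons is turned back into one sum over pairs, index by
    -- index.
    rw [← sum_prod_mul]
    refine Finset.sum_congr rfl fun d _ => ?_
    rw [← sum_prod_mul]
    refine Finset.sum_congr rfl fun g _ => ?_
    rw [sum_prod_mul (fun c => dendCoeff e.1 a.1 c d.1 * dendCoeff c b.1 f.1 g.1)
      fun c => dendCoeff e.2 a.2 c d.2 * dendCoeff c b.2 f.2 g.2]
    ring

/-- The dendriform relations in the new basis. -/
lemma dend_rel_new {k : Type u} [Field k] {r : (DendOp × DendOp → k) × (DendOp × DendOp → k)}
    (hr : r ∈ (dend k).rel) :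
    (∀ a b, ¬ dendBad a b →
      ∑ x, ∑ y, r.1 (x, y) * ((dendToNew x a * dendToNew y b : ℤ) : k) = 0) ∧
    ∀ c d, ∑ x, ∑ y, r.2 (x, y) * ((dendToNew x c * dendToNew y d : ℤ) : k) =
      ∑ a, ∑ b, (∑ x, ∑ y, r.1 (x, y) * ((dendToNew x a * dendToNew y b : ℤ) : k)) *
        (dendCoeff a b c d : k) := by
  simp only [dend, Submodule.mem_span_triple] at hr
  obtain ⟨α, β, γ, rfl⟩ := hr
  constructor
  · intro a b
    cases a <;> cases b <;> simp [dendBad, DendOp.sum_eq, opPair, dendToNew, Pi.single_apply]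
  · intro c d
    cases c <;> cases d <;>
      simp [DendOp.sum_eq, opPair, dendToNew, dendCoeff, Pi.single_apply] <;> ring

end

/-! ### The PBW basis of the quadri-algebra operad. -/

noncomputable section

/-- A system of binary generators of an operad for which the trees without bad left edges form a
basis, and by which the bad left combs can be rewritten into right combs. -/
structure LeftPBW {k : Type u} [Field k] (P : NSOperad.{u, w} k) (X : Type*) [Fintype X] where
  gen : X → P.obj 2
  bad : X → X → Prop
  span : ∀ (n : ℕ) (p : P.obj n),
    p ∈ Submodule.span k {q | ∃ (t : BTree X) (h : t.leaves = n), q = P.eval gen t n h}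
  coeff : X → X → X × X → k
  rewrite : ∀ a b, bad a b → P.eval gen (.node b (.node a .leaf .leaf) .leaf) 3 rfl =
    ∑ cd : X × X, coeff a b cd • P.eval gen (.node cd.1 .leaf (.node cd.2 .leaf .leaf)) 3 rfl
  -- The coordinate forms are constrained only on normal monomials; their existence amounts to the
  -- independence of these.
  coord : (n : ℕ) → BTree X → (P.obj n →ₗ[k] k)
  coord_self : ∀ (t : BTree X) (n : ℕ) (h : t.leaves = n), t.Normal bad →
    coord n t (P.eval gen t n h) = 1
  coord_of_ne : ∀ (t t' : BTree X) (n : ℕ) (h : t.leaves = n), t.Normal bad → t ≠ t' →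
    coord n t' (P.eval gen t n h) = 0

namespace BinQuadData

variable {k : Type u} [Field k] {X : Type w} [Fintype X] (Q : BinQuadData k X)

/-- The generating operations of a binary quadratic operad. -/
def gen (x : X) : Q.operad.obj 2 :=
  (Submodule.Quotient.mk (FreeOp.mono (n := 2) k (.node x .leaf .leaf) rfl) :
    FreeOp.Obj k X 2 ⧸ Q.ideal 2)

lemma comp_mk_mono {m n l : ℕ} (i : ℕ) (hi : i < m) (h : l + 1 = m + n) (t s : BTree X)
    (ht : t.leaves = m) (hs : s.leaves = n) (h' : (t.graft i s).leaves = l) :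
    Q.operad.comp i hi h
      (Submodule.Quotient.mk (FreeOp.mono k t ht) : FreeOp.Obj k X m ⧸ Q.ideal m)
      (Submodule.Quotient.mk (FreeOp.mono k s hs) : FreeOp.Obj k X n ⧸ Q.ideal n) =
    (Submodule.Quotient.mk (FreeOp.mono k (t.graft i s) h') : FreeOp.Obj k X l ⧸ Q.ideal l) := by
  refine (Q.quotComp_mk i hi h _ _).trans ?_
  rw [FreeOp.mono, FreeOp.mono, FreeOp.comp_single i hi h ⟨t, ht⟩ ⟨s, hs⟩ 1 1 h', mul_one]
  rfl

lemma eval_gen (t : BTree X) (n : ℕ) (h : t.leaves = n) :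
    Q.operad.eval Q.gen t n h =
      (Submodule.Quotient.mk (FreeOp.mono k t h) : FreeOp.Obj k X n ⧸ Q.ideal n) := by
  induction t generalizing n with
  | leaf => subst h; rfl
  | node x l r hl hr =>
    simp only [NSOperad.eval, hl, hr, gen]
    rw [Q.comp_mk_mono 1 one_lt_two _ (.node x .leaf .leaf) r rfl rfl
        (by simp [BTree.graft, BTree.leaves, add_comm]),
      Q.comp_mk_mono 0 _ _ _ l _ rfl (by simpa [BTree.graft, BTree.leaves] using h)]
    simp [BTree.graft, BTree.leaves]
    rfl

end BinQuadData

/-- The expression of the generators of `quad` in terms of the new basis. -/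
def quadToNew (k : Type u) [Field k] (x y : DendOp × DendOp) : k :=
  ((dendToNew x.1 y.1 * dendToNew x.2 y.2 : ℤ) : k)

/-- The expression of the new basis in terms of the generators of `quad`. -/
def quadOfNew (k : Type u) [Field k] (x y : DendOp × DendOp) : k :=
  ((dendOfNew x.1 y.1 * dendOfNew x.2 y.2 : ℤ) : k)

lemma dendToNew_ofNew : ∀ x z, ∑ y, dendToNew x y * dendOfNew y z = if x = z then 1 else 0 := by
  decide

lemma dendOfNew_toNew : ∀ x z, ∑ y, dendOfNew x y * dendToNew y z = if x = z then 1 else 0 := by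
  decide

lemma ite_mul_ite_prod {X Y : Type*} [DecidableEq X] [DecidableEq Y] (x z : X × Y) :
    (if x.1 = z.1 then (1 : ℤ) else 0) * (if x.2 = z.2 then 1 else 0) = if x = z then 1 else 0 := by
  simp only [Prod.ext_iff]
  split_ifs <;> simp_all

lemma quadToNew_ofNew (k : Type u) [Field k] (x z : DendOp × DendOp) :
    ∑ y, quadToNew k x y * quadOfNew k y z = if x = z then 1 else 0 := by
  simp only [quadToNew, quadOfNew, ← Int.cast_mul, ← Int.cast_sum]
  rw [Finset.sum_congr rfl fun y _ => mul_mul_mul_comm _ _ _ _,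
    sum_prod_mul (fun y => dendToNew x.1 y * dendOfNew y z.1)
    fun y => dendToNew x.2 y * dendOfNew y z.2, dendToNew_ofNew, dendToNew_ofNew,
    ite_mul_ite_prod]
  split_ifs <;> simp

lemma quadOfNew_toNew (k : Type u) [Field k] (x z : DendOp × DendOp) :
    ∑ y, quadOfNew k x y * quadToNew k y z = if x = z then 1 else 0 := by
  simp only [quadToNew, quadOfNew, ← Int.cast_mul, ← Int.cast_sum]
  rw [Finset.sum_congr rfl fun y _ => mul_mul_mul_comm _ _ _ _,
    sum_prod_mul (fun y => dendOfNew x.1 y * dendToNew y z.1)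
    fun y => dendOfNew x.2 y * dendToNew y z.2, dendOfNew_toNew, dendOfNew_toNew,
    ite_mul_ite_prod]
  split_ifs <;> simp

section Quad

variable (k : Type u) [Field k]

/-- The new basis of the binary operations of `quad`. -/
def quadGen (y : DendOp × DendOp) : (quad k).operad.obj 2 :=
  ∑ x, quadOfNew k y x • (quad k).gen x

lemma gen_eq_sum_quadGen (x : DendOp × DendOp) :
    (quad k).gen x = ∑ y, quadToNew k x y • quadGen k y := by
  simp only [quadGen, Finset.smul_sum, smul_smul]
  rw [Finset.sum_comm]
  simp only [← Finset.sum_smul, quadToNew_ofNew, ite_smul, one_smul, zero_smul]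
  simp

/-- The witnesses are coefficients of the three dendriform relations: the first one is the rule for
`(≺, ≺)`, the first two add up to the rule for `(*, ≺)`, and all three add up to the associativity
of `*`. -/
lemma dend_rel_of_bad (a b : DendOp) (h : dendBad a b) :
    ((fun xy => ((dendOfNew a xy.1 * dendOfNew b xy.2 : ℤ) : k)),
      fun xy => ((∑ c, ∑ d, dendCoeff a b c d * (dendOfNew c xy.1 * dendOfNew d xy.2) : ℤ) : k)) ∈
      (dend k).rel := by
  simp only [dend, Submodule.mem_span_triple]
  rcases a with _ | _ <;> rcases b with _ | _
  · refine ⟨1, 0, 0, Prod.ext (funext fun xy => ?_) (funext fun xy => ?_)⟩ <;>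
      rcases xy with ⟨_ | _, _ | _⟩ <;>
      simp [DendOp.sum_eq, opPair, dendOfNew, dendCoeff]
  · exact absurd h (by decide)
  · refine ⟨1, 1, 0, Prod.ext (funext fun xy => ?_) (funext fun xy => ?_)⟩ <;>
      rcases xy with ⟨_ | _, _ | _⟩ <;>
      simp [DendOp.sum_eq, opPair, dendOfNew, dendCoeff]
  · refine ⟨1, 1, 1, Prod.ext (funext fun xy => ?_) (funext fun xy => ?_)⟩ <;>
      rcases xy with ⟨_ | _, _ | _⟩ <;>
      simp [DendOp.sum_eq, opPair, dendOfNew, dendCoeff]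

lemma eval_quadGen_left (a b : DendOp × DendOp) :
    (quad k).operad.eval (quadGen k) (.node b (.node a .leaf .leaf) .leaf) 3 rfl =
      ∑ xy : (DendOp × DendOp) × (DendOp × DendOp), (quadOfNew k a xy.1 * quadOfNew k b xy.2) •
        (quad k).operad.eval (quad k).gen (.node xy.2 (.node xy.1 .leaf .leaf) .leaf) 3 rfl := by
  have h : ∀ ω : DendOp × DendOp → (quad k).operad.obj 2, ∀ a b,
      (quad k).operad.eval ω (.node b (.node a .leaf .leaf) .leaf) 3 rfl =
        (quad k).operad.comp (l := 3) 0 two_pos rfl (ω b) (ω a) := fun ω a b => by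
    rw [← (quad k).operad.eval_corolla ω b rfl, ← (quad k).operad.eval_corolla ω a rfl]
    exact (quad k).operad.eval_graft ω (.node b .leaf .leaf) (.node a .leaf .leaf) 0 _ _ rfl rfl rfl
  simp only [h, quadGen, map_sum, LinearMap.sum_apply, map_smul, LinearMap.smul_apply,
    Finset.smul_sum, smul_smul]
  rw [← Fintype.sum_prod_type']

lemma eval_quadGen_right (a b : DendOp × DendOp) :
    (quad k).operad.eval (quadGen k) (.node a .leaf (.node b .leaf .leaf)) 3 rfl =
      ∑ xy : (DendOp × DendOp) × (DendOp × DendOp), (quadOfNew k a xy.1 * quadOfNew k b xy.2) •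
        (quad k).operad.eval (quad k).gen (.node xy.1 .leaf (.node xy.2 .leaf .leaf)) 3 rfl := by
  have h : ∀ ω : DendOp × DendOp → (quad k).operad.obj 2, ∀ a b,
      (quad k).operad.eval ω (.node a .leaf (.node b .leaf .leaf)) 3 rfl =
        (quad k).operad.comp (l := 3) 1 one_lt_two rfl (ω a) (ω b) := fun ω a b => by
    rw [← (quad k).operad.eval_corolla ω b rfl, ← (quad k).operad.eval_corolla ω a rfl]
    exact (quad k).operad.eval_graft ω (.node a .leaf .leaf) (.node b .leaf .leaf) 1 _ _ rfl rfl rfl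
  simp only [h, quadGen, map_sum, LinearMap.sum_apply, map_smul, LinearMap.smul_apply,
    Finset.smul_sum, smul_smul]
  rw [Finset.sum_comm, ← Fintype.sum_prod_type']
  exact Finset.sum_congr rfl fun _ _ => by rw [mul_comm]

lemma quad_rewrite [CharZero k] (a b : DendOp × DendOp) (h : (quadRewriting k).bad a b) :
    (quad k).operad.eval (quadGen k) (.node b (.node a .leaf .leaf) .leaf) 3 rfl =
      ∑ cd : (DendOp × DendOp) × (DendOp × DendOp), (quadRewriting k).coeff a b cd.1 cd.2 •
        (quad k).operad.eval (quadGen k) (.node cd.1 .leaf (.node cd.2 .leaf .leaf)) 3 rfl := by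
  simp only [eval_quadGen_left, eval_quadGen_right, Finset.smul_sum, smul_smul]
  rw [Finset.sum_comm]
  simp only [← Finset.sum_smul]
  set U : (DendOp × DendOp) × (DendOp × DendOp) → k := fun xy =>
    quadOfNew k a xy.1 * quadOfNew k b xy.2
  set V : (DendOp × DendOp) × (DendOp × DendOp) → k := fun xy =>
    ∑ cd : (DendOp × DendOp) × (DendOp × DendOp), (quadRewriting k).coeff a b cd.1 cd.2 *
      (quadOfNew k cd.1 xy.1 * quadOfNew k cd.2 xy.2)
  -- The tensor product of two dendriform rules is one of the spanning relations of the black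
  -- square.
  have hUV : (U, V) ∈ (quad k).rel := by
    refine Submodule.subset_span ⟨_, dend_rel_of_bad k _ _ h.1, _, dend_rel_of_bad k _ _ h.2, ?_⟩
    refine Prod.ext (funext fun xy => ?_) (funext fun xy => ?_)
    · simp only [U, quadOfNew]
      push_cast
      ring
    · simp only [V, quadOfNew, quadRewriting, ← Int.cast_mul, ← Int.cast_sum]
      congr 1
      rw [Fintype.sum_prod_type, ← sum_prod_mul]
      refine Finset.sum_congr rfl fun c _ => ?_
      rw [← sum_prod_mul]
      exact Finset.sum_congr rfl fun d _ => by ring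
  have hz : (Submodule.Quotient.mk (BinQuadData.relator U V) :
      FreeOp.Obj k (DendOp × DendOp) 3 ⧸ (quad k).ideal 3) = 0 :=
    (Submodule.Quotient.mk_eq_zero _).2 (BinQuadData.MemIdeal.rel U V hUV)
  rw [← sub_eq_zero, ← Finset.sum_sub_distrib]
  refine Eq.trans ?_ hz
  refine Eq.trans (Finset.sum_congr rfl fun xy _ => ?_)
    (map_sum ((quad k).ideal 3).mkQ (fun xy => U xy •
      FreeOp.mono (n := 3) k (.node xy.2 (.node xy.1 .leaf .leaf) .leaf) rfl - V xy •
      FreeOp.mono (n := 3) k (.node xy.1 .leaf (.node xy.2 .leaf .leaf)) rfl) Finset.univ).symm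
  rw [map_sub, map_smul, map_smul]
  exact congrArg₂ (fun x y => U xy • x - V xy • y) ((quad k).eval_gen _ 3 _)
    ((quad k).eval_gen _ 3 _)

/-- The old generators are combinations of the new ones, and composition is linear at each vertex,
so monomials in the new generators span as well. -/
lemma quad_span (n : ℕ) (p : (quad k).operad.obj n) : p ∈ Submodule.span k
    {q | ∃ (t : BTree (DendOp × DendOp)) (h : t.leaves = n),
      q = (quad k).operad.eval (quadGen k) t n h} := by
  have H : ∀ (t : BTree (DendOp × DendOp)) (n : ℕ) (h : t.leaves = n),
      (quad k).operad.eval (quad k).gen t n h ∈ Submodule.span k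
      {q | ∃ (t : BTree (DendOp × DendOp)) (h : t.leaves = n),
        q = (quad k).operad.eval (quadGen k) t n h} := by
    intro t
    induction t with
    | leaf =>
      intro n h
      exact Submodule.subset_span ⟨.leaf, h, rfl⟩
    | node x l r hl hr =>
      intro n h
      simp only [BTree.leaves] at h
      have hr' := hr _ rfl
      have hl' := hl _ rfl
      simp only [NSOperad.eval]
      generalize (quad k).operad.eval (quad k).gen r _ rfl = q at hr'
      generalize (quad k).operad.eval (quad k).gen l _ rfl = p at hl'
      rw [gen_eq_sum_quadGen]
      simp only [map_sum, LinearMap.sum_apply, map_smul, LinearMap.smul_apply]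
      refine Submodule.sum_mem _ fun y _ => Submodule.smul_mem _ _ ?_
      refine Submodule.span_induction (fun q hq => ?_) ?_ (fun q q' _ _ h h' => ?_)
        (fun x q _ h => ?_) hr'
      · refine Submodule.span_induction (fun p hp => ?_) ?_ (fun q q' _ _ h h' => ?_)
          (fun x q _ h => ?_) hl'
        · obtain ⟨r', e', rfl⟩ := hq
          obtain ⟨l', e, rfl⟩ := hp
          refine Submodule.subset_span ⟨.node y l' r', by simp only [BTree.leaves]; omega, ?_⟩
          rw [NSOperad.eval_node _ _ _ _ _ e e']
        · rw [map_zero]; exact Submodule.zero_mem _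
        · rw [map_add]; exact Submodule.add_mem _ h h'
        · rw [map_smul]; exact Submodule.smul_mem _ _ h
      · rw [map_zero, map_zero]; exact Submodule.zero_mem _
      · rw [map_add, map_add]; exact Submodule.add_mem _ h h'
      · rw [map_smul, map_smul]; exact Submodule.smul_mem _ _ h
  obtain ⟨p, rfl⟩ := Submodule.Quotient.mk_surjective _ p
  induction p using Finsupp.induction_linear with
  | zero => exact Submodule.zero_mem _
  | add f g hf hg => exact Submodule.add_mem _ hf hg
  | single t x =>
    have := H t.1 n t.2
    rw [BinQuadData.eval_gen] at this
    have e : Finsupp.single t x = x • FreeOp.mono k t.1 t.2 := by simp [FreeOp.mono]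
    rw [e]
    exact Submodule.smul_mem _ x this

variable [CharZero k]

/-- The operations `≺` and `≻` on linear combinations of trees. -/
def quadMul (x : DendOp × DendOp) : (BTree (DendOp × DendOp) →₀ k) →ₗ[k]
    (BTree (DendOp × DendOp) →₀ k) →ₗ[k] (BTree (DendOp × DendOp) →₀ k) :=
  ∑ y, quadToNew k x y • (quadRewriting k).mul y

/-- In the new basis the left part of a relation is supported on bad pairs, and its right part is
what the rules make of it. Hence every relation is a combination of instances of
`CombRewriting.mul_mul`. -/
lemma satisfiesRel_quadMul : SatisfiesRel (quadMul k) (quad k) := by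
  intro u v huv s t z
  -- `U w` is the matrix of the tensor `w` in the new basis.
  let U : ((DendOp × DendOp) × (DendOp × DendOp) → k) → DendOp × DendOp → DendOp × DendOp → k :=
    fun u c d => ∑ x, ∑ y, u (x, y) * (quadToNew k x c * quadToNew k y d)
  have hU : ∀ r r' : DendOp × DendOp → k, ∀ c d,
      U (fun ab => r (ab.1.1, ab.2.1) * r' (ab.1.2, ab.2.2)) c d =
      (∑ x, ∑ y, r (x, y) * ((dendToNew x c.1 * dendToNew y d.1 : ℤ) : k)) *
      ∑ x, ∑ y, r' (x, y) * ((dendToNew x c.2 * dendToNew y d.2 : ℤ) : k) := by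
    intro r r' c d
    rw [← sum_prod_mul]
    refine Finset.sum_congr rfl fun x _ => ?_
    rw [← sum_prod_mul]
    refine Finset.sum_congr rfl fun y _ => ?_
    simp only [quadToNew]
    push_cast
    ring
  have key : ∀ c d, (¬ (quadRewriting k).bad c d → U u c d = 0) ∧
      U v c d = ∑ a, ∑ b, U u a b * (quadRewriting k).coeff a b c d := by
    suffices H : ∀ r ∈ (quad k).rel, ∀ c d, (¬ (quadRewriting k).bad c d → U r.1 c d = 0) ∧
      U r.2 c d = ∑ a, ∑ b, U r.1 a b * (quadRewriting k).coeff a b c d from H (u, v) huv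
    have hadd : ∀ r r', U (r + r') = U r + U r' := fun r r' => by
      funext c d
      simp only [U, Pi.add_apply, add_mul, Finset.sum_add_distrib]
    have hsmul : ∀ (x : k) r, U (x • r) = x • U r := fun x r => by
      funext c d
      simp only [U, Pi.smul_apply, smul_eq_mul, mul_assoc, Finset.mul_sum]
    intro r hr
    refine Submodule.span_induction (fun r hr => ?_) ?_ (fun r r' _ _ h h' => ?_)
      (fun x r _ h => ?_) hr
    · obtain ⟨r, hr, r', hr', rfl⟩ := hr
      intro c d
      obtain ⟨h1, h2⟩ := dend_rel_new hr
      obtain ⟨h1', h2'⟩ := dend_rel_new hr'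
      simp only [hU]
      refine ⟨fun h => ?_, ?_⟩
      · rcases not_and_or.1 h with h | h
        · rw [h1 _ _ h, zero_mul]
        · rw [h1' _ _ h, mul_zero]
      · rw [h2, h2', ← sum_prod_mul]
        refine Finset.sum_congr rfl fun a _ => ?_
        rw [← sum_prod_mul]
        refine Finset.sum_congr rfl fun b _ => ?_
        simp only [quadRewriting]
        push_cast
        ring
    · have h0 : U 0 = 0 := by simpa using hsmul 0 0
      intro c d
      simp [h0]
    · intro c d
      obtain ⟨h1, h2⟩ := h c d
      obtain ⟨h1', h2'⟩ := h' c d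
      simp only [Prod.fst_add, Prod.snd_add, hadd, Pi.add_apply, h2, h2', add_mul,
        Finset.sum_add_distrib, and_true]
      intro hb
      rw [h1 hb, h1' hb, add_zero]
    · intro c d
      obtain ⟨h1, h2⟩ := h c d
      simp only [Prod.smul_fst, Prod.smul_snd, hsmul, Pi.smul_apply, h2, smul_eq_mul, mul_assoc,
        Finset.mul_sum, and_true]
      intro hb
      rw [h1 hb, mul_zero]
  have hl : ∑ ab, u ab • quadMul k ab.2 (quadMul k ab.1 s t) z =
      ∑ c, ∑ d, U u c d • (quadRewriting k).mul d ((quadRewriting k).mul c s t) z := by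
    rw [Fintype.sum_prod_type]
    simp only [quadMul, LinearMap.sum_apply, LinearMap.smul_apply, map_sum, map_smul,
      Finset.smul_sum, smul_smul, U, Finset.sum_smul]
    rw [sum_sum_comm, Finset.sum_comm]
  have hr : ∑ ab, v ab • quadMul k ab.1 s (quadMul k ab.2 t z) =
      ∑ c, ∑ d, U v c d • (quadRewriting k).mul c s ((quadRewriting k).mul d t z) := by
    rw [Fintype.sum_prod_type]
    simp only [quadMul, LinearMap.sum_apply, LinearMap.smul_apply, map_sum, map_smul,
      Finset.smul_sum, smul_smul, U, Finset.sum_smul]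
    rw [sum_sum_comm, Finset.sum_comm]
    exact Finset.sum_congr rfl fun _ _ => Finset.sum_congr rfl fun _ _ => Finset.sum_congr rfl
      fun _ _ => Finset.sum_congr rfl fun _ _ => by rw [mul_comm (quadToNew k _ _)]
  rw [hl, hr]
  have h1 : ∀ a b, U u a b • (quadRewriting k).mul b ((quadRewriting k).mul a s t) z =
      ∑ c, ∑ d, (U u a b * (quadRewriting k).coeff a b c d) •
        (quadRewriting k).mul c s ((quadRewriting k).mul d t z) := by
    intro a b
    by_cases h : (quadRewriting k).bad a b
    · rw [(quadRewriting k).mul_mul h]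
      simp only [Finset.smul_sum, smul_smul]
    · simp [(key a b).1 h]
  simp only [h1, fun c d => (key c d).2, Finset.sum_smul]
  exact sum_sum_comm _

lemma operadEval_quadGen (y : DendOp × DendOp)
    (a : ℕ → (BTree (DendOp × DendOp) →₀ k)) :
    operadEval (satisfiesRel_quadMul k) a 2 (quadGen k y) =
      (quadRewriting k).mul y (a 0) (a 1) := by
  have h : ∀ x, operadEval (satisfiesRel_quadMul k) a 2 ((quad k).gen x) =
      quadMul k x (a 0) (a 1) := fun x =>
    (freeEval_single _ a _ 1).trans (one_smul _ _)
  simp only [quadGen, map_sum, map_smul, h, quadMul, LinearMap.sum_apply, LinearMap.smul_apply,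
    Finset.smul_sum, smul_smul]
  rw [Finset.sum_comm]
  simp only [← Finset.sum_smul, quadOfNew_toNew, ite_smul, one_smul, zero_smul]
  simp

/-- The basis of the quadri-algebra operad. -/
def quadPBW : LeftPBW (quad k).operad (DendOp × DendOp) where
  gen := quadGen k
  bad := (quadRewriting k).bad
  span := quad_span k
  coeff a b cd := (quadRewriting k).coeff a b cd.1 cd.2
  rewrite := quad_rewrite k
  -- All inputs are evaluated at the tree with one leaf, and the coefficient of `t` is read off.
  coord n t := Finsupp.lapply t ∘ₗ
    operadEval (satisfiesRel_quadMul k) (fun _ => Finsupp.single .leaf 1) n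
  coord_self t n h ht := by
    rw [LinearMap.comp_apply, operadEval_eval _ _ _ (operadEval_quadGen k),
      CombRewriting.algEval_of_normal _ _ ht]
    simp
  coord_of_ne t t' n h ht hne := by
    rw [LinearMap.comp_apply, operadEval_eval _ _ _ (operadEval_quadGen k),
      CombRewriting.algEval_of_normal _ _ ht]
    simp [hne]

end Quad

end

noncomputable section

/-! ### Sums over the inputs of a vertex -/

/-- The sum of the entries of `f` before position `i`. -/
def sumBefore {M : Type*} [AddCommMonoid M] {n : ℕ} (f : Fin n → M) (i : ℕ) : M :=
  ∑ j, if j.1 < i then f j else 0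

lemma sumBefore_add {n : ℕ} {M : Type*} [AddCommMonoid M] (f g : Fin n → M) (i : ℕ) :
    sumBefore (fun j => f j + g j) i = sumBefore f i + sumBefore g i := by
  simp only [sumBefore, ← Finset.sum_add_distrib]
  exact Finset.sum_congr rfl fun j _ => by split_ifs <;> simp

lemma sumBefore_natCast {n : ℕ} {M : Type*} [AddCommMonoidWithOne M] (f : Fin n → ℕ) (i : ℕ) :
    ((sumBefore f i : ℕ) : M) = sumBefore (fun j => (f j : M)) i := by
  simp only [sumBefore, Nat.cast_sum]
  exact Finset.sum_congr rfl fun j _ => by split_ifs <;> simp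

/-- Addresses a number below a sum by a block and an offset; below, the blocks are the vertices of
the successive inputs of a vertex. -/
lemma finSigmaFinEquiv_eq {n : ℕ} (f : Fin n → ℕ) (i : Fin n) (l : Fin (f i)) :
    (finSigmaFinEquiv ⟨i, l⟩ : ℕ) = sumBefore f i + l := by
  rw [finSigmaFinEquiv_apply, sumBefore]
  congr 1
  dsimp only
  rw [← Finset.sum_filter]
  refine Finset.sum_bij (fun j _ => Fin.castLE i.2.le j) (fun j _ => Finset.mem_filter.2 ⟨Finset.mem_univ _, j.2⟩)
    (fun j _ j' _ h => ?_)
    (fun j hj => ?_) fun j _ => rfl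
  · simpa [Fin.ext_iff] using h
  · simp only [Finset.mem_filter, Finset.mem_univ, true_and] at hj
    exact ⟨⟨j, hj⟩, by simp, by simp⟩

lemma exists_eq_sumBefore_add {n : ℕ} (f : Fin n → ℕ) (a : ℕ) (h : a < ∑ i, f i) :
    ∃ i l, l < f i ∧ a = sumBefore f i.1 + l := by
  obtain ⟨⟨i, l⟩, hil⟩ := finSigmaFinEquiv.surjective (⟨a, h⟩ : Fin (∑ i, f i))
  refine ⟨i, l, l.2, ?_⟩
  rw [← finSigmaFinEquiv_eq, hil]

lemma sum_range_eq_sum_blocks {M : Type*} [AddCommMonoid M] {n : ℕ} (f : Fin n → ℕ) (g : ℕ → M) :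
    ∑ a ∈ Finset.range (∑ i, f i), g a =
      ∑ i, ∑ l ∈ Finset.range (f i), g (sumBefore f i.1 + l) := by
  rw [← Fin.sum_univ_eq_sum_range, ← finSigmaFinEquiv.sum_comp, Fintype.sum_sigma]
  refine Finset.sum_congr rfl fun i _ => ?_
  rw [← Fin.sum_univ_eq_sum_range (fun l => g (sumBefore f i.1 + l))]
  exact Finset.sum_congr rfl fun l _ => by rw [finSigmaFinEquiv_eq]

lemma sumBefore_update_le {M : Type*} [AddCommMonoid M] {α : Type*} {n : ℕ} (f : α → M)
    (c : Fin n → α) (i : Fin n) (t : α) (j : ℕ) (hj : j ≤ i.1) :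
    sumBefore (fun l => f (Function.update c i t l)) j = sumBefore (fun l => f (c l)) j := by
  refine Finset.sum_congr rfl fun l _ => ?_
  by_cases hl : l = i
  · subst hl
    simp [hj.not_gt]
  · simp [hl]

/-- The replaced term is moved to the other side because there is no subtraction in `M`. -/
lemma sumBefore_update_gt {α : Type*} {M : Type*} [AddCommMonoid M] {n : ℕ} (f : α → M)
    (c : Fin n → α) (i : Fin n) (t : α) (j : ℕ) (hj : i.1 < j) :
    sumBefore (fun l => f (Function.update c i t l)) j + f (c i) =
      sumBefore (fun l => f (c l)) j + f t := by
  simp only [sumBefore]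
  rw [← Finset.add_sum_erase _ _ (Finset.mem_univ i),
    ← Finset.add_sum_erase _ (fun l => if l.1 < j then f (c l) else 0) (Finset.mem_univ i)]
  rw [Finset.sum_congr rfl fun l hl => by
    rw [Function.update_of_ne (Finset.ne_of_mem_erase hl)]]
  simp only [Function.update_self, hj, if_true]
  rw [add_right_comm, add_comm (f t), add_right_comm (f (c i))]

lemma sumBefore_mono_aux {n : ℕ} (f : Fin n → ℕ) (i : Fin n) (j : ℕ) (hij : i.1 < j) :
    sumBefore f i + f i ≤ sumBefore f j := by
  simp only [sumBefore]
  rw [← Finset.add_sum_erase _ _ (Finset.mem_univ i),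
    ← Finset.add_sum_erase _ (fun l => if l.1 < j then f l else 0) (Finset.mem_univ i)]
  simp only [lt_self_iff_false, if_false, hij, if_true, zero_add]
  rw [add_comm]
  refine Nat.add_le_add_left (Finset.sum_le_sum fun l _ => ?_) _
  split_ifs <;> omega

namespace DTree

/-- A version of `sum_mergeInputs` sensitive to positions: inputs before `i` keep theirs, those of
the inserted block are shifted by `i`, and those after `i` by `s + 1`. -/
lemma sum_mergeInputs_pos {α : Type w} {M : Type*} [AddCommMonoid M] {m s : ℕ}
    (F : ℕ → α → M) (c : Fin (m + 2) → α) (i : Fin (m + 2)) (e : Fin (s + 2) → α) :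
    ∑ j, F j.1 (mergeInputs c i e j) =
      ∑ j, if j < i then F j.1 (c j) else if j = i then ∑ l, F (i.1 + l.1) (e l)
        else F (j.1 + (s + 1)) (c j) := by
  obtain ⟨i, hi⟩ := i
  obtain ⟨r, hr⟩ : ∃ r, m + 2 = i + 1 + r := ⟨m + 1 - i, by omega⟩
  let C : ℕ → α := fun j => if h : j < m + 2 then c ⟨j, h⟩ else c 0
  let E : ℕ → α := fun j => if h : j < s + 2 then e ⟨j, h⟩ else c 0
  have hE : ∑ l, F (i + l.1) (e l) = ∑ l ∈ Finset.range (s + 2), F (i + l) (E l) := by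
    rw [← Fin.sum_univ_eq_sum_range (fun l => F (i + l) (E l))]
    exact Finset.sum_congr rfl fun j _ => by simp [E]
  have hR : (∑ j : Fin (m + 2), if j < ⟨i, hi⟩ then F j.1 (c j) else if j = ⟨i, hi⟩ then
      ∑ l, F (i + l.1) (e l) else F (j.1 + (s + 1)) (c j)) =
      ∑ j ∈ Finset.range (m + 2), if j < i then F j (C j) else if j = i then
      ∑ l, F (i + l.1) (e l) else F (j + (s + 1)) (C j) := by
    rw [← Fin.sum_univ_eq_sum_range (fun j => if j < i then F j (C j) else if j = i then
      ∑ l, F (i + l.1) (e l) else F (j + (s + 1)) (C j))]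
    exact Finset.sum_congr rfl fun j _ => by simp [C, Fin.lt_def, Fin.ext_iff]
  have hL : ∑ j, F j.1 (mergeInputs c ⟨i, hi⟩ e j) =
      ∑ j ∈ Finset.range (m + s + 1 + 2), if j < i then F j (C j) else if j < i + (s + 2) then
        F j (E (j - i)) else F j (C (j - (s + 1))) := by
    rw [← Fin.sum_univ_eq_sum_range (fun j => if j < i then F j (C j) else if j < i + (s + 2) then
        F j (E (j - i)) else F j (C (j - (s + 1))))]
    refine Finset.sum_congr rfl fun j _ => ?_
    simp only [mergeInputs, C, E]
    grind
  refine hL.trans (Eq.trans ?_ hR.symm)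
  rw [show m + s + 1 + 2 = i + (s + 2) + r by omega, hr,
    Finset.sum_range_add _ (i + (s + 2)) r, Finset.sum_range_add _ i (s + 2),
    Finset.sum_range_add _ (i + 1) r, Finset.sum_range_succ _ i]
  congr 1
  · congr 1
    · exact Finset.sum_congr rfl fun x hx => by simp [Finset.mem_range.1 hx]
    · simp only [lt_self_iff_false, if_false, if_true, hE]
      exact Finset.sum_congr rfl fun x hx => by simp [Finset.mem_range.1 hx]
  · refine Finset.sum_congr rfl fun x hx => ?_
    rw [if_neg (by omega), if_neg (by omega), if_neg (by omega), if_neg (by omega)]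
    congr 1
    · omega
    · congr 1
      omega

variable {α : Type w} {m s : ℕ}

lemma sumBefore_merge_le {M : Type*} [AddCommMonoid M] (f : α → M) (c : Fin (m + 2) → α)
    (i : Fin (m + 2)) (e : Fin (s + 2) → α) (j : ℕ) (hj : j ≤ i.1) :
    sumBefore (fun l => f (mergeInputs c i e l)) j = sumBefore (fun l => f (c l)) j := by
  simp only [sumBefore]
  rw [sum_mergeInputs_pos (fun l x => if l < j then f x else 0)]
  refine Finset.sum_congr rfl fun l _ => ?_
  rcases lt_trichotomy l i with h | h | h
  · simp [h]
  · subst h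
    simp only [lt_self_iff_false, if_false, if_true, hj.not_gt]
    exact Finset.sum_eq_zero fun x _ => if_neg (by omega)
  · have h' : i.1 < l.1 := h
    simp only [h.not_gt, h.ne', if_false]
    rw [if_neg (by omega), if_neg (by omega)]

lemma sumBefore_merge_mid {M : Type*} [AddCommMonoid M] (f : α → M) (c : Fin (m + 2) → α)
    (i : Fin (m + 2)) (e : Fin (s + 2) → α) (j : ℕ) (hj : j ≤ s + 2) :
    sumBefore (fun l => f (mergeInputs c i e l)) (i.1 + j) =
      sumBefore (fun l => f (c l)) i.1 + sumBefore (fun l => f (e l)) j := by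
  simp only [sumBefore]
  rw [sum_mergeInputs_pos (fun l x => if l < i.1 + j then f x else 0)]
  rw [← Finset.add_sum_erase _ _ (Finset.mem_univ i),
    ← Finset.add_sum_erase _ (fun l => if l.1 < i.1 then f (c l) else 0) (Finset.mem_univ i)]
  simp only [lt_self_iff_false, if_false, if_true, zero_add, add_lt_add_iff_left]
  rw [add_comm]
  congr 1
  refine Finset.sum_congr rfl fun l hl => ?_
  have hl' := Finset.ne_of_mem_erase hl
  rcases lt_or_gt_of_ne hl' with h | h
  · have h' : l.1 < i.1 := h
    simp only [h, h', if_true]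
    rw [if_pos (by omega)]
  · have h' : i.1 < l.1 := h
    simp only [h.not_gt, h.ne', if_false]
    rw [if_neg (by omega), if_neg (by omega)]

lemma sumBefore_merge_gt {M : Type*} [AddCommMonoid M] (f : α → M) (c : Fin (m + 2) → α)
    (i : Fin (m + 2)) (e : Fin (s + 2) → α) (j : ℕ) (hj : i.1 < j) :
    sumBefore (fun l => f (mergeInputs c i e l)) (j + (s + 1)) + f (c i) =
      sumBefore (fun l => f (c l)) j + ∑ l, f (e l) := by
  simp only [sumBefore]
  rw [sum_mergeInputs_pos (fun l x => if l < j + (s + 1) then f x else 0)]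
  rw [← Finset.add_sum_erase _ _ (Finset.mem_univ i),
    ← Finset.add_sum_erase _ (fun l => if l.1 < j then f (c l) else 0) (Finset.mem_univ i)]
  simp only [lt_self_iff_false, if_false, if_true, hj]
  rw [Finset.sum_congr rfl (g := fun l => f (e l)) fun l _ => if_pos (by omega)]
  rw [Finset.sum_congr rfl (g := fun l : Fin (m + 2) => if l.1 < j then f (c l) else 0)
    fun l hl => ?_]
  · rw [add_right_comm, add_comm (∑ l, f (e l)), add_right_comm (f (c i))]
  have hl' := Finset.ne_of_mem_erase hl
  rcases lt_or_gt_of_ne hl' with h | h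
  · have h' : l.1 < i.1 := h
    simp only [h, if_true]
    rw [if_pos (by omega), if_pos (by omega)]
  · have h' : i.1 < l.1 := h
    simp only [h.not_gt, h.ne', if_false]
    simp

end DTree

end

/-! ### Iterated contractions of internal edges. -/

noncomputable section

namespace DTree

variable {k : Type u} [Field k] {P : NSOperad.{u, w} k}

/-- The total number of vertices of the inputs before position `i`. -/
abbrev vertBefore {m : ℕ} (c : Fin (m + 2) → DTree P) (i : ℕ) : ℕ :=
  sumBefore (fun j => (c j).vertices) i

/-- Contraction of the `a`-th internal edge; the edges are numbered in the order in which their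
lower ends occur in a depth-first traversal. -/
def contr : DTree P → ℕ → DTree P
  | leaf, _ => leaf
  | node m p c, a =>
    if h : a < ∑ i, (c i).vertices then
      let x := finSigmaFinEquiv.symm (⟨a, h⟩ : Fin (∑ i, (c i).vertices))
      -- Offset 0 in a block is the root of that input, whose edge leads to the present root. The
      -- other offsets are edges inside the input, numbered from 0 there, hence the shift by one.
      if x.2.1 = 0 then
        match c x.1 with
        | leaf => leaf
        | node _ q e => contractRoot p c x.1 q e
      else node m p (Function.update c x.1 (contr (c x.1) (x.2.1 - 1)))
    else leaf

lemma lt_sum_vertices {m : ℕ} (c : Fin (m + 2) → DTree P) (i : Fin (m + 2)) (l : ℕ)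
    (h : l < (c i).vertices) : vertBefore c i + l < ∑ i, (c i).vertices := by
  rw [← finSigmaFinEquiv_eq (fun i => (c i).vertices) i ⟨l, h⟩]
  exact Fin.is_lt _

lemma finSigmaFinEquiv_symm {m : ℕ} (c : Fin (m + 2) → DTree P) (i : Fin (m + 2)) (l : ℕ)
    (h : l < (c i).vertices) :
    finSigmaFinEquiv.symm (⟨vertBefore c i + l, lt_sum_vertices c i l h⟩ :
      Fin (∑ i, (c i).vertices)) = ⟨i, ⟨l, h⟩⟩ := by
  rw [Equiv.symm_apply_eq]
  exact Fin.ext (finSigmaFinEquiv_eq (fun i => (c i).vertices) i ⟨l, h⟩).symm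

lemma contr_root {m s : ℕ} (p : P.obj (m + 2)) (c : Fin (m + 2) → DTree P) (i : Fin (m + 2))
    (q : P.obj (s + 2)) (e : Fin (s + 2) → DTree P) (h : c i = node s q e) (a : ℕ)
    (ha : a = vertBefore c i) :
    contr (node m p c) a = contractRoot p c i q e := by
  subst ha
  have h0 : 0 < (c i).vertices := by rw [h]; simp only [vertices]; omega
  have h1 := lt_sum_vertices c i 0 h0
  have h2 := finSigmaFinEquiv_symm c i 0 h0
  simp only [add_zero] at h1 h2
  simp only [contr, h1, dif_pos]
  rw [h2]
  simp only [if_true]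
  rw [h]

lemma contr_child {m : ℕ} (p : P.obj (m + 2)) (c : Fin (m + 2) → DTree P) (i : Fin (m + 2))
    (b : ℕ) (h : b + 1 < (c i).vertices) (a : ℕ) (ha : a = vertBefore c i + (b + 1)) :
    contr (node m p c) a = node m p (Function.update c i (contr (c i) b)) := by
  subst ha
  have h1 := lt_sum_vertices c i (b + 1) h
  simp only [contr, h1, dif_pos]
  rw [finSigmaFinEquiv_symm c i (b + 1) h]
  simp

lemma vertices_contractRoot {m s : ℕ} (p : P.obj (m + 2)) (c : Fin (m + 2) → DTree P)
    (i : Fin (m + 2)) (q : P.obj (s + 2)) (e : Fin (s + 2) → DTree P) (h : c i = node s q e) :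
    (contractRoot p c i q e).vertices + 1 = (node m p c).vertices := by
  have := sum_mergeInputs vertices c i e
  rw [h] at this
  simp only [contractRoot, vertices] at this ⊢
  omega

lemma leaves_contractRoot {m s : ℕ} (p : P.obj (m + 2)) (c : Fin (m + 2) → DTree P)
    (i : Fin (m + 2)) (q : P.obj (s + 2)) (e : Fin (s + 2) → DTree P) (h : c i = node s q e) :
    (contractRoot p c i q e).leaves = (node m p c).leaves := by
  have := sum_mergeInputs leaves c i e
  rw [h] at this
  simp only [contractRoot, leaves] at this ⊢
  omega

lemma sum_update {α : Type*} {m : ℕ} (f : α → ℕ) (c : Fin m → α) (i : Fin m) (t : α) :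
    ∑ j, f (Function.update c i t j) + f (c i) = ∑ j, f (c j) + f t := by
  rw [← Finset.add_sum_erase _ _ (Finset.mem_univ i),
    ← Finset.add_sum_erase _ (fun j => f (c j)) (Finset.mem_univ i)]
  rw [Finset.sum_congr rfl fun j hj => by
    rw [Function.update_of_ne (Finset.ne_of_mem_erase hj)]]
  rw [Function.update_self]
  omega

lemma contr_spec (t : DTree P) (a : ℕ) (h : a + 1 < t.vertices) :
    (t.contr a).vertices + 1 = t.vertices ∧ (t.contr a).leaves = t.leaves := by
  induction t generalizing a with
  | leaf => simp [vertices] at h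
  | node m p c ih =>
    simp only [vertices] at h
    obtain ⟨i, l, hl, rfl⟩ := exists_eq_sumBefore_add (fun i => (c i).vertices) a (by omega)
    cases l with
    | zero =>
      cases hc : c i with
      | leaf => rw [hc] at hl; simp [vertices] at hl
      | node s q e =>
        rw [contr_root p c i q e hc _ (add_zero _)]
        exact ⟨vertices_contractRoot p c i q e hc, leaves_contractRoot p c i q e hc⟩
    | succ b =>
      rw [contr_child p c i b hl _ rfl]
      obtain ⟨h1, h2⟩ := ih i b hl
      have e1 := sum_update vertices c i ((c i).contr b)
      have e2 := sum_update leaves c i ((c i).contr b)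
      simp only [vertices, leaves]
      omega

/-- Two orders of contraction produce equal arities that are not definitionally equal; the
heterogeneous equality is confined to the decoration of the root. -/
lemma node_congr {m m' : ℕ} (hm : m = m') {p : P.obj (m + 2)} {p' : P.obj (m' + 2)}
    {c : Fin (m + 2) → DTree P} {c' : Fin (m' + 2) → DTree P} (hp : HEq p p')
    (hc : ∀ j (h : j < m + 2), c ⟨j, h⟩ = c' ⟨j, hm ▸ h⟩) : node m p c = node m' p' c' := by
  subst hm
  rw [eq_of_heq hp]
  congr 1
  funext j
  exact hc j.1 j.2

lemma NSOperad_comp_heq {m n l l' : ℕ} (i j : ℕ) (hij : i = j) (hi : i < m) (hj : j < m)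
    (h : l + 1 = m + n) (h' : l' + 1 = m + n) (p : P.obj m) (q : P.obj n) :
    HEq (P.comp i hi h p q) (P.comp j hj h' p q) := by
  obtain rfl : l = l' := by omega
  subst hij
  rfl

/-- Two successive edges on a path from the root can be contracted in either order by the axiom
`comp_seq`. The entry `u` is arbitrary because merging overwrites it. -/
lemma contractRoot_seq {m s r : ℕ} (p : P.obj (m + 2)) (c : Fin (m + 2) → DTree P)
    (i : Fin (m + 2)) (q : P.obj (s + 2)) (e : Fin (s + 2) → DTree P) (j : Fin (s + 2))
    (q' : P.obj (r + 2)) (e' : Fin (r + 2) → DTree P) (u : DTree P) :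
    contractRoot (P.comp i.1 i.2 (by omega) p q : P.obj (m + s + 1 + 2)) (mergeInputs c i e)
      ⟨i.1 + j.1, by omega⟩ q' e' =
    contractRoot p (Function.update c i u) i
      (P.comp j.1 j.2 (by omega) q q' : P.obj (s + r + 1 + 2)) (mergeInputs e j e') := by
  unfold contractRoot
  refine node_congr (by omega) ?_ ?_
  · rw [P.comp_seq i.1 j.1 i.2 j.2 (by omega) (by omega)
      (show (s + r + 1 + 2) + 1 = s + 2 + (r + 2) by omega) (by omega)]
    exact NSOperad_comp_heq _ _ rfl _ _ _ _ _ _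
  · intro x hx
    simp only [mergeInputs, Function.update_apply, Fin.ext_iff]
    grind

/-- Two edges to different inputs of the root commute by the axiom `comp_par`; the first contraction
shifts the later input by `s + 1`. -/
lemma contractRoot_par {m s r : ℕ} (p : P.obj (m + 2)) (c : Fin (m + 2) → DTree P)
    (i j : Fin (m + 2)) (hij : i < j) (q : P.obj (s + 2)) (e : Fin (s + 2) → DTree P)
    (q' : P.obj (r + 2)) (e' : Fin (r + 2) → DTree P) :
    contractRoot (P.comp i.1 i.2 (by omega) p q : P.obj (m + s + 1 + 2)) (mergeInputs c i e)
      ⟨j.1 + (s + 1), by omega⟩ q' e' =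
    contractRoot (P.comp j.1 j.2 (by omega) p q' : P.obj (m + r + 1 + 2)) (mergeInputs c j e')
      ⟨i.1, by omega⟩ q e := by
  have hij' : i.1 < j.1 := hij
  unfold contractRoot
  refine node_congr (by omega) ?_ ?_
  · rw [P.comp_par i.1 j.1 (j.1 + (s + 1)) hij' j.2 (by omega) (by omega) (by omega)
      (show (m + r + 1 + 2) + 1 = m + 2 + (r + 2) by omega) (by omega) _ (by omega)]
    exact NSOperad_comp_heq _ _ rfl _ _ _ _ _ _
  · intro x hx
    simp only [mergeInputs]
    grind

lemma mergeInputs_apply_lt {α : Type w} {m s : ℕ} (c : Fin (m + 2) → α) (i j : Fin (m + 2))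
    (hij : j < i) (e : Fin (s + 2) → α) (h : j.1 < m + s + 1 + 2) :
    mergeInputs c i e ⟨j.1, h⟩ = c j := by
  have : j.1 < i.1 := hij
  simp [mergeInputs, this]

lemma mergeInputs_apply_mid {α : Type w} {m s : ℕ} (c : Fin (m + 2) → α) (i : Fin (m + 2))
    (e : Fin (s + 2) → α) (j : Fin (s + 2)) (h : i.1 + j.1 < m + s + 1 + 2) :
    mergeInputs c i e ⟨i.1 + j.1, h⟩ = e j := by
  simp [mergeInputs]

lemma mergeInputs_apply_gt {α : Type w} {m s : ℕ} (c : Fin (m + 2) → α) (i j : Fin (m + 2))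
    (hij : i < j) (e : Fin (s + 2) → α) (h : j.1 + (s + 1) < m + s + 1 + 2) :
    mergeInputs c i e ⟨j.1 + (s + 1), h⟩ = c j := by
  have : i.1 < j.1 := hij
  simp only [mergeInputs]
  rw [dif_neg (by omega), dif_neg (by omega)]
  exact congrArg c (Fin.ext (by simp))

lemma mergeInputs_update_gt {α : Type w} {m s : ℕ} (c : Fin (m + 2) → α) (i j : Fin (m + 2))
    (hij : i < j) (e : Fin (s + 2) → α) (u : α) :
    mergeInputs (Function.update c j u) i e =
      Function.update (mergeInputs c i e) ⟨j.1 + (s + 1), by omega⟩ u := by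
  have : i.1 < j.1 := hij
  funext x
  simp only [mergeInputs, Function.update_apply, Fin.ext_iff]
  grind

lemma mergeInputs_update_lt {α : Type w} {m s : ℕ} (c : Fin (m + 2) → α) (i j : Fin (m + 2))
    (hij : j < i) (e : Fin (s + 2) → α) (u : α) :
    mergeInputs (Function.update c j u) i e =
      Function.update (mergeInputs c i e) ⟨j.1, by omega⟩ u := by
  have : j.1 < i.1 := hij
  funext x
  simp only [mergeInputs, Function.update_apply, Fin.ext_iff]
  grind

/-- A simplicial identity: once edge `a` is contracted, the edge that was number `b + 1` becomes
number `b`. The cases are governed by whether the edges belong to the same input of the root and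
whether each of them ends at the root. -/
lemma contr_contr (t : DTree P) (a b : ℕ) (hab : a ≤ b) (hb : b + 2 < t.vertices) :
    (t.contr a).contr b = (t.contr (b + 1)).contr a := by
  induction t generalizing a b with
  | leaf => simp [vertices] at hb
  | node m p c ih =>
    simp only [vertices] at hb
    obtain ⟨i, x, hx, hax⟩ := exists_eq_sumBefore_add (fun i => (c i).vertices) a (by omega)
    obtain ⟨j, y, hy, hby⟩ := exists_eq_sumBefore_add (fun i => (c i).vertices) (b + 1) (by omega)
    rcases lt_trichotomy i j with hij | hij | hij
    · have hm := sumBefore_mono_aux (fun i => (c i).vertices) i j hij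
      rcases x with _ | x <;> rcases y with _ | y
      · cases hi : c i with
        | leaf => rw [hi] at hx; simp [vertices] at hx
        | node s q e =>
        cases hj : c j with
        | leaf => rw [hj] at hy; simp [vertices] at hy
        | node r q' e' =>
        rw [contr_root p c i q e hi a (by omega), contr_root p c j q' e' hj (b + 1) (by omega)]
        have e1 := sumBefore_merge_gt vertices c i e j hij
        have e2 := sumBefore_merge_le vertices c j e' i (le_of_lt hij)
        rw [hi] at e1
        simp only [vertices] at e1
        refine (contr_root _ (mergeInputs c i e) ⟨j.1 + (s + 1), by omega⟩ q' e'
          ((mergeInputs_apply_gt c i j hij e _).trans hj) b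
            (by dsimp only [vertBefore]; omega)).trans (Eq.trans ?_
          (contr_root _ (mergeInputs c j e') ⟨i.1, by omega⟩ q e
          ((mergeInputs_apply_lt c j i hij e' _).trans hi) a
            (by dsimp only [vertBefore]; omega)).symm)
        exact contractRoot_par p c i j hij q e q' e'
      · cases hi : c i with
        | leaf => rw [hi] at hx; simp [vertices] at hx
        | node s q e =>
        rw [contr_root p c i q e hi a (by omega), contr_child p c j y hy (b + 1) hby]
        have e1 := sumBefore_merge_gt vertices c i e j hij
        have e2 := sumBefore_update_le vertices c j ((c j).contr y) i (le_of_lt hij)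
        rw [hi] at e1
        simp only [vertices] at e1
        have e3 := mergeInputs_apply_gt c i j hij e (by omega)
        rw [contractRoot, contr_child _ (mergeInputs c i e) ⟨j.1 + (s + 1), by omega⟩ y
          (by rw [e3]; exact hy) b (by dsimp only [vertBefore]; omega),
          contr_root p _ i q e (by rw [Function.update_of_ne hij.ne, hi]) a
            (by dsimp only [vertBefore]; omega), contractRoot, mergeInputs_update_gt c i j hij, e3]
      · cases hj : c j with
        | leaf => rw [hj] at hy; simp [vertices] at hy
        | node r q' e' =>
        rw [contr_child p c i x hx a hax, contr_root p c j q' e' hj (b + 1) (by omega)]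
        have e0 := (contr_spec (c i) x hx).1
        have e1 := sumBefore_update_gt vertices c i ((c i).contr x) j hij
        have e2 := sumBefore_merge_le vertices c j e' i (le_of_lt hij)
        have e3 := mergeInputs_apply_lt c j i hij e' (by omega)
        rw [contr_root p _ j q' e' (by rw [Function.update_of_ne hij.ne', hj]) b
            (by dsimp only [vertBefore]; omega), contractRoot, contractRoot,
          contr_child _ (mergeInputs c j e') ⟨i.1, by omega⟩ x
          (by rw [e3]; exact hx) a (by dsimp only [vertBefore]; omega),
          mergeInputs_update_lt c j i hij, e3]
      · rw [contr_child p c i x hx a hax, contr_child p c j y hy (b + 1) hby]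
        have e0 := (contr_spec (c i) x hx).1
        have e1 := sumBefore_update_gt vertices c i ((c i).contr x) j hij
        have e2 := sumBefore_update_le vertices c j ((c j).contr y) i (le_of_lt hij)
        rw [contr_child p _ j y (by rw [Function.update_of_ne hij.ne']; exact hy) b
            (by dsimp only [vertBefore]; omega),
          contr_child p _ i x (by rw [Function.update_of_ne hij.ne]; exact hx) a
            (by dsimp only [vertBefore]; omega), Function.update_of_ne hij.ne',
          Function.update_of_ne hij.ne, Function.update_comm hij.ne]
    · subst hij
      rcases y with _ | y
      · omega
      rcases x with _ | x
      · cases hi : c i with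
        | leaf => rw [hi] at hx; simp [vertices] at hx
        | node s q e =>
        have hy' := hy
        rw [hi] at hy'
        simp only [vertices] at hy'
        rw [contr_root p c i q e hi a (by omega), contr_child p c i y hy (b + 1) hby]
        obtain ⟨j, z, hz, hjz⟩ := exists_eq_sumBefore_add (fun i => (e i).vertices) y (by omega)
        have e1 := sumBefore_merge_mid vertices c i e j j.2.le
        have e2 := sumBefore_update_le vertices c i ((c i).contr y) i le_rfl
        have e3 := mergeInputs_apply_mid c i e j (by omega)
        rcases z with _ | z
        · cases hj : e j with
          | leaf => rw [hj] at hz; simp [vertices] at hz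
          | node r q' e' =>
          rw [contractRoot, contr_root _ (mergeInputs c i e) ⟨i.1 + j.1, by omega⟩ q' e'
            (e3.trans hj) b (by dsimp only [vertBefore]; omega)]
          have e4 : (c i).contr y = contractRoot q e j q' e' := by
            rw [hi, contr_root q e j q' e' hj y (by omega)]
          rw [contr_root p _ i (P.comp j.1 j.2 (by omega) q q') (mergeInputs e j e')
            (by rw [Function.update_self, e4]; rfl) a (by dsimp only [vertBefore]; omega)]
          exact contractRoot_seq p c i q e j q' e' _
        · rw [contractRoot, contr_child _ (mergeInputs c i e) ⟨i.1 + j.1, by omega⟩ z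
            (by rw [e3]; exact hz) b (by dsimp only [vertBefore]; omega)]
          have e4 : (c i).contr y = node s q (Function.update e j ((e j).contr z)) := by
            rw [hi, contr_child q e j z hz y hjz]
          rw [contr_root p _ i q (Function.update e j ((e j).contr z))
            (by rw [Function.update_self, e4]) a (by dsimp only [vertBefore]; omega),
            contractRoot, mergeInputs_update_same, mergeInputs_update_right, e3]
      · rcases y with _ | y
        · omega
        rw [contr_child p c i x hx a hax, contr_child p c i (y + 1) hy (b + 1) hby]
        have e1 := contr_spec (c i) x hx
        have e2 := contr_spec (c i) (y + 1) hy
        have e3 := sumBefore_update_le vertices c i ((c i).contr x) i le_rfl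
        have e4 := sumBefore_update_le vertices c i ((c i).contr (y + 1)) i le_rfl
        rw [contr_child p _ i y (by rw [Function.update_self]; omega) b
            (by dsimp only [vertBefore]; omega),
          contr_child p _ i x (by rw [Function.update_self]; omega) a
            (by dsimp only [vertBefore]; omega), Function.update_self, Function.update_self,
          ih i x y (by omega) hy, Function.update_idem, Function.update_idem]
    · have := sumBefore_mono_aux (fun i => (c i).vertices) j i hij
      omega

end DTree

end

/-! ### Signs, and the vanishing of the square of the differential. -/

noncomputable section

/-- The sign `(-1)^x`. -/
def parity (k : Type u) [Field k] (x : ZMod 2) : k := if x = 0 then 1 else -1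

lemma parity_add (k : Type u) [Field k] (x y : ZMod 2) :
    parity k (x + y) = parity k x * parity k y := by
  have h : ∀ x : ZMod 2, x = 0 ∨ x = 1 := by decide
  have h11 : (1 + 1 : ZMod 2) = 0 := by decide
  rcases h x with rfl | rfl <;> rcases h y with rfl | rfl <;> simp [parity, h11]

lemma parity_one (k : Type u) [Field k] : parity k 1 = -1 := by simp [parity]

lemma parity_natCast (k : Type u) [Field k] (n : ℕ) : parity k n = (-1) ^ n := by
  induction n with
  | zero => simp [parity]
  | succ n ih => rw [Nat.cast_succ, parity_add, ih, parity_one, pow_succ]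

namespace DTree

variable {k : Type u} [Field k] {P : NSOperad.{u, w} k}

/-- The number of leaves minus one, modulo two. -/
def leavesPar (t : DTree P) : ZMod 2 := t.leaves + 1

/-- The number of vertices modulo two. -/
def vertPar (t : DTree P) : ZMod 2 := t.vertices

/-- The exponent of the sign that compares the sign conventions of `dEval` with the alternating
sum over the internal edges. -/
def signExp : DTree P → ZMod 2
  | leaf => 0
  | node m _ c => ∑ i, (signExp (c i) +
      vertPar (c i) * (m + 1 + sumBefore (fun j => leavesPar (c j)) i.1) +
      (m + 1 + i.1) * leavesPar (c i))

/-- Modulo two this splits the degree into `leavesPar` and `vertPar`, the two quantities used by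
`signExp`. -/
lemma deg_add_vertices (t : DTree P) : t.deg + t.vertices + 1 = t.leaves := by
  induction t with
  | leaf => rfl
  | node m p c ih =>
    simp only [deg, vertices, leaves]
    have : ∑ i, (c i).leaves = ∑ i, (c i).deg + ∑ i, (c i).vertices + (m + 2) := by
      rw [← Finset.sum_congr rfl fun i _ => ih i]
      simp [Finset.sum_add_distrib]
    omega

lemma degBefore_par {m : ℕ} (c : Fin (m + 2) → DTree P) (i : Fin (m + 2)) :
    (degBefore c i : ZMod 2) = sumBefore (fun j => leavesPar (c j)) i.1 +
      sumBefore (fun j => vertPar (c j)) i.1 := by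
  rw [← sumBefore_add, degBefore, Nat.cast_sum, Finset.sum_filter]
  refine Finset.sum_congr rfl fun j _ => ?_
  have h := congrArg (Nat.cast : ℕ → ZMod 2) (deg_add_vertices (c j))
  push_cast at h
  simp only [leavesPar, vertPar, ← h, Fin.lt_def]
  congr 1
  generalize ((c j).deg : ZMod 2) = x
  generalize ((c j).vertices : ZMod 2) = y
  revert x y
  decide

lemma leavesPar_node (m : ℕ) (p : P.obj (m + 2)) (c : Fin (m + 2) → DTree P) :
    leavesPar (node m p c) = ∑ i, leavesPar (c i) + m + 1 := by
  have h2 : (2 : ZMod 2) = 0 := by decide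
  simp only [leavesPar, leaves, Finset.sum_add_distrib]
  simp only [Nat.cast_sum, Finset.sum_const, Finset.card_univ, Fintype.card_fin, nsmul_eq_mul,
    Nat.cast_add, Nat.cast_ofNat, mul_one]
  linear_combination (-(m : ZMod 2) - 1) * h2

/-- Up to the coboundary of `signExp`, the sign exponent of a root edge is the number of that edge.
Modulo two the inputs to the right of `i` cancel, each input to the left leaves `s + 1` times its
degree, and the vertex that disappears supplies the remaining terms. -/
lemma signExp_contractRoot {m s : ℕ} (p : P.obj (m + 2)) (c : Fin (m + 2) → DTree P)
    (i : Fin (m + 2)) (q : P.obj (s + 2)) (e : Fin (s + 2) → DTree P) (h : c i = node s q e) :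
    signExp (node m p c) + signExp (contractRoot p c i q e) +
      sumBefore (fun j => vertPar (c j)) i.1 =
      i.1 + s * (m + 1 + i.1) + s * degBefore c i := by
  have h2 : (2 : ZMod 2) = 0 := by decide
  rw [degBefore_par]
  set H := sumBefore (fun j => leavesPar (c j)) with hH
  set V := sumBefore (fun j => vertPar (c j)) with hV
  have hl := leavesPar_node s q e
  have hv : vertPar (node s q e) = 1 + ∑ l, vertPar (e l) := by
    simp [vertPar, vertices]
  have hs : signExp (node s q e) = ∑ l, (signExp (e l) +
      vertPar (e l) * (s + 1 + sumBefore (fun j => leavesPar (e j)) l.1) +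
      (s + 1 + l.1) * leavesPar (e l)) := rfl
  have h1 : signExp (contractRoot p c i q e) =
      ∑ j, if j < i then signExp (c j) + vertPar (c j) * (m + s + 1 + 1 + H j.1) +
          (m + s + 1 + 1 + j.1) * leavesPar (c j)
        else if j = i then ∑ l, (signExp (e l) + vertPar (e l) * (m + s + 1 + 1 +
          (H i.1 + sumBefore (fun j => leavesPar (e j)) l.1)) +
          (m + s + 1 + 1 + (i.1 + l.1)) * leavesPar (e l))
        else signExp (c j) + vertPar (c j) * (m + 1 + H j.1) + (m + 1 + j.1) * leavesPar (c j) := by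
    simp only [contractRoot, signExp]
    refine (sum_mergeInputs_pos (fun J x => signExp x + vertPar x * (((m + s + 1 : ℕ) : ZMod 2) + 1 +
      sumBefore (fun j => leavesPar (mergeInputs c i e j)) J) +
      (((m + s + 1 : ℕ) : ZMod 2) + 1 + J) * leavesPar x) c i e).trans ?_
    refine Finset.sum_congr rfl fun j _ => ?_
    split_ifs with h3 h4
    · rw [sumBefore_merge_le leavesPar c i e j.1 (le_of_lt h3)]
      push_cast
      rfl
    · refine Finset.sum_congr rfl fun l _ => ?_
      rw [sumBefore_merge_mid leavesPar c i e l.1 l.2.le]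
      push_cast
      rfl
    · have hij : i.1 < j.1 := lt_of_le_of_ne (not_lt.1 h3) (fun h => h4 (Fin.ext h.symm))
      have e1 := sumBefore_merge_gt leavesPar c i e j.1 hij
      rw [h, hl] at e1
      push_cast
      linear_combination vertPar (c j) * e1 + (s + 1) * leavesPar (c j) * h2
  have h3 : signExp (node m p c) + signExp (contractRoot p c i q e) =
      ∑ j, ((s + 1) * (if j.1 < i.1 then leavesPar (c j) + vertPar (c j) else 0) +
      if j = i then (m + 1 + H i.1) + (m + 1 + i.1) * (s + 1) else 0) := by
    rw [h1, signExp, ← Finset.sum_add_distrib]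
    refine Finset.sum_congr rfl fun j _ => ?_
    rcases lt_trichotomy j i with hj | hj | hj
    · have hj' : j.1 < i.1 := hj
      simp only [hj, hj', hj.ne, if_true, if_false]
      linear_combination (signExp (c j) + vertPar (c j) * (m + 1 + H j.1) +
        (m + 1 + j.1) * leavesPar (c j)) * h2
    · subst hj
      simp only [lt_self_iff_false, if_false, if_true]
      rw [h, hl, hv, hs]
      have h4 : ∑ l, (signExp (e l) + vertPar (e l) * (m + s + 1 + 1 +
          (H j.1 + sumBefore (fun j => leavesPar (e j)) l.1)) +
          (m + s + 1 + 1 + (j.1 + l.1)) * leavesPar (e l)) =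
          ∑ l, (signExp (e l) +
            vertPar (e l) * (s + 1 + sumBefore (fun j => leavesPar (e j)) l.1) +
            (s + 1 + l.1) * leavesPar (e l)) + (m + 1 + H j.1) * ∑ l, vertPar (e l) +
          (m + 1 + j.1) * ∑ l, leavesPar (e l) := by
        rw [Finset.mul_sum, Finset.mul_sum, ← Finset.sum_add_distrib, ← Finset.sum_add_distrib]
        refine Finset.sum_congr rfl fun l _ => ?_
        ring
      rw [h4]
      linear_combination (∑ l, (signExp (e l) +
            vertPar (e l) * (s + 1 + sumBefore (fun j => leavesPar (e j)) l.1) +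
            (s + 1 + l.1) * leavesPar (e l)) + (m + 1 + H j.1) * ∑ l, vertPar (e l) +
          (m + 1 + j.1) * ∑ l, leavesPar (e l)) * h2
    · have hj' : i.1 < j.1 := hj
      simp only [hj.not_gt, hj'.not_gt, hj.ne', if_false]
      linear_combination (signExp (c j) + vertPar (c j) * (m + 1 + H j.1) +
        (m + 1 + j.1) * leavesPar (c j)) * h2
  have h5 : ∑ j, ((s + 1 : ZMod 2) * (if j.1 < i.1 then leavesPar (c j) + vertPar (c j) else 0)) =
      (s + 1) * (H i.1 + V i.1) := by
    rw [hH, hV, ← sumBefore_add, ← Finset.mul_sum]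
    rfl
  rw [h3, Finset.sum_add_distrib, h5]
  simp only [Finset.sum_ite_eq', Finset.mem_univ, if_true]
  linear_combination (H i.1 + V i.1 + m + 1) * h2

/-- The analogue for an edge inside an input. Contraction removes one vertex of that input and no
leaf, so apart from `signExp` of the input only the coefficient of `vertPar` survives. -/
lemma signExp_update {m : ℕ} (p : P.obj (m + 2)) (c : Fin (m + 2) → DTree P)
    (i : Fin (m + 2)) (t : DTree P) (hv : t.vertices + 1 = (c i).vertices)
    (hl : t.leaves = (c i).leaves) :
    signExp (node m p c) + signExp (node m p (Function.update c i t)) =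
      signExp (c i) + signExp t + (m + 1 + sumBefore (fun j => leavesPar (c j)) i.1) := by
  have h2 : (2 : ZMod 2) = 0 := by decide
  have hl' : leavesPar t = leavesPar (c i) := by simp [leavesPar, hl]
  have hv' : vertPar (c i) = vertPar t + 1 := by simp [vertPar, ← hv]
  have e1 : (fun j => leavesPar (Function.update c i t j)) = fun j => leavesPar (c j) := by
    funext j
    by_cases h : j = i
    · subst h; simp [hl']
    · simp [h]
  simp only [signExp]
  rw [e1, ← Finset.sum_add_distrib]
  rw [Finset.sum_eq_single i]
  · simp only [Function.update_self, hl', hv']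
    linear_combination (vertPar t * (m + 1 + sumBefore (fun j => leavesPar (c j)) i.1) +
      (m + 1 + i.1) * leavesPar (c i)) * h2
  · intro j _ hj
    rw [Function.update_of_ne hj]
    exact CharTwo.add_self_eq_zero _
  · simp

/-- The differential as an alternating sum over the internal edges. -/
lemma dEval_eq_sum (t : DTree P) (φ : DTree P → k) :
    dEval t φ = ∑ a ∈ Finset.range (t.vertices - 1),
      parity k (signExp t + signExp (t.contr a) + a) * φ (t.contr a) := by
  induction t generalizing φ with
  | leaf => simp [dEval, vertices]
  | node m p c ih =>
    have hr : (node m p c).vertices - 1 = ∑ i, (c i).vertices := by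
      simp only [vertices]; omega
    rw [hr, sum_range_eq_sum_blocks, dEval]
    refine Finset.sum_congr rfl fun i _ => ?_
    have hVc : ((sumBefore (fun j => (c j).vertices) i.1 : ℕ) : ZMod 2) =
      sumBefore (fun j => vertPar (c j)) i.1 := sumBefore_natCast _ _
    cases hc : c i with
    | leaf => simp [dEval, vertices]
    | node s q e =>
      have hv : (node s q e).vertices = (node s q e).vertices - 1 + 1 := by
        simp only [vertices]; omega
      -- In each block the offset 0 is the edge to the root, and the remaining offsets are the inner
      -- edges of the input.
      rw [hv, Finset.sum_range_succ']
      rw [add_comm]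
      congr 1
      · rw [← hc, ih i, hc, Finset.mul_sum]
        refine Finset.sum_congr rfl fun b hb => ?_
        have hb' : b + 1 < (c i).vertices := by
          have := Finset.mem_range.1 hb
          rw [hc]; omega
        have hsp := contr_spec (c i) b hb'
        rw [contr_child p c i b hb' _ rfl]
        rw [← hc, ← mul_assoc]
        congr 1
        rw [← parity_natCast k, ← parity_add]
        congr 1
        have hu := signExp_update p c i ((c i).contr b) hsp.1 hsp.2
        rw [hu]
        push_cast
        rw [hVc, degBefore_par]
        have h2 : (2 : ZMod 2) = 0 := by decide
        linear_combination -h2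
      · rw [contr_root p c i q e hc _ (add_zero _)]
        dsimp only
        congr 1
        rw [← parity_natCast k]
        congr 1
        have hu := signExp_contractRoot p c i q e hc
        have h2 : (2 : ZMod 2) = 0 := by decide
        have hi : ((m + 1 - i.1 : ℕ) : ZMod 2) = m + 1 + i.1 := by
          have : (m + 1 - i.1) + i.1 = m + 1 := by omega
          have h3 := congrArg (Nat.cast : ℕ → ZMod 2) this
          push_cast at h3
          linear_combination h3 - (i.1 : ZMod 2) * h2
        push_cast
        rw [hVc, hi]
        linear_combination -hu + (m + 1 + i.1 : ZMod 2) * h2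

/-- The involution exchanges the two orders in which the same pair of edges is removed, and it
changes the parity of `a + b`. -/
lemma sum_alternating_eq_zero {k : Type u} [Field k] (n : ℕ) (F : ℕ → ℕ → k)
    (hF : ∀ a b, a ≤ b → b + 1 < n → F a b = F (b + 1) a) :
    ∑ a ∈ Finset.range n, ∑ b ∈ Finset.range (n - 1),
      parity k (a + b) * F a b = 0 := by
  rw [← Finset.sum_product']
  refine Finset.sum_involution (fun x _ => if x.1 ≤ x.2 then (x.2 + 1, x.1) else (x.2, x.1 - 1))
    ?_ ?_ ?_ ?_
  · rintro ⟨a, b⟩ hx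
    simp only [Finset.mem_product, Finset.mem_range] at hx
    dsimp only
    split_ifs with h
    · rw [hF a b h (by omega)]
      simp only [Nat.cast_add, Nat.cast_one]
      rw [show ((b : ZMod 2) + 1 + a) = (a + b) + 1 by ring, parity_add k _ 1, parity_one]
      ring
    · obtain ⟨a, rfl⟩ : ∃ a', a = a' + 1 := ⟨a - 1, by omega⟩
      simp only [Nat.add_sub_cancel]
      rw [hF b a (by omega) (by omega)]
      simp only [Nat.cast_add, Nat.cast_one]
      rw [show ((a : ZMod 2) + 1 + b) = (b + a) + 1 by ring, parity_add k _ 1, parity_one]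
      ring
  · rintro ⟨a, b⟩ hx _ h
    dsimp only at h
    split_ifs at h with h'
    · simp only [Prod.mk.injEq] at h; omega
    · simp only [Prod.mk.injEq] at h; omega
  · rintro ⟨a, b⟩ hx
    simp only [Finset.mem_product, Finset.mem_range] at hx ⊢
    split_ifs with h <;> simp only <;> omega
  · rintro ⟨a, b⟩ hx
    simp only [Finset.mem_product, Finset.mem_range] at hx
    dsimp only
    by_cases h : a ≤ b
    · simp only [h, if_true]
      rw [if_neg (by omega)]
      simp
    · simp only [h, if_false]
      rw [if_pos (by omega)]
      exact Prod.ext (by dsimp only; omega) rfl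

/-- The value of `signExp` at the intermediate tree occurs twice and cancels, so only the
alternating sum over pairs of edges is left. -/
theorem dEval_dEval (t : DTree P) (φ : DTree P → k) : dEval t (fun t' => dEval t' φ) = 0 := by
  rw [dEval_eq_sum]
  have h : ∀ a ∈ Finset.range (t.vertices - 1),
      parity k (signExp t + signExp (t.contr a) + a) * dEval (t.contr a) φ =
      ∑ b ∈ Finset.range (t.vertices - 1 - 1), parity k (a + b) *
        (parity k (signExp t + signExp ((t.contr a).contr b)) * φ ((t.contr a).contr b)) := by
    intro a ha
    have hv := (contr_spec t a (by have := Finset.mem_range.1 ha; omega)).1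
    rw [dEval_eq_sum, Finset.mul_sum, show (t.contr a).vertices - 1 = t.vertices - 1 - 1 by omega]
    refine Finset.sum_congr rfl fun b _ => ?_
    rw [← mul_assoc, ← mul_assoc, ← parity_add, ← parity_add]
    congr 2
    have h2 : (2 : ZMod 2) = 0 := by decide
    linear_combination signExp (t.contr a) * h2
  rw [Finset.sum_congr rfl h]
  refine sum_alternating_eq_zero _ (fun a b => parity k (signExp t +
    signExp ((t.contr a).contr b)) * φ ((t.contr a).contr b)) fun a b hab hb => ?_
  rw [contr_contr t a b hab (by omega)]

end DTree

end

/-! ### The weight of binary trees, and reduction to normal monomials. -/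

noncomputable section

namespace BTree

variable {X : Type*}

/-- The tree obtained by grafting the tree `f j` on the `j`-th leaf, for all `j`. -/
def subst : BTree X → (ℕ → BTree X) → BTree X
  | leaf, f => f 0
  | node x l r, f => node x (l.subst f) (r.subst fun j => f (j + l.leaves))

lemma subst_congr {f g : ℕ → BTree X} (t : BTree X) (h : ∀ i < t.leaves, f i = g i) :
    t.subst f = t.subst g := by
  induction t generalizing f g with
  | leaf => exact h 0 one_pos
  | node x l r hl hr =>
    simp only [leaves] at h
    simp only [subst]
    rw [hl fun i hi => h i (by omega), hr fun i hi => h _ (by omega)]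

lemma subst_graft (f : ℕ → BTree X) (t s : BTree X) (i : ℕ) (hi : i < t.leaves) :
    (t.graft i s).subst f = t.subst fun j =>
      if j < i then f j else if j = i then s.subst (fun l => f (i + l)) else
        f (j - 1 + s.leaves) := by
  induction t generalizing f i with
  | leaf =>
    simp only [leaves] at hi
    obtain rfl : i = 0 := by omega
    simp [graft, subst]
  | node x l r hl hr =>
    simp only [leaves] at hi
    by_cases h : i < l.leaves
    · have e := leaves_graft l s i h
      simp only [graft, h, if_true, subst]
      rw [hl f i h]
      congr 1
      refine subst_congr r fun j _ => ?_
      rw [if_neg (by omega), if_neg (by omega)]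
      congr 1
      omega
    · simp only [graft, h, if_false, subst]
      rw [hr _ _ (by omega)]
      congr 1
      · refine subst_congr l fun j hj => ?_
        rw [if_pos (by omega)]
      · refine subst_congr r fun j hj => ?_
        by_cases h1 : j < i - l.leaves
        · rw [if_pos h1, if_pos (by omega)]
        · rw [if_neg h1, if_neg (show ¬ j + l.leaves < i by omega)]
          by_cases h2 : j = i - l.leaves
          · rw [if_pos h2, if_pos (show j + l.leaves = i by omega)]
            congr 1
            funext y
            congr 1
            omega
          · rw [if_neg h2, if_neg (show ¬ j + l.leaves = i by omega)]
            congr 1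
            omega

lemma leaves_subst (t : BTree X) (f : ℕ → BTree X) :
    (t.subst f).leaves = ∑ j ∈ Finset.range t.leaves, (f j).leaves := by
  induction t generalizing f with
  | leaf => simp [subst, leaves]
  | node x l r hl hr =>
    simp only [subst, leaves, hl, hr, Finset.sum_range_add]
    congr 1
    exact Finset.sum_congr rfl fun j _ => by rw [add_comm]

/-- The sum over the vertices of the number of leaves to the left of the vertex. -/
def weight : BTree X → ℕ
  | leaf => 0
  | node _ l r => l.leaves + l.weight + r.weight

/-- Bounds the weight in each arity, which makes an induction on the weight cover all trees. -/
lemma weight_le (t : BTree X) : t.weight ≤ t.leaves ^ 2 := by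
  induction t with
  | leaf => simp [weight]
  | node x l r hl hr =>
    have := l.leaves_pos
    have := r.leaves_pos
    simp only [weight, leaves]
    nlinarith

/-- A lighter tree with the same number of leaves leaves every contribution from outside that tree
unchanged. -/
lemma weight_subst_lt (t : BTree X) (f g : ℕ → BTree X) (i : ℕ) (hi : i < t.leaves)
    (hfg : ∀ j, j ≠ i → f j = g j) (h₁ : (f i).leaves = (g i).leaves)
    (h₂ : (f i).weight < (g i).weight) : (t.subst f).weight < (t.subst g).weight := by
  induction t generalizing f g i with
  | leaf =>
    simp only [leaves] at hi
    obtain rfl : i = 0 := by omega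
    exact h₂
  | node x l r hl hr =>
    simp only [leaves] at hi
    have e : (l.subst f).leaves = (l.subst g).leaves := by
      rw [leaves_subst, leaves_subst]
      refine Finset.sum_congr rfl fun j _ => ?_
      by_cases hj : j = i
      · rw [hj, h₁]
      · rw [hfg j hj]
    simp only [subst, weight, e]
    by_cases h : i < l.leaves
    · have := hl f g i h hfg h₁ h₂
      rw [subst_congr r fun j _ => hfg (j + l.leaves) (by omega)]
      omega
    · have := hr (fun j => f (j + l.leaves)) (fun j => g (j + l.leaves)) (i - l.leaves) (by omega)
        (fun j hj => hfg _ (by omega)) (by rwa [Nat.sub_add_cancel (by omega)])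
        (by rwa [Nat.sub_add_cancel (by omega)])
      rw [subst_congr l fun j _ => hfg j (by omega)]
      omega

/-- `t'` has the same leaves as `t`, and smaller weight, even after grafting other trees on the
leaves. -/
def IsLower (t' t : BTree X) : Prop :=
  t'.leaves = t.leaves ∧ ∀ f, (t'.subst f).leaves = (t.subst f).leaves ∧
    (t'.subst f).weight < (t.subst f).weight

end BTree

namespace LeftPBW

variable {k : Type u} [Field k] {P : NSOperad.{u, w} k} {X : Type*} [Fintype X] (B : LeftPBW P X)

/-- The monomials in the generators. -/
abbrev ev (t : BTree X) (n : ℕ) (h : t.leaves = n) : P.obj n := P.eval B.gen t n h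

/-- A rule turns `(A a B) b C` into `A c (B d C)`. The contributions `|A| + |B|` and `|A|` of the
two vertices become `|A|` and `|B|`, so the weight drops by `|A|`, which remains positive after any
grafting. -/
lemma ev_mem_span_lower (t : BTree X) (ht : ¬ t.Normal B.bad) (n : ℕ) (h : t.leaves = n) :
    B.ev t n h ∈ Submodule.span k {q | ∃ (t' : BTree X) (h' : t'.leaves = n),
      t'.IsLower t ∧ q = B.ev t' n h'} := by
  induction t generalizing n with
  | leaf => exact absurd trivial ht
  | node b l r ihl ihr =>
    by_cases hl : l.Normal B.bad
    swap
    · refine Submodule.span_induction (p := fun x _ => P.comp (m := r.leaves + 1) (n := l.leaves) 0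
        (Nat.succ_pos _) (l := n) (by simp only [BTree.leaves] at h; omega) (P.comp 1 one_lt_two
        (by omega) (B.gen b) (B.ev r r.leaves rfl)) x ∈ Submodule.span k {q | ∃ (t' : BTree X)
        (h' : t'.leaves = n), t'.IsLower (.node b l r) ∧ q = B.ev t' n h'})
        ?_ ?_ ?_ ?_ (ihl hl l.leaves rfl)
      · rintro _ ⟨l', e, hlow, rfl⟩
        refine Submodule.subset_span ⟨.node b l' r, by simp only [BTree.leaves] at h ⊢; omega,
          ⟨by simp only [BTree.leaves]; omega, fun f => ?_⟩,
          (P.eval_node _ _ _ _ e rfl _).symm⟩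
        obtain ⟨h1, h2⟩ := hlow.2 f
        simp only [BTree.subst, BTree.leaves, BTree.weight, e]
        omega
      · rw [map_zero]; exact Submodule.zero_mem _
      · intro x y _ _ hx hy
        rw [map_add]; exact Submodule.add_mem _ hx hy
      · intro x y _ hx
        rw [map_smul]; exact Submodule.smul_mem _ _ hx
    by_cases hr : r.Normal B.bad
    swap
    · refine Submodule.span_induction (p := fun x _ => P.comp (m := r.leaves + 1) (n := l.leaves) 0
        (Nat.succ_pos _) (l := n) (by simp only [BTree.leaves] at h; omega) (P.comp 1 one_lt_two
        (by omega) (B.gen b) x) (B.ev l l.leaves rfl) ∈ Submodule.span k {q | ∃ (t' : BTree X)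
        (h' : t'.leaves = n), t'.IsLower (.node b l r) ∧ q = B.ev t' n h'})
        ?_ ?_ ?_ ?_ (ihr hr r.leaves rfl)
      · rintro _ ⟨r', e, hlow, rfl⟩
        refine Submodule.subset_span ⟨.node b l r', by simp only [BTree.leaves] at h ⊢; omega,
          ⟨by simp only [BTree.leaves]; omega, fun f => ?_⟩,
          (P.eval_node _ _ _ _ rfl e _).symm⟩
        obtain ⟨h1, h2⟩ := hlow.2 fun j => f (j + l.leaves)
        simp only [BTree.subst, BTree.leaves, BTree.weight]
        omega
      · rw [map_zero, map_zero]; exact Submodule.zero_mem _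
      · intro x y _ _ hx hy
        rw [map_add, map_add]; exact Submodule.add_mem _ hx hy
      · intro x y _ hx
        rw [map_smul, map_smul]; exact Submodule.smul_mem _ _ hx
    simp only [BTree.Normal, hl, hr, true_and, not_forall, not_not] at ht
    obtain ⟨a, l₁, l₂, rfl, hbad⟩ := ht
    simp only [BTree.leaves] at h
    have := P.eval_comb B.gen Finset.univ (B.coeff a b) a b Prod.fst Prod.snd (B.rewrite a b hbad)
      l₁ l₂ r n h (by omega)
    change P.eval _ _ _ _ ∈ _
    rw [this]
    refine Submodule.sum_mem _ fun cd _ => Submodule.smul_mem _ _ (Submodule.subset_span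
      ⟨_, _, ⟨by simp only [BTree.leaves]; omega, fun f => ?_⟩, rfl⟩)
    have e : (fun j => f (j + l₂.leaves + l₁.leaves)) =
      fun j => f (j + (l₁.leaves + l₂.leaves)) := by
      funext j; congr 1; omega
    have := (l₁.subst f).leaves_pos
    simp only [BTree.subst, BTree.leaves, BTree.weight, e]
    omega

end LeftPBW

/-! ### Trees decorated by monomials -/

/-- Reduced planar trees in which every vertex with `l` inputs is decorated by a binary tree with
`l` leaves. -/
inductive MTree (X : Type w) : Type w
  | leaf : MTree X
  | node (m : ℕ) (p : {t : BTree X // t.leaves = m + 2}) (c : Fin (m + 2) → MTree X) : MTree X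

namespace MTree

variable {X : Type w}

/-- The binary tree obtained by composing all the decorations. -/
def flatten : MTree X → BTree X
  | leaf => .leaf
  | node m p c => p.1.subst fun j => if h : j < m + 2 then (c ⟨j, h⟩).flatten else .leaf

/-- The number of vertices. -/
def vertices : MTree X → ℕ
  | leaf => 0
  | node _ _ c => 1 + ∑ i, (c i).vertices

/-- All decorations are normal. -/
def Normal (bad : X → X → Prop) : MTree X → Prop
  | leaf => True
  | node _ p c => p.1.Normal bad ∧ ∀ i, (c i).Normal bad

/-- Contraction of the edge between the root and its `i`-th input. -/
def contractRoot {m s : ℕ} (p : {t : BTree X // t.leaves = m + 2}) (c : Fin (m + 2) → MTree X)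
    (i : Fin (m + 2)) (q : {t : BTree X // t.leaves = s + 2}) (e : Fin (s + 2) → MTree X) :
    MTree X :=
  node (m + s + 1) ⟨p.1.graft i.1 q.1, by
    have := BTree.leaves_graft p.1 q.1 i.1 (p.2.symm ▸ i.2)
    rw [p.2, q.2] at this
    omega⟩ (DTree.mergeInputs c i e)

/-- `Contr t t'`: the tree `t'` is obtained from `t` by contraction of an edge. -/
inductive Contr : MTree X → MTree X → Prop
  | root {m s : ℕ} (p : {t : BTree X // t.leaves = m + 2}) (c : Fin (m + 2) → MTree X)
      (i : Fin (m + 2)) (q : {t : BTree X // t.leaves = s + 2}) (e : Fin (s + 2) → MTree X) :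
      c i = node s q e → Contr (node m p c) (contractRoot p c i q e)
  | child {m : ℕ} (p : {t : BTree X // t.leaves = m + 2}) (c : Fin (m + 2) → MTree X)
      (i : Fin (m + 2)) (t : MTree X) :
      Contr (c i) t → Contr (node m p c) (node m p (Function.update c i t))

/-- Contraction grafts one monomial into another, which flattening does anyway. Hence the flattened
tree is an invariant of contractions. -/
lemma flatten_contractRoot {m s : ℕ} (p : {t : BTree X // t.leaves = m + 2})
    (c : Fin (m + 2) → MTree X) (i : Fin (m + 2)) (q : {t : BTree X // t.leaves = s + 2})
    (e : Fin (s + 2) → MTree X) (h : c i = node s q e) :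
    (contractRoot p c i q e).flatten = (node m p c).flatten := by
  simp only [contractRoot, flatten]
  rw [BTree.subst_graft _ _ _ _ (p.2.symm ▸ i.2)]
  refine BTree.subst_congr _ fun j hj => ?_
  rw [p.2] at hj
  by_cases h1 : j < i.1
  · rw [if_pos h1, dif_pos (by omega), dif_pos hj]
    simp [DTree.mergeInputs, h1]
  · rw [if_neg h1, dif_pos hj]
    by_cases h2 : j = i.1
    · subst h2
      simp only [if_true, h, flatten]
      refine BTree.subst_congr _ fun l hl => ?_
      rw [q.2] at hl
      rw [dif_pos (by omega), dif_pos hl]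
      simp [DTree.mergeInputs, hl]
    · rw [if_neg h2, q.2, dif_pos (by omega)]
      simp only [DTree.mergeInputs]
      rw [dif_neg (by omega), dif_neg (by omega)]
      congr 2
      exact Fin.ext (by dsimp only; omega)

lemma flatten_update {m : ℕ} (p : {t : BTree X // t.leaves = m + 2})
    (c : Fin (m + 2) → MTree X) (i : Fin (m + 2)) (t : MTree X)
    (h : t.flatten = (c i).flatten) :
    (node m p (Function.update c i t)).flatten = (node m p c).flatten := by
  simp only [flatten]
  refine BTree.subst_congr _ fun j hj => ?_
  rw [p.2] at hj
  rw [dif_pos hj, dif_pos hj]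
  by_cases h1 : (⟨j, hj⟩ : Fin (m + 2)) = i
  · subst h1; simp [h]
  · simp [h1]

lemma Contr.flatten_eq {t t' : MTree X} (h : Contr t t') : t'.flatten = t.flatten := by
  induction h with
  | root p c i q e h => exact flatten_contractRoot p c i q e h
  | child p c i t h ih => exact flatten_update p c i t ih

lemma leaves_flatten_node {m : ℕ} (p : {t : BTree X // t.leaves = m + 2})
    (c : Fin (m + 2) → MTree X) :
    (node m p c).flatten.leaves = ∑ i, (c i).flatten.leaves := by
  simp only [flatten]
  rw [BTree.leaves_subst, p.2, ← Fin.sum_univ_eq_sum_range (fun j =>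
    (if h : j < m + 2 then (c ⟨j, h⟩).flatten else BTree.leaf).leaves)]
  exact Finset.sum_congr rfl fun j _ => by simp

end MTree

lemma mergeInputs_map {α β : Type*} (f : α → β) {m s : ℕ} (c : Fin (m + 2) → α) (i : Fin (m + 2))
    (e : Fin (s + 2) → α) (j : Fin (m + s + 1 + 2)) :
    f (DTree.mergeInputs c i e j) =
      DTree.mergeInputs (fun j => f (c j)) i (fun j => f (e j)) j := by
  simp only [DTree.mergeInputs]
  split_ifs <;> rfl

namespace DTree.IsMultilin

variable {k : Type u} [Field k] {P : NSOperad.{u, w} k}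

/-- A multilinear function, as a linear function of the decoration of the root. -/
def rootMap {φ : DTree P → k} (hφ : IsMultilin φ) {m : ℕ} (c : Fin (m + 2) → DTree P) :
    P.obj (m + 2) →ₗ[k] k where
  toFun p := φ (node m p c)
  map_add' p q := by
    have := hφ 1 1 _ _ _ (IsLinComb.root m p q c)
    simpa using this
  map_smul' a p := by
    have := hφ a 0 _ _ _ (IsLinComb.root m p p c)
    simpa using this

lemma update {φ : DTree P → k} (hφ : IsMultilin φ) {m : ℕ} (p : P.obj (m + 2))
    (c : Fin (m + 2) → DTree P) (i : Fin (m + 2)) :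
    IsMultilin fun t => φ (node m p (Function.update c i t)) :=
  fun a b _ _ _ h => hφ a b _ _ _ (IsLinComb.child m p c i h)

end DTree.IsMultilin

namespace LeftPBW

variable {k : Type u} [Field k] {P : NSOperad.{u, w} k} {X : Type*} [Fintype X] (B : LeftPBW P X)

/-- The decorated tree defined by a tree decorated by monomials. -/
def toD : MTree X → DTree P
  | .leaf => .leaf
  | .node m p c => .node m (B.ev p.1 (m + 2) p.2) fun i => toD (c i)

lemma toD_contractRoot {m s : ℕ} (p : {t : BTree X // t.leaves = m + 2})
    (c : Fin (m + 2) → MTree X) (i : Fin (m + 2)) (q : {t : BTree X // t.leaves = s + 2})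
    (e : Fin (s + 2) → MTree X) :
    B.toD (MTree.contractRoot p c i q e) = DTree.contractRoot (B.ev p.1 (m + 2) p.2)
      (fun i => B.toD (c i)) i (B.ev q.1 (s + 2) q.2) fun i => B.toD (e i) := by
  simp only [MTree.contractRoot, toD, DTree.contractRoot]
  congr 1
  · exact P.eval_graft _ _ _ _ _ _ _ _ _
  · exact funext fun j => mergeInputs_map B.toD c i e j

lemma toD_update {m : ℕ} (c : Fin (m + 2) → MTree X) (i : Fin (m + 2)) (t : MTree X) :
    (fun j => B.toD (Function.update c i t j)) =
      Function.update (fun j => B.toD (c j)) i (B.toD t) := by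
  funext j
  by_cases h : j = i
  · subst h; simp
  · simp [h]

lemma leaves_toD (t : MTree X) : (B.toD t).leaves = t.flatten.leaves := by
  induction t with
  | leaf => rfl
  | node m p c ih =>
    rw [MTree.leaves_flatten_node, toD, DTree.leaves]
    exact Finset.sum_congr rfl fun i _ => ih i

lemma vertices_toD (t : MTree X) : (B.toD t).vertices = t.vertices := by
  induction t with
  | leaf => rfl
  | node m p c ih =>
    rw [MTree.vertices, toD, DTree.vertices]
    exact congrArg _ (Finset.sum_congr rfl fun i _ => ih i)

/-- At a tree of monomials the differential only involves trees of monomials: composites are grafted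
and not yet rewritten into normal ones. -/
lemma dEval_eq_zero_of_contr (t : MTree X) (φ : DTree P → k)
    (h : ∀ t', MTree.Contr t t' → φ (B.toD t') = 0) : (B.toD t).dEval φ = 0 := by
  induction t generalizing φ with
  | leaf => rfl
  | node m p c ih =>
    simp only [toD, DTree.dEval]
    refine Finset.sum_eq_zero fun i _ => ?_
    rw [ih i, mul_zero, add_zero]
    · cases hc : c i with
      | leaf => rfl
      | node s q e =>
        simp only [toD]
        rw [← B.toD_contractRoot p c i q e, h _ (MTree.Contr.root p c i q e hc), mul_zero]
    · intro t' ht'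
      have := h _ (MTree.Contr.child p c i t' ht')
      rwa [toD, toD_update] at this

/-- Rewriting one non-normal decoration expresses the value through trees of smaller flattened
weight. If the decoration of the root is normal, the argument is applied inside an input that is
not. -/
lemma eq_zero_of_not_normal (t : MTree X) (ht : ¬ t.Normal B.bad) {φ : DTree P → k}
    (hφ : DTree.IsMultilin φ) (h : ∀ t' : MTree X, t'.flatten.leaves = t.flatten.leaves →
      t'.flatten.weight < t.flatten.weight → φ (B.toD t') = 0) : φ (B.toD t) = 0 := by
  induction t generalizing φ with
  | leaf => exact absurd trivial ht
  | node m p c ih =>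
    by_cases hp : p.1.Normal B.bad
    · simp only [MTree.Normal, hp, true_and, not_forall] at ht
      obtain ⟨i, hi⟩ := ht
      have := ih i hi (hφ.update (B.ev p.1 (m + 2) p.2) (fun j => B.toD (c j)) i) fun t' h1 h2 => ?_
      · simpa [toD] using this
      · rw [← toD_update]
        refine h (.node m p (Function.update c i t')) ?_ ?_
        · simp only [MTree.leaves_flatten_node]
          refine Finset.sum_congr rfl fun j _ => ?_
          by_cases hj : j = i
          · subst hj; simp [h1]
          · simp [hj]
        · refine BTree.weight_subst_lt _ _ _ i.1 (p.2.symm ▸ i.2) (fun j hj => ?_) ?_ ?_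
          · split_ifs with hj'
            · rw [Function.update_of_ne fun h => hj (Fin.ext_iff.1 h)]
            · rfl
          · simpa using h1
          · simpa using h2
    · have key := B.ev_mem_span_lower p.1 hp (m + 2) p.2
      have : Submodule.span k {q | ∃ (t' : BTree X) (h' : t'.leaves = m + 2),
          t'.IsLower p.1 ∧ q = B.ev t' (m + 2) h'} ≤
          LinearMap.ker (hφ.rootMap fun i => B.toD (c i)) := by
        rw [Submodule.span_le]
        rintro _ ⟨t', h', hlow, rfl⟩
        exact h (.node m ⟨t', h'⟩ c) (hlow.2 _).1 (hlow.2 _).2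
      exact this key

/-- A multilinear function that vanishes on normal trees of small weight vanishes on all trees
of small weight. -/
lemma eq_zero_of_weight_lt {φ : DTree P → k} (hφ : DTree.IsMultilin φ) (n N : ℕ)
    (h : ∀ t : MTree X, t.Normal B.bad → t.flatten.leaves = n → t.flatten.weight < N →
      φ (B.toD t) = 0) (t : MTree X) (hn : t.flatten.leaves = n) (hN : t.flatten.weight < N) :
    φ (B.toD t) = 0 := by
  induction hw : t.flatten.weight using Nat.strong_induction_on generalizing t with
  | _ w ih =>
    by_cases ht : t.Normal B.bad
    · exact h t ht hn hN
    · exact B.eq_zero_of_not_normal t ht hφ fun t' h1 h2 =>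
        ih _ (by omega) t' (by omega) (by omega) rfl

lemma eq_zero_of_monomials {φ : DTree P → k} (hφ : DTree.IsMultilin φ)
    (h : ∀ t : MTree X, φ (B.toD t) = 0) (t : DTree P) : φ t = 0 := by
  induction t generalizing φ with
  | leaf => exact h .leaf
  | node m p c ih =>
    -- `S` collects the inputs that are still arbitrary; the others are already trees of monomials.
    suffices H : ∀ S : Finset (Fin (m + 2)), ∀ c' : Fin (m + 2) → DTree P,
        (∀ i ∈ S, c' i = c i) → (∀ i, i ∉ S → ∃ x, c' i = B.toD x) → φ (.node m p c') = 0 from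
      H Finset.univ c (fun _ _ => rfl) fun i hi => absurd (Finset.mem_univ i) hi
    intro S
    induction S using Finset.induction_on with
    | empty =>
      intro c' _ hc'
      choose x hx using fun i => hc' i (Finset.notMem_empty i)
      obtain rfl : c' = fun i => B.toD (x i) := funext hx
      have : Submodule.span k {q | ∃ (t : BTree X) (h : t.leaves = m + 2),
          q = P.eval B.gen t (m + 2) h} ≤ LinearMap.ker (hφ.rootMap fun i => B.toD (x i)) := by
        rw [Submodule.span_le]
        rintro _ ⟨t, ht, rfl⟩
        exact h (.node m ⟨t, ht⟩ x)
      exact this (B.span (m + 2) p)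
    | insert i S hi ihS =>
      intro c' h1 h2
      have := ih i (hφ.update p c' i) fun x => ihS _ (fun j hj => ?_) fun j hj => ?_
      · rwa [← h1 i (Finset.mem_insert_self i S), Function.update_eq_self] at this
      · have hji : j ≠ i := fun e => hi (e ▸ hj)
        rw [Function.update_of_ne hji]
        exact h1 j (Finset.mem_insert_of_mem hj)
      · by_cases hji : j = i
        · subst hji
          exact ⟨x, by simp⟩
        · rw [Function.update_of_ne hji]
          exact h2 j (by simp [hji, hj])

/-- A multilinear function is determined by its values at the normal trees. -/
lemma eq_zero_of_normal {φ : DTree P → k} (hφ : DTree.IsMultilin φ)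
    (h : ∀ t : MTree X, t.Normal B.bad → φ (B.toD t) = 0) : φ = 0 :=
  funext fun t => B.eq_zero_of_monomials hφ (fun t => B.eq_zero_of_weight_lt hφ t.flatten.leaves
    (t.flatten.weight + 1) (fun t ht _ _ => h t ht) t rfl (Nat.lt_succ_self _)) t

end LeftPBW

end

noncomputable section

/-! ### Multilinear functions given by trees of linear forms -/

/-- Reduced planar trees in which every vertex with `l` inputs is decorated by a linear form
on `P(l)`. -/
inductive FTree {k : Type u} [Field k] (P : NSOperad.{u, w} k) : Type (max u w)
  | leaf : FTree P
  | node (m : ℕ) (f : P.obj (m + 2) →ₗ[k] k) (c : Fin (m + 2) → FTree P) : FTree P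

namespace FTree

variable {k : Type u} [Field k] {P : NSOperad.{u, w} k}

/-- The number of leaves. -/
def leaves : FTree P → ℕ
  | leaf => 1
  | node _ _ c => ∑ i, (c i).leaves

/-- The number of vertices. -/
def vertices : FTree P → ℕ
  | leaf => 0
  | node _ _ c => 1 + ∑ i, (c i).vertices

/-- The value at a decorated tree. -/
def pair : FTree P → DTree P → k
  | leaf, .leaf => 1
  | node m f c, .node m' p c' =>
    if h : m' = m then f (h ▸ p) * ∏ i, pair (c i) (c' (Fin.cast (by rw [h]) i)) else 0
  | leaf, .node _ _ _ => 0
  | node _ _ _, .leaf => 0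

lemma pair_node (m : ℕ) (f : P.obj (m + 2) →ₗ[k] k) (c : Fin (m + 2) → FTree P)
    (p : P.obj (m + 2)) (c' : Fin (m + 2) → DTree P) :
    pair (node m f c) (.node m p c') = f p * ∏ i, pair (c i) (c' i) := by
  simp [pair]

lemma pair_node_of_ne {m m' : ℕ} (h : m' ≠ m) (f : P.obj (m + 2) →ₗ[k] k)
    (c : Fin (m + 2) → FTree P) (p : P.obj (m' + 2)) (c' : Fin (m' + 2) → DTree P) :
    pair (node m f c) (.node m' p c') = 0 := by
  simp [pair, h]

lemma pair_update {m : ℕ} (c : Fin m → FTree P) (c' : Fin m → DTree P) (j : Fin m) (t : DTree P) :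
    ∏ i, pair (c i) (Function.update c' j t i) =
      pair (c j) t * ∏ i ∈ Finset.univ.erase j, pair (c i) (c' i) := by
  rw [← Finset.mul_prod_erase _ _ (Finset.mem_univ j), Function.update_self]
  congr 1
  exact Finset.prod_congr rfl fun i hi => by
    rw [Function.update_of_ne (Finset.ne_of_mem_erase hi)]

lemma isMultilin_pair (f : FTree P) : DTree.IsMultilin (pair f) := by
  intro a b t t₁ t₂ h
  induction h generalizing f with
  | root m p₁ p₂ c =>
    cases f with
    | leaf => simp [pair]
    | node m' f d =>
      by_cases hm : m = m'
      · subst hm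
        simp only [pair_node, map_add, map_smul, smul_eq_mul]
        ring
      · simp [pair_node_of_ne hm]
  | @child m p c i t t₁ t₂ h ih =>
    cases f with
    | leaf => simp [pair]
    | node m' f d =>
      by_cases hm : m = m'
      · subst hm
        simp only [pair_node, pair_update, ih]
        ring
      · simp [pair_node_of_ne hm]

lemma eq_of_pair_ne_zero (f : FTree P) (t : DTree P) (h : pair f t ≠ 0) :
    t.leaves = f.leaves ∧ t.vertices = f.vertices := by
  induction f generalizing t with
  | leaf =>
    cases t with
    | leaf => exact ⟨rfl, rfl⟩
    | node m p c => exact absurd rfl h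
  | node m f c ih =>
    cases t with
    | leaf => exact absurd rfl h
    | node m' p c' =>
      by_cases hm : m' = m
      · subst hm
        rw [pair_node] at h
        have hi := fun i => ih i (c' i)
          (Finset.prod_ne_zero_iff.1 (right_ne_zero_of_mul h) i (Finset.mem_univ i))
        simp only [DTree.leaves, DTree.vertices, leaves, vertices]
        exact ⟨Finset.sum_congr rfl fun i _ => (hi i).1,
          congrArg _ (Finset.sum_congr rfl fun i _ => (hi i).2)⟩
      · exact absurd (pair_node_of_ne hm _ _ _ _) h

lemma pair_mem_bar (f : FTree P) (n i : ℕ) (hl : f.leaves = n) (hv : f.vertices + i + 1 = n) :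
    pair f ∈ P.bar n i :=
  ⟨isMultilin_pair f, fun t ht => by
    by_contra h
    have := eq_of_pair_ne_zero f t h
    exact ht (by omega)⟩

end FTree

namespace MTree

variable {X : Type w}

/-- Every input has at least one leaf. So with at most `n + 1` leaves the root has at most `n + 1`
inputs, and as it has at least two, each of them has at most `n` leaves. -/
lemma finite_leaves_le [Finite X] (n : ℕ) : {t : MTree X | t.flatten.leaves ≤ n}.Finite := by
  induction n with
  | zero =>
    convert Set.finite_empty (α := MTree X)
    ext t
    have := t.flatten.leaves_pos
    simp only [Set.mem_ofPred_eq, Set.mem_empty_iff_false, iff_false]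
    omega
  | succ n ih =>
    have h : ∀ m : ℕ, ((fun a : {t : BTree X // t.leaves = m + 2} × (Fin (m + 2) → MTree X) =>
        node m a.1 a.2) '' (Set.univ ×ˢ Set.pi Set.univ fun _ =>
          {t : MTree X | t.flatten.leaves ≤ n})).Finite := fun m =>
      (Set.finite_univ.prod (Set.Finite.pi fun _ => ih)).image _
    refine (((Set.finite_lt_nat n).biUnion fun m _ => h m).insert leaf).subset ?_
    intro t ht
    cases t with
    | leaf => exact Set.mem_insert _ _
    | node m p c =>
      simp only [Set.mem_ofPred_eq, leaves_flatten_node] at ht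
      have hpos : ∀ i, 1 ≤ (c i).flatten.leaves := fun i => (c i).flatten.leaves_pos
      have h1 : m + 2 ≤ ∑ i, (c i).flatten.leaves := by
        calc m + 2 = ∑ _i : Fin (m + 2), 1 := by simp
          _ ≤ _ := Finset.sum_le_sum fun i _ => hpos i
      have h2 : ∀ i, (c i).flatten.leaves ≤ n := by
        intro i
        have h3 : m + 1 ≤ ∑ j ∈ Finset.univ.erase i, (c j).flatten.leaves := by
          calc m + 1 = ∑ _j ∈ Finset.univ.erase i, 1 := by simp
            _ ≤ _ := Finset.sum_le_sum fun i _ => hpos i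
        rw [← Finset.add_sum_erase _ _ (Finset.mem_univ i)] at ht
        omega
      refine Set.mem_insert_of_mem _ (Set.mem_biUnion (show m < n by omega) ⟨(p, c), ?_, rfl⟩)
      simpa using h2

end MTree

namespace LeftPBW

variable {k : Type u} [Field k] {P : NSOperad.{u, w} k} {X : Type*} [Fintype X] (B : LeftPBW P X)

/-- The tree of coordinate forms dual to a tree of monomials. -/
def toF : MTree X → FTree P
  | .leaf => .leaf
  | .node m p c => .node m (B.coord (m + 2) p.1) fun i => toF (c i)

lemma leaves_toF (t : MTree X) : (B.toF t).leaves = t.flatten.leaves := by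
  induction t with
  | leaf => rfl
  | node m p c ih =>
    rw [MTree.leaves_flatten_node, toF, FTree.leaves]
    exact Finset.sum_congr rfl fun i _ => ih i

lemma vertices_toF (t : MTree X) : (B.toF t).vertices = t.vertices := by
  induction t with
  | leaf => rfl
  | node m p c ih =>
    rw [MTree.vertices, toF, FTree.vertices]
    exact congrArg _ (Finset.sum_congr rfl fun i _ => ih i)

lemma pair_toF_self (t : MTree X) (ht : t.Normal B.bad) : (B.toF t).pair (B.toD t) = 1 := by
  induction t with
  | leaf => rfl
  | node m p c ih =>
    rw [toF, toD, FTree.pair_node, B.coord_self _ _ _ ht.1, one_mul]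
    exact Finset.prod_eq_one fun i _ => ih i (ht.2 i)

lemma pair_toF_of_ne (t t' : MTree X) (ht : t.Normal B.bad) (h : t ≠ t') :
    (B.toF t').pair (B.toD t) = 0 := by
  induction t' generalizing t with
  | leaf =>
    cases t with
    | leaf => exact absurd rfl h
    | node m p c => rfl
  | node m' p' c' ih =>
    cases t with
    | leaf => rfl
    | node m p c =>
      by_cases hm : m = m'
      · subst hm
        rw [toF, toD, FTree.pair_node]
        by_cases hp : p = p'
        · subst hp
          obtain ⟨i, hi⟩ : ∃ i, c i ≠ c' i := by
            by_contra! hc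
            exact h (by rw [funext hc])
          rw [Finset.prod_eq_zero (Finset.mem_univ i) (ih i (c i) (ht.2 i) hi), mul_zero]
        · rw [B.coord_of_ne _ _ _ _ ht.1 fun e => hp (Subtype.ext e), zero_mul]
      · exact FTree.pair_node_of_ne hm _ _ _ _

/-- The values of an element of the bar complex at normal trees can be prescribed. -/
lemma exists_mem_bar (g : MTree X → k) (n i : ℕ) :
    ∃ ψ ∈ P.bar n i, ∀ t : MTree X, t.Normal B.bad → t.flatten.leaves = n →
      t.vertices + i + 1 = n → ψ (B.toD t) = g t := by
  classical
  have hfin : {t : MTree X | t.flatten.leaves = n ∧ t.vertices + i + 1 = n}.Finite :=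
    (MTree.finite_leaves_le n).subset fun t ht => le_of_eq ht.1
  refine ⟨∑ t ∈ hfin.toFinset, g t • (B.toF t).pair, ?_, ?_⟩
  · refine Submodule.sum_mem _ fun t ht => Submodule.smul_mem _ _ ?_
    rw [Set.Finite.mem_toFinset] at ht
    exact FTree.pair_mem_bar _ _ _ (by rw [leaves_toF, ht.1]) (by rw [vertices_toF, ht.2])
  · intro t ht h1 h2
    rw [Finset.sum_apply, Finset.sum_eq_single t]
    · simp [B.pair_toF_self t ht]
    · intro t' _ hne
      simp [B.pair_toF_of_ne t t' ht hne.symm]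
    · intro h
      exact absurd (hfin.mem_toFinset.2 ⟨h1, h2⟩) h

end LeftPBW

end

noncomputable section

/-! ### An acyclic matching on the trees decorated by monomials -/

/-- The label of the root. -/
def BTree.root {X : Type w} : BTree X → Option X
  | leaf => none
  | node x _ _ => some x

lemma BTree.root_graft {X : Type w} (t s : BTree X) (i : ℕ) (h : 2 ≤ t.leaves) :
    (t.graft i s).root = t.root := by
  cases t with
  | leaf => simp [leaves] at h
  | node x l r =>
    simp only [graft]
    split_ifs <;> rfl

lemma BTree.exists_root {X : Type w} (t : BTree X) (h : 2 ≤ t.leaves) : ∃ a, t.root = some a := by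
  cases t with
  | leaf => simp [leaves] at h
  | node x l r => exact ⟨x, rfl⟩

lemma BTree.graft_node_leaf {X : Type w} (x : X) (l q : BTree X) :
    (node x l leaf).graft l.leaves q = node x l q := by
  simp [graft]

namespace MTree

variable {X : Type w}

/-- The label of the root of the decoration of the root. -/
def root : MTree X → Option X
  | leaf => none
  | node _ p _ => p.1.root

/-- The binary tree with one vertex. -/
def pt (x : X) : {t : BTree X // t.leaves = 0 + 2} := ⟨.node x .leaf .leaf, rfl⟩

/-- The tree `t` with a binary vertex added below its root, on the right of which is a leaf. -/
def up (x : X) (t : MTree X) : MTree X := node 0 (pt x) ![t, leaf]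

/-- The matching: in the tree on the left one edge is contracted. -/
inductive Match (bad : X → X → Prop) : MTree X → MTree X → Prop
  -- The monomial of the last input moves into the empty right slot of the root monomial. This
  -- creates no new left edge, so normality is not at stake.
  | right {m s : ℕ} (x : X) (p : BTree X) (h : (BTree.node x p .leaf).leaves = m + 2)
      (c : Fin (m + 2) → MTree X) (q : {t : BTree X // t.leaves = s + 2})
      (e : Fin (s + 2) → MTree X) : c (Fin.last (m + 1)) = node s q e →
      Match bad (node m ⟨.node x p .leaf, h⟩ c)
        (contractRoot ⟨.node x p .leaf, h⟩ c (Fin.last (m + 1)) q e)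
  -- Contraction into the left slot creates the left edge `(a, x)`, hence the condition that this
  -- pair is not bad.
  | left {s : ℕ} (x a : X) (q : {t : BTree X // t.leaves = s + 2}) (e : Fin (s + 2) → MTree X) :
      q.1.root = some a → ¬ bad a x →
      Match bad (up x (node s q e)) (contractRoot (pt x) ![node s q e, leaf] 0 q e)
  -- If a bad pair blocks the contraction at the root, the pairing is inherited from the left input.
  | up (x a : X) (t t' : MTree X) : t.root = some a → bad a x → Match bad t t' →
      Match bad (up x t) (up x t')

lemma node_inj {m m' : ℕ} {p : {t : BTree X // t.leaves = m + 2}}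
    {p' : {t : BTree X // t.leaves = m' + 2}} {c : Fin (m + 2) → MTree X}
    {c' : Fin (m' + 2) → MTree X} (h : node m p c = node m' p' c') :
    m = m' ∧ p.1 = p'.1 ∧ ∀ j hj hj', c ⟨j, hj⟩ = c' ⟨j, hj'⟩ := by
  cases h
  exact ⟨rfl, rfl, fun _ _ _ => rfl⟩

lemma node_ext {m m' : ℕ} {p : {t : BTree X // t.leaves = m + 2}}
    {p' : {t : BTree X // t.leaves = m' + 2}} {c : Fin (m + 2) → MTree X}
    {c' : Fin (m' + 2) → MTree X} (hm : m = m') (hp : p.1 = p'.1)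
    (hc : ∀ j hj hj', c ⟨j, hj⟩ = c' ⟨j, hj'⟩) : node m p c = node m' p' c' := by
  subst hm
  obtain rfl : p = p' := Subtype.ext hp
  congr 1
  exact funext fun j => hc j.1 j.2 j.2

lemma update_pair (s t u : MTree X) : Function.update ![s, u] 0 t = ![t, u] := by
  funext j
  fin_cases j <;> rfl

lemma Contr.up (x : X) {t t' : MTree X} (h : Contr t t') : Contr (up x t) (up x t') := by
  have := Contr.child (pt x) ![t, leaf] 0 t' h
  rwa [update_pair] at this

lemma Contr.root_eq {t t' : MTree X} (h : Contr t t') : t'.root = t.root := by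
  cases h with
  | root p c i q e h => exact BTree.root_graft _ _ _ (by rw [p.2]; omega)
  | child p c i t h => rfl

lemma Contr.exists_node {t t' : MTree X} (h : Contr t t') : ∃ s q e, t' = node s q e := by
  cases h with
  | root p c i q e h => exact ⟨_, _, _, rfl⟩
  | child p c i t h => exact ⟨_, _, _, rfl⟩

lemma Contr.vertices_eq {t t' : MTree X} (h : Contr t t') : t'.vertices + 1 = t.vertices := by
  induction h with
  | root p c i q e h =>
    have := DTree.sum_mergeInputs vertices c i e
    rw [h] at this
    simp only [contractRoot, vertices] at this ⊢
    omega
  | child p c i t h ih =>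
    have := DTree.sum_update vertices c i t
    simp only [vertices]
    omega

lemma exists_root {t : MTree X} {s q e} (h : t = node s q e) : ∃ a, t.root = some a := by
  subst h
  exact q.1.exists_root (by rw [q.2]; omega)

lemma leaves_flatten_up (x : X) (t : MTree X) :
    (up x t).flatten.leaves = t.flatten.leaves + 1 := by
  rw [up, leaves_flatten_node, Fin.sum_univ_two]
  rfl

lemma flatten_up (x : X) (t : MTree X) : (up x t).flatten = .node x t.flatten .leaf := rfl

lemma weight_flatten_up (x : X) (t : MTree X) :
    (up x t).flatten.weight = t.flatten.leaves + t.flatten.weight := rfl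

variable {bad : X → X → Prop}

lemma Match.contr {a b : MTree X} (h : Match bad a b) : Contr a b := by
  induction h with
  | right x p h c q e hc => exact Contr.root _ _ _ _ _ hc
  | left x a q e h hb => exact Contr.root _ _ _ _ _ rfl
  | up x a t t' h hb _ ih => exact ih.up x

lemma Match.exists_node {a b : MTree X} (h : Match bad a b) : ∃ s q e, a = node s q e := by
  cases h with
  | right x p h c q e hc => exact ⟨_, _, _, rfl⟩
  | left x a q e h hb => exact ⟨_, _, _, rfl⟩
  | up x a t t' h hb _ => exact ⟨_, _, _, rfl⟩

/-- If `t` is matched with a smaller tree, then so is `up x t`. -/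
lemma Match.exists_up {t b : MTree X} (h : Match bad t b) (x : X) :
    ∃ b', Match bad (MTree.up x t) b' := by
  obtain ⟨s, q, e, rfl⟩ := h.exists_node
  obtain ⟨a, ha⟩ := exists_root (t := node s q e) rfl
  by_cases hb : bad a x
  · exact ⟨_, Match.up x a _ _ ha hb h⟩
  · exact ⟨_, Match.left x a q e ha hb⟩

lemma normal_up (x : X) (t : MTree X) : (up x t).Normal bad ↔ t.Normal bad := by
  simp [up, pt, Normal, BTree.Normal, Fin.forall_fin_two]

lemma graft_last {m : ℕ} (x : X) (p q : BTree X) (h : (BTree.node x p .leaf).leaves = m + 2) :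
    (BTree.node x p .leaf).graft (m + 1) q = .node x p q := by
  simp only [BTree.leaves] at h
  rw [show m + 1 = p.leaves by omega]
  exact BTree.graft_node_leaf x p q

lemma forall_mergeInputs {α : Type*} {m s : ℕ} (c : Fin (m + 2) → α) (i : Fin (m + 2))
    (e : Fin (s + 2) → α) (R : α → Prop) :
    (∀ j, R (DTree.mergeInputs c i e j)) ↔ (∀ j ≠ i, R (c j)) ∧ ∀ j, R (e j) := by
  refine ⟨fun h => ⟨fun j hj => ?_, fun j => ?_⟩, fun h j => ?_⟩
  · rcases lt_or_gt_of_ne hj with hj | hj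
    · rw [← DTree.mergeInputs_apply_lt c i j hj e (by omega)]
      exact h _
    · rw [← DTree.mergeInputs_apply_gt c i j hj e (by omega)]
      exact h _
  · rw [← DTree.mergeInputs_apply_mid c i e j (by omega)]
    exact h _
  · simp only [DTree.mergeInputs]
    split_ifs with h1 h2
    · exact h.1 _ fun e => by rw [← e] at h1; exact lt_irrefl _ h1
    · exact h.2 _
    · exact h.1 _ fun e => by rw [← e] at h1 h2; dsimp only at h1 h2; omega

/-- The matching preserves normality in both directions. -/
lemma Match.normal_iff {a b : MTree X} (h : Match bad a b) : b.Normal bad ↔ a.Normal bad := by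
  induction h with
  | @right m s x p h c q e hc =>
    simp only [contractRoot, Normal, Fin.val_last, graft_last x p q.1 h, forall_mergeInputs,
      BTree.Normal]
    constructor
    · rintro ⟨⟨h1, h2, h3⟩, h4, h5⟩
      refine ⟨⟨h1, trivial, h3⟩, fun i => ?_⟩
      by_cases hi : i = Fin.last _
      · rw [hi, hc]
        exact ⟨h2, h5⟩
      · exact h4 i hi
    · rintro ⟨⟨h1, -, h3⟩, h4⟩
      have := h4 (Fin.last _)
      rw [hc] at this
      exact ⟨⟨h1, this.1, h3⟩, fun i _ => h4 i, this.2⟩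
  | left x a q e h hb =>
    rw [normal_up]
    simp only [contractRoot, pt, Normal, Fin.val_zero, BTree.graft, BTree.leaves, one_pos, if_true,
      forall_mergeInputs, BTree.Normal, true_and]
    constructor
    · rintro ⟨⟨h1, h3⟩, h4, h5⟩
      exact ⟨h1, h5⟩
    · rintro ⟨h1, h5⟩
      refine ⟨⟨h1, fun a' l₁ l₂ e => ?_⟩, fun j hj => ?_, h5⟩
      · rw [e] at h
        cases h
        exact hb
      · fin_cases j
        · exact absurd rfl hj
        · trivial
  | up x a t t' h hb _ ih => rw [normal_up, normal_up, ih]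

/-- Every tree that is not matched with a smaller one is determined by the larger tree it is
matched with. -/
lemma Match.left_unique {a b a' b' : MTree X} (h : Match bad a b) (h' : Match bad a' b')
    (hb : b = b') : a = a' := by
  induction h generalizing a' b' with
  | @right m s x p h c q e hc =>
    cases h' with
    | @right m' s' x' p' h' c' q' e' hc' =>
      obtain ⟨h1, h2, h3⟩ := node_inj hb
      simp only [Fin.val_last, graft_last x p q.1 h, graft_last x' p' q'.1 h',
        BTree.node.injEq] at h2
      obtain ⟨rfl, rfl, h2⟩ := h2
      obtain rfl : m = m' := by simp only [BTree.leaves] at h h'; omega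
      obtain rfl : s = s' := by omega
      obtain rfl : q = q' := Subtype.ext h2
      have he : e = e' := funext fun j => by
        have := h3 ((Fin.last (m + 1)).1 + j.1) (by simp only [Fin.val_last]; omega)
          (by simp only [Fin.val_last]; omega)
        rwa [DTree.mergeInputs_apply_mid, DTree.mergeInputs_apply_mid] at this
      subst he
      congr 1
      refine funext fun j => ?_
      by_cases hj : j = Fin.last _
      · rw [hj, hc, hc']
      · have := h3 j.1 (by omega) (by omega)
        rwa [DTree.mergeInputs_apply_lt _ _ _ (lt_of_le_of_ne (Fin.le_last j) hj),
          DTree.mergeInputs_apply_lt _ _ _ (lt_of_le_of_ne (Fin.le_last j) hj)] at this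
    -- The kinds of result exclude each other: a right contraction leaves a nontrivial right subtree
    -- in the root monomial, a left one leaves a leaf there, and `up` keeps a binary root.
    | left x' a' q' e' h' hb' =>
      obtain ⟨h1, h2, h3⟩ := node_inj hb
      replace h2 : BTree.node x p q.1 = .node x' q'.1 .leaf := (graft_last x p q.1 h).symm.trans h2
      rw [BTree.node.injEq] at h2
      have := q.2
      rw [h2.2.2] at this
      simp [BTree.leaves] at this
    | up x' a' t t' h' hb' ht =>
      obtain ⟨h1, -, -⟩ := node_inj hb
      omega
  | @left s x a q e h hg =>
    cases h' with
    | @right m' s' x' p' h' c' q' e' hc' =>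
      obtain ⟨h1, h2, h3⟩ := node_inj hb
      replace h2 : BTree.node x q.1 .leaf = .node x' p' q'.1 :=
        h2.trans (graft_last x' p' q'.1 h')
      rw [BTree.node.injEq] at h2
      have := q'.2
      rw [← h2.2.2] at this
      simp [BTree.leaves] at this
    | @left s' x' a' q' e' h' hb' =>
      obtain ⟨h1, h2, h3⟩ := node_inj hb
      simp only [pt, Fin.val_zero, BTree.graft, BTree.leaves, one_pos, if_true,
        BTree.node.injEq] at h2
      obtain rfl : s = s' := by omega
      obtain rfl : q = q' := Subtype.ext h2.2.1
      obtain rfl := h2.1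
      have he : e = e' := funext fun j => by
        have := h3 ((0 : Fin (0 + 2)).1 + j.1) (by simp only [Fin.val_zero]; omega)
          (by simp only [Fin.val_zero]; omega)
        rwa [DTree.mergeInputs_apply_mid, DTree.mergeInputs_apply_mid] at this
      rw [he]
    | up x' a' t t' h' hb' ht =>
      obtain ⟨h1, -, -⟩ := node_inj hb
      omega
  | up x a t t' h hbad ht ih =>
    cases h' with
    | right x' p' h' c' q' e' hc' =>
      obtain ⟨h1, -, -⟩ := node_inj hb
      omega
    | left x' a' q' e' h' hb' =>
      obtain ⟨h1, -, -⟩ := node_inj hb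
      omega
    | up x' a' t₁ t₁' h' hb' ht' =>
      obtain ⟨-, h2, h3⟩ := node_inj hb
      simp only [pt, BTree.node.injEq] at h2
      rw [h2.1, ih ht' (h3 0 two_pos two_pos)]

/-- The result of a match is not matched with a smaller tree. -/
lemma Match.not_match {a b b' c : MTree X} (h : Match bad a b) (h' : Match bad b' c)
    (hb : b = b') : False := by
  induction h generalizing b' c with
  | @right m s x p h c q e hc =>
    cases h' with
    | right x' p' h' c' q' e' hc' =>
      obtain ⟨h1, h2, h3⟩ := node_inj hb
      simp only [Fin.val_last, graft_last x p q.1 h, BTree.node.injEq] at h2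
      have := q.2
      rw [h2.2.2] at this
      simp [BTree.leaves] at this
    | left x' a' q' e' h' hb' =>
      obtain ⟨h1, -, -⟩ := node_inj hb
      omega
    | up x' a' t₁ t₁' h' hb' ht' =>
      obtain ⟨h1, -, -⟩ := node_inj hb
      omega
  | @left s x a q e h hg =>
    cases h' with
    | @right m' s' x' p' h' c' q' e' hc' =>
      obtain ⟨h1, h2, h3⟩ := node_inj hb
      -- After a left contraction the last input is still a leaf, whereas `right` needs a vertex
      -- there.
      have := h3 ((1 : Fin (0 + 2)).1 + (s + 1)) (by simp only [Fin.val_one]; omega)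
        (by simp only [Fin.val_one]; omega)
      rw [DTree.mergeInputs_apply_gt _ _ _ (by decide)] at this
      rw [show (⟨(1 : Fin (0 + 2)).1 + (s + 1), _⟩ : Fin (m' + 2)) = Fin.last (m' + 1) from
        Fin.ext (by simp only [Fin.val_one, Fin.val_last]; omega), hc'] at this
      cases this
    | left x' a' q' e' h' hb' =>
      obtain ⟨h1, -, -⟩ := node_inj hb
      omega
    | up x' a' t₁ t₁' h' hb' ht' =>
      obtain ⟨h1, -, -⟩ := node_inj hb
      omega
  | up x a t t' h hbad ht ih =>
    cases h' with
    | @right m' s' x' p' h' c' q' e' hc' =>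
      obtain ⟨h1, -, h3⟩ := node_inj hb
      obtain rfl : m' = 0 := h1.symm
      have := h3 1 (by omega) (by omega)
      have h4 : c' ⟨1, by omega⟩ = c' (Fin.last (0 + 1)) := rfl
      rw [h4, hc'] at this
      cases this
    | left x' a' q' e' h' hb' =>
      obtain ⟨-, h2, h3⟩ := node_inj hb
      have h4 : t' = node _ q' e' := h3 0 two_pos two_pos
      simp only [pt, BTree.node.injEq] at h2
      -- Contraction preserves the label of the root, so the same pair would have to be both bad and
      -- not bad.
      have h5 := ht.contr.root_eq
      rw [h4, h] at h5
      have h6 : q'.1.root = some a := h5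
      rw [h6] at h'
      cases h'
      rw [h2.1] at hbad
      exact hb' hbad
    | up x' a' t₁ t₁' h' hb' ht' =>
      obtain ⟨-, h2, h3⟩ := node_inj hb
      exact ih ht' (h3 0 two_pos two_pos)

/-- The critical trees: the left combs with binary vertices, all of whose pairs of successive
labels are bad. -/
inductive Crit (bad : X → X → Prop) : MTree X → Prop
  | leaf : Crit bad leaf
  | up (x : X) (t : MTree X) : (∀ a, t.root = some a → bad a x) → Crit bad t → Crit bad (up x t)

/-- All vertices are binary, so critical trees occur only in degree 0. -/
lemma Crit.vertices_add_one {t : MTree X} (h : Crit bad t) :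
    t.vertices + 1 = t.flatten.leaves := by
  induction h with
  | leaf => rfl
  | up x t _ _ ih =>
    rw [leaves_flatten_up, ← ih, MTree.up, vertices, Fin.sum_univ_two]
    simp only [Matrix.cons_val_zero, Matrix.cons_val_one, vertices]
    omega

/-- The root monomial `node x l r` decides. A nontrivial `r` can be split off as a last input; if
`r` is a leaf, a vertex at the last input can be contracted; if there is none, a nontrivial `l` can
be split off. What remains is `up x` of the first input, settled by the pair of root labels and
induction. -/
lemma match_or_crit (t : MTree X) (ht : t.Normal bad) :
    (∃ b, Match bad t b) ∨ (∃ a, a.Normal bad ∧ Match bad a t) ∨ Crit bad t := by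
  induction t with
  | leaf => exact Or.inr (Or.inr Crit.leaf)
  | node m p c ih =>
    obtain ⟨p, hp⟩ := p
    cases p with
    | leaf => simp [BTree.leaves] at hp
    | node x l r =>
    cases r with
    | node y r₁ r₂ =>
      right; left
      obtain ⟨s, hs⟩ : ∃ s, (BTree.node y r₁ r₂).leaves = s + 2 := by
        have := r₁.leaves_pos
        have := r₂.leaves_pos
        exact ⟨r₁.leaves + r₂.leaves - 2, by simp only [BTree.leaves]; omega⟩
      obtain ⟨m', hm'⟩ : ∃ m', l.leaves = m' + 1 := ⟨l.leaves - 1, by have := l.leaves_pos; omega⟩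
      have hm : m = m' + s + 1 := by
        simp only [BTree.leaves] at hp hs
        omega
      subst hm
      let e : Fin (s + 2) → MTree X := fun j => c ⟨m' + 1 + j.1, by omega⟩
      let c' : Fin (m' + 2) → MTree X := fun j =>
        if j.1 < m' + 1 then c ⟨j.1, by omega⟩ else node s ⟨_, hs⟩ e
      have hc' : c' (Fin.last (m' + 1)) = node s ⟨_, hs⟩ e := by simp [c']
      have hp' : (BTree.node x l .leaf).leaves = m' + 2 := by simp only [BTree.leaves]; omega
      have hM := Match.right (bad := bad) x l hp' c' ⟨_, hs⟩ e hc'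
      have heq : contractRoot ⟨BTree.node x l .leaf, hp'⟩ c' (Fin.last (m' + 1)) ⟨_, hs⟩ e =
          node (m' + s + 1) ⟨.node x l (.node y r₁ r₂), hp⟩ c := by
        refine node_ext rfl (graft_last x l _ hp') fun j hj hj' => ?_
        simp only [DTree.mergeInputs, Fin.val_last, c', e]
        split_ifs with h1 h2
        · rfl
        · congr 2
          omega
        · omega
        · omega
      rw [heq] at hM
      exact ⟨_, hM.normal_iff.1 ht, hM⟩
    | leaf =>
    cases hlast : c (Fin.last (m + 1)) with
    | node s q e => exact Or.inl ⟨_, Match.right x l hp c q e hlast⟩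
    | leaf =>
    cases l with
    | node y l₁ l₂ =>
      right; left
      obtain ⟨s, hs⟩ : ∃ s, (BTree.node y l₁ l₂).leaves = s + 2 := by
        have := l₁.leaves_pos
        have := l₂.leaves_pos
        exact ⟨l₁.leaves + l₂.leaves - 2, by simp only [BTree.leaves]; omega⟩
      have hm : m = 0 + s + 1 := by
        simp only [BTree.leaves] at hp hs
        omega
      subst hm
      let e : Fin (s + 2) → MTree X := fun j => c ⟨j.1, by omega⟩
      -- Normality of the root monomial says precisely that `(y, x)` is not bad.
      have hM := Match.left (bad := bad) x y ⟨_, hs⟩ e rfl (ht.1.2.2 y l₁ l₂ rfl)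
      have heq : contractRoot (pt x) ![node s ⟨_, hs⟩ e, leaf] 0 ⟨_, hs⟩ e =
          node (0 + s + 1) ⟨.node x (.node y l₁ l₂) .leaf, hp⟩ c := by
        refine node_ext rfl rfl fun j hj hj' => ?_
        simp only [DTree.mergeInputs, Fin.val_zero, Nat.not_lt_zero, dif_neg, not_false_eq_true, e]
        split_ifs with h2
        · rfl
        · have h3 : (⟨j, hj'⟩ : Fin (0 + s + 1 + 2)) = Fin.last (0 + s + 1 + 1) :=
            Fin.ext (by simp only [Fin.val_last]; omega)
          have h4 : (⟨j - (s + 1), by omega⟩ : Fin (0 + 2)) = 1 :=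
            Fin.ext (by simp only [Fin.val_one]; omega)
          exact (congrArg _ h4).trans ((congrArg c h3).trans hlast).symm
      rw [heq] at hM
      exact ⟨_, hM.normal_iff.1 ht, hM⟩
    | leaf =>
    obtain rfl : m = 0 := by
      simp only [BTree.leaves] at hp
      omega
    have heq : node 0 ⟨BTree.node x .leaf .leaf, hp⟩ c = up x (c 0) := by
      refine node_ext rfl rfl fun j hj hj' => ?_
      obtain rfl | rfl : j = 0 ∨ j = 1 := by omega
      · rfl
      · exact hlast
    rw [heq] at ht ⊢
    rw [normal_up] at ht
    have ih0 := ih 0 ht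
    cases h0 : c 0 with
    | leaf =>
      right; right
      exact Crit.up x _ (fun a ha => by cases ha) Crit.leaf
    | node s q e =>
    obtain ⟨a, ha⟩ := exists_root h0
    rw [h0] at ha ih0
    by_cases hb : bad a x
    · rcases ih0 with ⟨b, hM⟩ | ⟨b, hn, hM⟩ | hC
      · exact Or.inl (hM.exists_up x)
      · right; left
        exact ⟨_, (normal_up x b).2 hn, Match.up x a _ _ (by rw [← hM.contr.root_eq, ha]) hb hM⟩
      · right; right
        refine Crit.up x _ (fun a' ha' => ?_) hC
        rw [ha] at ha'
        cases ha'
        exact hb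
    · exact Or.inl ⟨_, Match.left x a q e ha hb⟩

end MTree

end

noncomputable section

/-! ### Exactness of the bar complex -/

namespace LeftPBW

variable {k : Type u} [Field k] {P : NSOperad.{u, w} k} {X : Type*} [Fintype X] (B : LeftPBW P X)

/-- Isolates the contribution of one edge at the root, the hypotheses removing all the other edges.
-/
lemma dEval_eq_contractRoot {m s : ℕ} (p : {t : BTree X // t.leaves = m + 2})
    (c : Fin (m + 2) → MTree X) (i : Fin (m + 2)) (q : {t : BTree X // t.leaves = s + 2})
    (e : Fin (s + 2) → MTree X) (hc : c i = .node s q e) (φ : DTree P → k)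
    (h₁ : ∀ j, j ≠ i → ∀ s q (e : Fin (s + 2) → MTree X), c j = .node s q e →
      φ (B.toD (.contractRoot p c j q e)) = 0)
    (h₂ : ∀ j t, MTree.Contr (c j) t → φ (B.toD (.node m p (Function.update c j t))) = 0) :
    (B.toD (.node m p c)).dEval φ =
      (-1) ^ (i.1 + (s + 2) * (m + 1 - i.1) + s * DTree.degBefore (fun j => B.toD (c j)) i) *
        φ (B.toD (.contractRoot p c i q e)) := by
  have h3 : ∀ j, (B.toD (c j)).dEval (fun t => φ (.node m (B.ev p.1 (m + 2) p.2)
      (Function.update (fun i => B.toD (c i)) j t))) = 0 := fun j =>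
    B.dEval_eq_zero_of_contr _ _ fun t ht => by
      have := h₂ j t ht
      rwa [toD, toD_update] at this
  simp only [toD, DTree.dEval, h3, mul_zero, add_zero]
  rw [Finset.sum_eq_single i]
  · rw [B.toD_contractRoot, hc]
    rfl
  · intro j _ hj
    cases hcj : c j with
    | leaf => rfl
    | node s q e =>
      simp only [toD]
      rw [← B.toD_contractRoot, h₁ j hj s q e hcj, mul_zero]
  · exact fun h => absurd (Finset.mem_univ i) h

/-- The added root has degree 0 and nothing precedes its first input, so the differential passes to
`t` without sign once the root edge contributes zero. -/
lemma dEval_up (x : X) (t : MTree X) (φ : DTree P → k)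
    (h : ∀ s q (e : Fin (s + 2) → MTree X), t = .node s q e →
      φ (B.toD (.contractRoot (MTree.pt x) ![t, .leaf] 0 q e)) = 0) :
    (B.toD (.up x t)).dEval φ = (B.toD t).dEval fun u => φ (.node 0
      (B.ev (MTree.pt x).1 (0 + 2) (MTree.pt x).2)
      (Function.update (fun j => B.toD (![t, .leaf] j)) 0 u)) := by
  simp only [MTree.up, toD, DTree.dEval]
  rw [Finset.sum_eq_single 0]
  · have h1 : DTree.degBefore (fun j => B.toD (![t, MTree.leaf] j)) (0 : Fin (0 + 2)) = 0 := by
      simp [DTree.degBefore]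
    rw [h1, add_zero, pow_zero, one_mul, Matrix.cons_val_zero]
    refine add_eq_right.2 ?_
    cases t with
    | leaf => rfl
    | node s q e =>
      have := h s q e rfl
      rw [toD_contractRoot] at this
      simp only [toD, this, mul_zero]
  · intro j _ hj
    have h3 : ![t, MTree.leaf] j = MTree.leaf := by
      fin_cases j
      · exact absurd rfl hj
      · rfl
    rw [h3]
    simp only [toD, DTree.dEval, mul_zero, add_zero]
  · exact fun h => absurd (Finset.mem_univ _) h

/-- The function `φ` vanishes on the trees with `n` leaves and weight at most `N` that are of
smaller weight, or matched with a smaller tree, or not normal. -/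
def Vanishes (φ : DTree P → k) (n N : ℕ) : Prop :=
  ∀ t : MTree X, t.flatten.leaves = n → t.flatten.weight ≤ N →
    (t.flatten.weight < N ∨ (∃ b, MTree.Match B.bad t b) ∨ ¬ t.Normal B.bad) → φ (B.toD t) = 0

variable {B} in
lemma Vanishes.eq_zero {φ : DTree P → k} {a t : MTree X}
    (h : B.Vanishes φ a.flatten.leaves a.flatten.weight) (ht : t.flatten = a.flatten)
    (hmn : (∃ b, MTree.Match B.bad t b) ∨ ¬ t.Normal B.bad) : φ (B.toD t) = 0 :=
  h t (by rw [ht]) (by rw [ht]) (Or.inr hmn)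

/-- The differential of a function with the appropriate vanishing properties, at a matched tree,
has just one nonzero summand. -/
lemma dEval_of_match {a b : MTree X} (h : MTree.Match B.bad a b) :
    ∃ ε : k, ε ≠ 0 ∧ ∀ φ : DTree P → k, B.Vanishes φ a.flatten.leaves a.flatten.weight →
      (B.toD a).dEval φ = ε * φ (B.toD b) := by
  induction h with
  | @right m s x p h c q e hc =>
    refine ⟨_, pow_ne_zero _ (neg_ne_zero.2 one_ne_zero), fun φ hφ =>
      B.dEval_eq_contractRoot _ c (Fin.last _) q e hc φ (fun j hj s' q' e' hj' => ?_)
        fun j t ht => ?_⟩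
    · have hlt : j.1 < m + 1 := by
        have := Fin.lt_last_iff_ne_last.2 hj
        exact this
      -- Contracting another root edge keeps both the leaf on the right of the root monomial and the
      -- vertex at the last input, so the result is matched with a smaller tree again.
      refine hφ.eq_zero (MTree.Contr.root _ c j q' e' hj').flatten_eq (Or.inl ?_)
      have hp : p.leaves = m + 1 := by simp only [BTree.leaves] at h; omega
      have h1 : (BTree.node x p .leaf).graft j.1 q'.1 = .node x (p.graft j.1 q'.1) .leaf := by
        rw [BTree.graft, if_pos (by omega)]
      have h2 : MTree.contractRoot ⟨BTree.node x p .leaf, h⟩ c j q' e' =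
          .node (m + s' + 1) ⟨.node x (p.graft j.1 q'.1) .leaf, by
            have := BTree.leaves_graft p q'.1 j.1 (by omega)
            have := q'.2
            simp only [BTree.leaves]
            omega⟩ (DTree.mergeInputs c j e') :=
        MTree.node_ext rfl h1 fun _ _ _ => rfl
      rw [h2]
      refine ⟨_, MTree.Match.right _ _ _ _ q e ?_⟩
      rw [← hc, ← DTree.mergeInputs_apply_gt c j (Fin.last _) (Fin.lt_last_iff_ne_last.2 hj) e'
        (by simp only [Fin.val_last]; omega)]
      congr 1
      exact Fin.ext (by simp only [Fin.val_last]; omega)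
    -- Contraction inside an input never removes the vertex at the last input.
    · refine hφ.eq_zero (MTree.Contr.child _ c j t ht).flatten_eq (Or.inl ?_)
      by_cases hj : Fin.last (m + 1) = j
      · subst hj
        obtain ⟨s', q', e', rfl⟩ := ht.exists_node
        exact ⟨_, MTree.Match.right _ _ _ _ q' e' (Function.update_self _ _ _)⟩
      · exact ⟨_, MTree.Match.right _ _ _ _ q e (by rw [Function.update_of_ne hj, hc])⟩
  | @left s x a q e h hb =>
    refine ⟨_, pow_ne_zero _ (neg_ne_zero.2 one_ne_zero), fun φ hφ =>
      B.dEval_eq_contractRoot _ ![.node s q e, .leaf] 0 q e rfl φ (fun j hj s' q' e' hj' => ?_)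
        fun j t ht => ?_⟩
    · fin_cases j
      · exact absurd rfl hj
      · cases hj'
    -- Contraction inside the left input preserves its root label `a`, so the result still admits a
    -- left match.
    · refine hφ.eq_zero (MTree.Contr.child (MTree.pt x) ![.node s q e, .leaf] j t ht).flatten_eq
        (Or.inl ?_)
      fin_cases j
      · obtain ⟨s', q', e', rfl⟩ := ht.exists_node
        have h1 := ht.root_eq
        have h2 : q'.1.root = some a := h1.trans h
        have h3 := MTree.Match.left (bad := B.bad) x a q' e' h2 hb
        refine ⟨.contractRoot (MTree.pt x) ![.node s' q' e', .leaf] 0 q' e', ?_⟩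
        have h4 := MTree.update_pair (.node s q e) (.node s' q' e') .leaf
        exact (congrArg (fun c => MTree.Match B.bad (.node 0 (MTree.pt x) c) _) h4).mpr h3
      · cases ht
  | up x a t t' h hb hM ih =>
    obtain ⟨ε, hε, ih⟩ := ih
    refine ⟨ε, hε, fun φ hφ => ?_⟩
    have key : ∀ u, B.toD (.up x u) = .node 0 (B.ev (MTree.pt x).1 (0 + 2) (MTree.pt x).2)
        (Function.update (fun j => B.toD (![t, .leaf] j)) 0 (B.toD u)) := fun u => by
      rw [← toD_update, ← toD]
      exact congrArg (fun c => B.toD (.node 0 (MTree.pt x) c)) (MTree.update_pair t u .leaf).symm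
    rw [B.dEval_up, ih, ← key]
    -- Adding the root `x` raises the weight by the number of leaves, which is the same for all
    -- trees compared here, so the vanishing is inherited.
    · intro u h1 h2 h3
      refine (congrArg φ (key u)).symm.trans (hφ _ ?_ ?_ ?_)
      · rw [MTree.leaves_flatten_up, MTree.leaves_flatten_up, h1]
      · rw [MTree.weight_flatten_up, MTree.weight_flatten_up, h1]; omega
      · rw [MTree.weight_flatten_up, MTree.weight_flatten_up, h1, MTree.normal_up]
        rcases h3 with h3 | ⟨b, h3⟩ | h3
        · left; omega
        · exact Or.inr (Or.inl (h3.exists_up x))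
        · exact Or.inr (Or.inr h3)
    · intro s q e ht
      subst ht
      -- Contracting the root edge creates the bad left edge `(a, x)`, so this tree is not normal.
      refine hφ.eq_zero (MTree.Contr.root (MTree.pt x) ![.node s q e, .leaf] 0 q e rfl).flatten_eq
        (Or.inr fun hn => ?_)
      obtain ⟨q, hq⟩ := q
      cases q with
      | leaf => cases h
      | node y l r =>
        cases h
        exact hn.1.2.2 _ _ _ rfl hb

/-- Non-normal trees need no separate hypothesis: rewriting reduces them to trees of smaller weight,
where the function already vanishes. -/
lemma vanishes_of_normal {φ : DTree P → k} (hφ : DTree.IsMultilin φ) (n N : ℕ)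
    (h₁ : ∀ t : MTree X, t.Normal B.bad → t.flatten.leaves = n → t.flatten.weight < N →
      φ (B.toD t) = 0)
    (h₂ : ∀ t b : MTree X, t.Normal B.bad → t.flatten.leaves = n → MTree.Match B.bad t b →
      φ (B.toD t) = 0) : B.Vanishes φ n N := by
  intro t hn hN h
  have h3 := B.eq_zero_of_weight_lt hφ n N h₁
  by_cases ht : t.Normal B.bad
  · rcases h with h | ⟨b, h⟩ | h
    · exact h₁ t ht hn h
    · exact h₂ t b ht hn h
    · exact absurd ht h
  · exact B.eq_zero_of_not_normal t ht hφ fun t' h4 h5 => h3 t' (by omega) (by omega)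

/-- The equation `dψ = φ` can be solved at the trees matched with a smaller tree. -/
lemma exists_dEval_eq (n i : ℕ) {φ : DTree P → k} (hφ : φ ∈ P.bar n i) :
    ∃ ψ ∈ P.bar n (i + 1), ∀ a b : MTree X, a.Normal B.bad → MTree.Match B.bad a b →
      (B.toD a).dEval ψ = φ (B.toD a) := by
  classical
  suffices H : ∀ N, ∃ ψ ∈ P.bar n (i + 1),
      (∀ a b : MTree X, a.Normal B.bad → MTree.Match B.bad a b → ψ (B.toD a) = 0) ∧
      ∀ a b : MTree X, a.Normal B.bad → MTree.Match B.bad a b → a.flatten.leaves = n →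
        a.vertices + i + 1 = n → a.flatten.weight < N → (B.toD a).dEval ψ = φ (B.toD a) by
    -- Trees with `n` leaves have weight at most `n ^ 2`.
    obtain ⟨ψ, h1, -, h2⟩ := H (n ^ 2 + 1)
    refine ⟨ψ, h1, fun a b ha hab => ?_⟩
    by_cases hn : a.flatten.leaves = n ∧ a.vertices + i + 1 = n
    · have := a.flatten.weight_le
      rw [hn.1] at this
      exact h2 a b ha hab hn.1 hn.2 (by omega)
    · rw [hφ.2 _ (by rwa [leaves_toD, vertices_toD])]
      exact (P.barD n i ⟨ψ, h1⟩).2.2 _ (by rwa [leaves_toD, vertices_toD])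
  intro N
  induction N with
  | zero => exact ⟨0, Submodule.zero_mem _, fun _ _ _ _ => rfl, fun a b _ _ _ _ h => by omega⟩
  | succ N ih =>
    obtain ⟨ψ, h1, h2, h3⟩ := ih
    choose! ε hε hε' using fun (a b : MTree X) (h : MTree.Match B.bad a b) => B.dEval_of_match h
    -- The value the correction must take at `b` to remove the remaining error at its partner of
    -- weight `N`; the partner is unique by `Match.left_unique`.
    let g : MTree X → k := fun b =>
      if h : ∃ a, a.Normal B.bad ∧ MTree.Match B.bad a b ∧ a.flatten.weight = N then
        (ε h.choose b)⁻¹ * (φ (B.toD h.choose) - (B.toD h.choose).dEval ψ) else 0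
    have hg : ∀ a b, a.Normal B.bad → MTree.Match B.bad a b → a.flatten.weight = N →
        g b = (ε a b)⁻¹ * (φ (B.toD a) - (B.toD a).dEval ψ) := by
      intro a b h4 h5 h6
      have h : ∃ a, a.Normal B.bad ∧ MTree.Match B.bad a b ∧ a.flatten.weight = N := ⟨a, h4, h5, h6⟩
      have : h.choose = a := h.choose_spec.2.1.left_unique h5 rfl
      simp only [g, dif_pos h, this]
    have hg0 : ∀ b, b.flatten.weight < N → g b = 0 := fun b hb => dif_neg (by
      rintro ⟨a, -, h5, h6⟩
      rw [← h5.contr.flatten_eq] at h6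
      omega)
    have hg1 : ∀ b b', MTree.Match B.bad b b' → g b = 0 := fun b b' hb => dif_neg (by
      rintro ⟨a, -, h5, -⟩
      exact h5.not_match hb rfl)
    obtain ⟨δ, hδ, hδ'⟩ := B.exists_mem_bar g n (i + 1)
    have hz : ∀ t, t.Normal B.bad → g t = 0 → δ (B.toD t) = 0 := by
      intro t ht hgt
      by_cases hn : t.flatten.leaves = n ∧ t.vertices + (i + 1) + 1 = n
      · rw [hδ' t ht hn.1 hn.2, hgt]
      · exact hδ.2 _ (by rwa [leaves_toD, vertices_toD])
    refine ⟨ψ + δ, Submodule.add_mem _ h1 hδ, fun a b ha hab => ?_, fun a b ha hab h4 h5 h6 => ?_⟩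
    · rw [Pi.add_apply, h2 a b ha hab, hz a ha (hg1 a b hab), add_zero]
    · rw [DTree.dEval_add]
      rcases Nat.lt_succ_iff_lt_or_eq.1 h6 with h7 | h7
      -- The correction vanishes below weight `N` and contraction preserves the weight, so the
      -- equations already solved are not disturbed.
      · rw [h3 a b ha hab h4 h5 h7, B.dEval_eq_zero_of_contr, add_zero]
        intro t ht
        refine B.eq_zero_of_weight_lt hδ.1 n N (fun t ht _ hw => hz t ht (hg0 t hw)) t ?_ ?_ <;>
          rw [ht.flatten_eq] <;> assumption
      -- At weight `N` the differential of the correction is just `ε` times its value at `b`, and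
      -- that value was chosen accordingly.
      · have hV : B.Vanishes δ a.flatten.leaves a.flatten.weight := by
          rw [h4, h7]
          exact B.vanishes_of_normal hδ.1 n N (fun t ht _ hw => hz t ht (hg0 t hw))
            fun t b ht _ hb => hz t ht (hg1 t b hb)
        have hv := hab.contr.vertices_eq
        rw [hε' a b hab δ hV, hδ' b (hab.normal_iff.2 ha) (by rw [hab.contr.flatten_eq, h4])
          (by omega), hg a b ha hab h7, mul_inv_cancel_left₀ (hε a b hab)]
        ring

/-- A cycle that vanishes on the trees matched with a smaller tree and on the critical trees
is zero. -/
lemma eq_zero_of_dEval_eq_zero {χ : DTree P → k} (hχ : DTree.IsMultilin χ)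
    (hd : ∀ t : DTree P, t.dEval χ = 0)
    (h₁ : ∀ a b : MTree X, a.Normal B.bad → MTree.Match B.bad a b → χ (B.toD a) = 0)
    (h₂ : ∀ t : MTree X, MTree.Crit B.bad t → χ (B.toD t) = 0) : χ = 0 := by
  refine B.eq_zero_of_normal hχ fun t ht => ?_
  induction hw : t.flatten.weight using Nat.strong_induction_on generalizing t with
  | _ N ih =>
    rcases MTree.match_or_crit t ht with ⟨b, hb⟩ | ⟨a, ha, hb⟩ | hc
    · exact h₁ t b ht hb
    -- By induction the cycle equation at the partner `a` has a single term left, a nonzero multiple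
    -- of the value at `t`.
    · obtain ⟨ε, hε, h⟩ := B.dEval_of_match hb
      have h3 := h χ ?_
      · rw [hd] at h3
        exact (mul_eq_zero.1 h3.symm).resolve_left hε
      · rw [← hb.contr.flatten_eq]
        exact B.vanishes_of_normal hχ _ _ (fun t ht _ h6 => ih _ (hw ▸ h6) t ht rfl)
          fun t b ht _ hb => h₁ t b ht hb
    · exact h₂ t hc

/-- Subtracting a suitable boundary makes a cycle vanish on the trees matched with smaller ones. In
positive degree there are no critical trees, so the difference is zero. -/
lemma exact_barD (B : LeftPBW P X) (n i : ℕ) : Function.Exact (P.barD n (i + 1)) (P.barD n i) := by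
  intro φ
  constructor
  · intro h
    obtain ⟨ψ, hψ, h1⟩ := B.exists_dEval_eq n (i + 1) φ.2
    refine ⟨⟨ψ, hψ⟩, ?_⟩
    have h2 := B.eq_zero_of_dEval_eq_zero (χ := (φ - P.barD n (i + 1) ⟨ψ, hψ⟩).1)
      (φ - P.barD n (i + 1) ⟨ψ, hψ⟩).2.1 ?_ ?_ ?_
    · exact (sub_eq_zero.1 (Subtype.ext h2)).symm
    · intro t
      have h3 : P.barD n i (P.barD n (i + 1) ⟨ψ, hψ⟩) = 0 :=
        Subtype.ext (funext fun t => DTree.dEval_dEval t ψ)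
      have h4 : P.barD n i (φ - P.barD n (i + 1) ⟨ψ, hψ⟩) = 0 := by rw [map_sub, h, h3, sub_zero]
      exact congrFun (congrArg Subtype.val h4) t
    · intro a b ha hab
      exact sub_eq_zero.2 (h1 a b ha hab).symm
    · intro t ht
      refine (φ - P.barD n (i + 1) ⟨ψ, hψ⟩).2.2 _ fun h => ?_
      rw [leaves_toD, vertices_toD] at h
      have := ht.vertices_add_one
      omega
  · rintro ⟨ψ, rfl⟩
    exact Subtype.ext (funext fun t => DTree.dEval_dEval t ψ.1)

/-- In degree `0` every element is equivalent to one that is determined by its values at the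
critical trees. -/
lemma exists_sub_barD (n : ℕ) (φ : P.bar n 0) : ∃ ψ, ∀ t : MTree X, t.Normal B.bad →
    ¬ MTree.Crit B.bad t → (φ - P.barD n 0 ψ).1 (B.toD t) = 0 := by
  obtain ⟨ψ, hψ, h1⟩ := B.exists_dEval_eq n 0 φ.2
  refine ⟨⟨ψ, hψ⟩, fun t ht hc => ?_⟩
  rcases MTree.match_or_crit t ht with ⟨b, hb⟩ | ⟨a, ha, hb⟩ | hc'
  · exact sub_eq_zero.2 (h1 t b ht hb).symm
  -- In degree 0 a larger partner would have more vertices than `n` leaves allow.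
  · refine (φ - P.barD n 0 ⟨ψ, hψ⟩).2.2 _ fun h => ?_
    rw [leaves_toD, vertices_toD] at h
    have h2 := hb.contr.vertices_eq
    have h3 := DTree.deg_add_vertices (B.toD a)
    rw [vertices_toD, leaves_toD, ← hb.contr.flatten_eq] at h3
    omega
  · exact absurd hc' hc

end LeftPBW

end

noncomputable section

/-! ### Sums over binary trees -/

namespace BTree

variable {X : Type w} [Finite X]

/-- The binary trees with at most `N` leaves. -/
def upTo (X : Type w) [Finite X] (N : ℕ) : Finset (BTree X) :=
  (finite_leaves_le N).toFinset

lemma mem_upTo {N : ℕ} {t : BTree X} : t ∈ upTo X N ↔ t.leaves ≤ N :=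
  (finite_leaves_le N).mem_toFinset

/-- The two subtrees may be bounded separately because `F` vanishes on trees that are too large;
this keeps the sums over them independent. -/
lemma sum_upTo [Fintype X] {A : Type*} [AddCommMonoid A] (N : ℕ) (F : BTree X → A)
    (hF : ∀ t, N < t.leaves → F t = 0) :
    ∑ t ∈ upTo X N, F t =
      F leaf + ∑ x, ∑ l ∈ upTo X N, ∑ r ∈ upTo X N, F (node x l r) := by
  have h1 : Function.Injective fun a : X × BTree X × BTree X => node a.1 a.2.1 a.2.2 := by
    rintro ⟨x, l, r⟩ ⟨x', l', r'⟩ h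
    cases h
    rfl
  have h2 : (leaf : BTree X) ∉ (Finset.univ ×ˢ upTo X N ×ˢ upTo X N).map ⟨_, h1⟩ := by simp
  have h3 : ∑ t ∈ Finset.cons leaf _ h2, F t = F leaf + ∑ x, ∑ l ∈ upTo X N, ∑ r ∈ upTo X N,
      F (node x l r) := by
    simp only [Finset.sum_cons, Finset.sum_map, Finset.sum_product, Function.Embedding.coeFn_mk]
  rw [← h3]
  refine Finset.sum_subset (fun t ht => ?_) fun t _ ht => hF t (by rwa [mem_upTo, not_le] at ht)
  cases t with
  | leaf => simp
  | node x l r =>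
    rw [mem_upTo, leaves] at ht
    simp [mem_upTo]
    omega

end BTree

namespace BinQuadData

variable {k : Type u} [Field k] {X : Type w} [Fintype X] (Q : BinQuadData k X)

/-- The ideal of relations in the direct sum of all arities of the free operad. -/
def totalIdeal : Submodule k (BTree X →₀ k) :=
  ⨆ n, (Q.ideal n).map (Finsupp.lmapDomain k k Subtype.val)

lemma mapDomain_mem_totalIdeal {n : ℕ} {p : FreeOp.Obj k X n} (hp : p ∈ Q.ideal n) :
    p.mapDomain Subtype.val ∈ Q.totalIdeal :=
  (le_iSup (fun n => (Q.ideal n).map (Finsupp.lmapDomain k k Subtype.val)) n)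
    (Submodule.mem_map_of_mem hp)

/-- The total ideal is graded by arity: projection to arity `n` fixes the ideal of that arity and
kills the other ones. -/
lemma mem_ideal_of_mapDomain_mem {n : ℕ} {p : FreeOp.Obj k X n}
    (hp : p.mapDomain Subtype.val ∈ Q.totalIdeal) : p ∈ Q.ideal n := by
  have h : Q.totalIdeal ≤ (Q.ideal n).comap
      (Finsupp.lcomapDomain (Subtype.val : {t : BTree X // t.leaves = n} → BTree X)
        Subtype.val_injective) := by
    refine iSup_le fun m => Submodule.map_le_iff_le_comap.2 fun q hq => ?_
    rw [Submodule.mem_comap, Submodule.mem_comap]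
    by_cases hm : m = n
    · subst hm
      convert hq
      ext t
      simp [Finsupp.lcomapDomain, Finsupp.mapDomain_apply Subtype.val_injective]
    · convert Submodule.zero_mem _
      ext t
      simp only [Finsupp.lcomapDomain, Finsupp.lmapDomain_apply, LinearMap.coe_mk, AddHom.coe_mk,
        Finsupp.comapDomain_apply, Finsupp.coe_zero, Pi.zero_apply]
      refine Finsupp.mapDomain_of_notMem_range _ _ ?_
      rintro ⟨s, hs⟩
      exact hm (by rw [← s.2, hs, t.2])
  have h1 := h hp
  rw [Submodule.mem_comap] at h1
  convert h1
  ext t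
  simp [Finsupp.lcomapDomain, Finsupp.mapDomain_apply Subtype.val_injective]

lemma mapDomain_node_left_mem (x : X) (r : BTree X) {f : BTree X →₀ k} (hf : f ∈ Q.totalIdeal) :
    f.mapDomain (fun l => .node x l r) ∈ Q.totalIdeal := by
  have h : Q.totalIdeal ≤ Q.totalIdeal.comap (Finsupp.lmapDomain k k fun l => .node x l r) := by
    refine iSup_le fun n => Submodule.map_le_iff_le_comap.2 fun p hp => ?_
    rw [Submodule.mem_comap, Submodule.mem_comap]
    have h1 := Q.mapDomain_mem_totalIdeal (MemIdeal.comp_right (l := n + r.leaves) 0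
      (Nat.succ_pos r.leaves) (by omega)
      (FreeOp.mono k (.node x .leaf r) (by simp only [BTree.leaves]; omega)) hp)
    convert h1 using 1
    clear h1 hp
    induction p using Finsupp.induction_linear with
    | zero => simp
    | add f g hf hg => simp only [map_add, hf, hg, Finsupp.mapDomain_add]
    | single t a =>
      refine Eq.trans ?_ (congrArg (Finsupp.mapDomain Subtype.val)
        (FreeOp.comp_single 0 (Nat.succ_pos r.leaves) (by omega) ⟨.node x .leaf r, by
          simp only [BTree.leaves]; omega⟩ t 1 a (by simp [BTree.graft, BTree.leaves, t.2])).symm)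
      simp [Finsupp.mapDomain_single, BTree.graft, BTree.leaves]
  exact h hf

lemma mapDomain_node_right_mem (x : X) (l : BTree X) {f : BTree X →₀ k} (hf : f ∈ Q.totalIdeal) :
    f.mapDomain (fun r => .node x l r) ∈ Q.totalIdeal := by
  have h : Q.totalIdeal ≤ Q.totalIdeal.comap (Finsupp.lmapDomain k k fun r => .node x l r) := by
    refine iSup_le fun n => Submodule.map_le_iff_le_comap.2 fun p hp => ?_
    rw [Submodule.mem_comap, Submodule.mem_comap]
    have h1 := Q.mapDomain_mem_totalIdeal (MemIdeal.comp_right (l := n + l.leaves) l.leaves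
      (Nat.lt_succ_self l.leaves) (by omega)
      (FreeOp.mono k (.node x l .leaf) (by simp only [BTree.leaves])) hp)
    convert h1 using 1
    clear h1 hp
    induction p using Finsupp.induction_linear with
    | zero => simp
    | add f g hf hg => simp only [map_add, hf, hg, Finsupp.mapDomain_add]
    | single t a =>
      refine Eq.trans ?_ (congrArg (Finsupp.mapDomain Subtype.val)
        (FreeOp.comp_single l.leaves (Nat.lt_succ_self l.leaves) (by omega) ⟨.node x l .leaf, by
          simp only [BTree.leaves]⟩ t 1 a (by
            simp [BTree.graft_node_leaf, BTree.leaves, t.2, add_comm])).symm)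
      simp [Finsupp.mapDomain_single, BTree.graft_node_leaf]
  exact h hf

/-- The trees are inserted at positions 2, 1, 0 in this order, so that the positions still to be
used are not renumbered. -/
lemma relator_mem_totalIdeal {u v : X × X → k} (h : (u, v) ∈ Q.rel) (A B C : BTree X) :
    ∑ ab : X × X, (u ab • Finsupp.single (BTree.node ab.2 (.node ab.1 A B) C) (1 : k) -
      v ab • Finsupp.single (BTree.node ab.1 A (.node ab.2 B C)) (1 : k)) ∈ Q.totalIdeal := by
  have h1 := MemIdeal.comp_left (l := 2 + C.leaves) 2 (by norm_num) (by omega)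
    (FreeOp.mono k C rfl) (MemIdeal.rel u v h)
  have h2 := MemIdeal.comp_left (l := 1 + B.leaves + C.leaves) 1 (by omega) (by omega)
    (FreeOp.mono k B rfl) h1
  have h3 := MemIdeal.comp_left (l := A.leaves + B.leaves + C.leaves) 0 (by omega) (by omega)
    (FreeOp.mono k A rfl) h2
  have h4 := Q.mapDomain_mem_totalIdeal h3
  convert h4 using 1
  simp only [relator, map_sum, map_sub, map_smul, LinearMap.sum_apply, LinearMap.sub_apply,
    LinearMap.smul_apply, FreeOp.mono]
  have hB := B.leaves_pos
  have hC := C.leaves_pos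
  have e1 : ∀ a b : X, FreeOp.comp (k := k) (l := A.leaves + B.leaves + C.leaves) 0 (by omega)
      (by omega) (FreeOp.comp (l := 1 + B.leaves + C.leaves) 1 (by omega) (by omega)
        (FreeOp.comp (l := 2 + C.leaves) 2 (by norm_num) (by omega)
          (Finsupp.single (⟨.node b (.node a .leaf .leaf) .leaf, rfl⟩ :
            {t : BTree X // t.leaves = 3}) (1 : k))
          (Finsupp.single (⟨C, rfl⟩ : {t : BTree X // t.leaves = C.leaves}) 1))
        (Finsupp.single (⟨B, rfl⟩ : {t : BTree X // t.leaves = B.leaves}) 1))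
      (Finsupp.single (⟨A, rfl⟩ : {t : BTree X // t.leaves = A.leaves}) 1) =
      Finsupp.single (⟨.node b (.node a A B) C, by simp only [BTree.leaves]⟩ :
        {t : BTree X // t.leaves = A.leaves + B.leaves + C.leaves}) 1 := by
    intro a b
    rw [FreeOp.comp_single _ _ _ _ _ _ _ (by simp [BTree.graft, BTree.leaves]),
      FreeOp.comp_single _ _ _ _ _ _ _ (by simp [BTree.graft, BTree.leaves]),
      FreeOp.comp_single _ _ _ _ _ _ _ (by simp [BTree.graft, BTree.leaves])]
    simp [BTree.graft, BTree.leaves]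
  have e2 : ∀ a b : X, FreeOp.comp (k := k) (l := A.leaves + B.leaves + C.leaves) 0 (by omega)
      (by omega) (FreeOp.comp (l := 1 + B.leaves + C.leaves) 1 (by omega) (by omega)
        (FreeOp.comp (l := 2 + C.leaves) 2 (by norm_num) (by omega)
          (Finsupp.single (⟨.node a .leaf (.node b .leaf .leaf), rfl⟩ :
            {t : BTree X // t.leaves = 3}) (1 : k))
          (Finsupp.single (⟨C, rfl⟩ : {t : BTree X // t.leaves = C.leaves}) 1))
        (Finsupp.single (⟨B, rfl⟩ : {t : BTree X // t.leaves = B.leaves}) 1))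
      (Finsupp.single (⟨A, rfl⟩ : {t : BTree X // t.leaves = A.leaves}) 1) =
      Finsupp.single (⟨.node a A (.node b B C), by simp only [BTree.leaves]; omega⟩ :
        {t : BTree X // t.leaves = A.leaves + B.leaves + C.leaves}) 1 := by
    intro a b
    rw [FreeOp.comp_single _ _ _ _ _ _ _ (by simp [BTree.graft, BTree.leaves]; omega),
      FreeOp.comp_single _ _ _ _ _ _ _ (by simp [BTree.graft, BTree.leaves]; omega),
      FreeOp.comp_single _ _ _ _ _ _ _ (by simp [BTree.graft, BTree.leaves]; omega)]
    simp [BTree.graft, BTree.leaves]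
  simp only [e1, e2, Finsupp.mapDomain_finsetSum, sub_eq_add_neg, Finsupp.mapDomain_add,
    ← neg_smul, Finsupp.mapDomain_smul, Finsupp.mapDomain_single]

end BinQuadData

end

noncomputable section

/-! ### The augmentation vanishes on boundaries -/

lemma sum_tail_comm {α β M : Type*} [AddCommMonoid M] (s : Finset α) (t : Finset β)
    (f : α → α → α → β → β → M) :
    ∑ A ∈ s, ∑ B ∈ s, ∑ C ∈ s, ∑ a ∈ t, ∑ b ∈ t, f A B C a b =
      ∑ a ∈ t, ∑ b ∈ t, ∑ A ∈ s, ∑ B ∈ s, ∑ C ∈ s, f A B C a b := by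
  simp only [← Finset.sum_product' t t, ← Finset.sum_product' s s]
  rw [Finset.sum_comm_cycle, Finset.sum_congr rfl fun _ _ => Finset.sum_comm]

namespace DTree

variable {k : Type u} [Field k] {P : NSOperad.{u, w} k}

/-- The tree with a binary root. -/
def bin (p : P.obj 2) (l r : DTree P) : DTree P := .node 0 p ![l, r]

lemma leaves_bin (p : P.obj 2) (l r : DTree P) : (bin p l r).leaves = l.leaves + r.leaves := by
  rw [bin, DTree.leaves]
  exact Fin.sum_univ_two _

lemma IsMultilin.bin_left {φ : DTree P → k} (hφ : IsMultilin φ) (p : P.obj 2)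
    (r : DTree P) : IsMultilin fun u => φ (bin p u r) := by
  have h := hφ.update (m := 0) p ![r, r] 0
  have e : ∀ u, Function.update ![r, r] 0 u = ![u, r] := fun u =>
    funext fun j => by fin_cases j <;> rfl
  simp only [e] at h
  exact h

lemma IsMultilin.bin_right {φ : DTree P → k} (hφ : IsMultilin φ) (p : P.obj 2)
    (l : DTree P) : IsMultilin fun u => φ (bin p l u) := by
  have h := hφ.update (m := 0) p ![l, l] 1
  have e : ∀ u, Function.update ![l, l] 1 u = ![l, u] := fun u =>
    funext fun j => by fin_cases j <;> rfl
  simp only [e] at h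
  exact h

end DTree

namespace BinQuadData

variable {k : Type u} [Field k] {X : Type w} [Fintype X] (Q : BinQuadData k X)

lemma toDTree_node (x : X) (l r : BTree X) :
    Q.toDTree (.node x l r) = DTree.bin (Q.gen x) (Q.toDTree l) (Q.toDTree r) := rfl

lemma deg_toDTree (t : BTree X) : (Q.toDTree t).deg = 0 := by
  induction t with
  | leaf => rfl
  | node x l r hl hr =>
    rw [toDTree_node, DTree.bin, DTree.deg, zero_add]
    exact (Fin.sum_univ_two _).trans (by simp [hl, hr])

lemma leaves_toDTree (t : BTree X) : (Q.toDTree t).leaves = t.leaves := by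
  induction t with
  | leaf => rfl
  | node x l r hl hr => rw [toDTree_node, DTree.leaves_bin, hl, hr, BTree.leaves]

/-- The left comb with two generators, seen as the decoration of a ternary vertex. -/
def ternL (x a : X) (A B C : DTree Q.operad) : DTree Q.operad :=
  .node 1 (Q.operad.comp (l := 3) 0 two_pos rfl (Q.gen x) (Q.gen a)) ![A, B, C]

/-- The right comb with two generators, seen as the decoration of a ternary vertex. -/
def ternR (x a : X) (A B C : DTree Q.operad) : DTree Q.operad :=
  .node 1 (Q.operad.comp (l := 3) 1 one_lt_two rfl (Q.gen x) (Q.gen a)) ![A, B, C]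

/-- The contribution to the differential of the edge to the left of the root. -/
def leftTerm (φ : DTree Q.operad → k) (x : X) : BTree X → DTree Q.operad → k
  | .leaf, _ => 0
  | .node a A B, C => φ (Q.ternL x a (Q.toDTree A) (Q.toDTree B) C)

/-- The contribution to the differential of the edge to the right of the root, up to sign. -/
def rightTerm (φ : DTree Q.operad → k) (x : X) (A : DTree Q.operad) : BTree X → k
  | .leaf => 0
  | .node b B C => φ (Q.ternR x b A (Q.toDTree B) (Q.toDTree C))

/-- All degrees are 0, so the only signs come from the root edges, with exponents 2 on the left and
1 on the right. The resulting minus sign is the one in the pairing that defines the quadratic dual.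
-/
lemma dEval_toDTree_node (φ : DTree Q.operad → k) (x : X) (l r : BTree X) :
    (Q.toDTree (.node x l r)).dEval φ =
      Q.leftTerm φ x l (Q.toDTree r) - Q.rightTerm φ x (Q.toDTree l) r +
        (Q.toDTree l).dEval (fun u => φ (DTree.bin (Q.gen x) u (Q.toDTree r))) +
        (Q.toDTree r).dEval (fun u => φ (DTree.bin (Q.gen x) (Q.toDTree l) u)) := by
  have hd : ∀ j, DTree.degBefore ![Q.toDTree l, Q.toDTree r] j = 0 := fun j =>
    Finset.sum_eq_zero fun i _ => by fin_cases i <;> exact Q.deg_toDTree _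
  have hu0 : ∀ u, (DTree.node 0 (Q.gen x) (Function.update ![Q.toDTree l, Q.toDTree r] 0 u)) =
      DTree.bin (Q.gen x) u (Q.toDTree r) := fun u =>
    congrArg _ (funext fun j => by fin_cases j <;> rfl)
  have hu1 : ∀ u, (DTree.node 0 (Q.gen x) (Function.update ![Q.toDTree l, Q.toDTree r] 1 u)) =
      DTree.bin (Q.gen x) (Q.toDTree l) u := fun u =>
    congrArg _ (funext fun j => by fin_cases j <;> rfl)
  rw [toDTree_node, DTree.bin, DTree.dEval]
  refine (Fin.sum_univ_two _).trans ?_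
  simp only [hd]
  simp only [hu0, hu1, add_zero, pow_zero, one_mul, mul_zero]
  refine Eq.trans (b := Q.leftTerm φ x l (Q.toDTree r) +
    (Q.toDTree l).dEval (fun u => φ (DTree.bin (Q.gen x) u (Q.toDTree r))) +
    (-Q.rightTerm φ x (Q.toDTree l) r +
      (Q.toDTree r).dEval (fun u => φ (DTree.bin (Q.gen x) (Q.toDTree l) u))))
    (congrArg₂ (· + ·) (congrArg₂ (· + ·) ?_ rfl) (congrArg₂ (· + ·) ?_ rfl)) (by ring)
  · cases l with
    | leaf => rfl
    | node a A B =>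
      have e : DTree.contractRoot (m := 0) (s := 0) (Q.gen x)
          ![Q.toDTree (.node a A B), Q.toDTree r] 0 (Q.gen a) ![Q.toDTree A, Q.toDTree B] =
          Q.ternL x a (Q.toDTree A) (Q.toDTree B) (Q.toDTree r) :=
        congrArg (DTree.node 1 _) (funext fun j => by fin_cases j <;> rfl)
      refine (congrArg (fun t => (-1) ^ (0 + (0 + 2) * (0 + 1 - 0)) * φ t) e).trans ?_
      norm_num [leftTerm]
  · cases r with
    | leaf => exact neg_zero.symm
    | node b B C =>
      have e : DTree.contractRoot (m := 0) (s := 0) (Q.gen x)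
          ![Q.toDTree l, Q.toDTree (.node b B C)] 1 (Q.gen b) ![Q.toDTree B, Q.toDTree C] =
          Q.ternR x b (Q.toDTree l) (Q.toDTree B) (Q.toDTree C) :=
        congrArg (DTree.node 1 _) (funext fun j => by fin_cases j <;> rfl)
      refine (congrArg (fun t => (-1) ^ (1 + (0 + 2) * (0 + 1 - 1)) * φ t) e).trans ?_
      norm_num [rightTerm]

lemma leaves_ternL (x a : X) (A B C : DTree Q.operad) :
    (Q.ternL x a A B C).leaves = A.leaves + B.leaves + C.leaves := by
  rw [ternL, DTree.leaves]
  exact Fin.sum_univ_three _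

lemma leaves_ternR (x a : X) (A B C : DTree Q.operad) :
    (Q.ternR x a A B C).leaves = A.leaves + B.leaves + C.leaves := by
  rw [ternR, DTree.leaves]
  exact Fin.sum_univ_three _

/-- A multilinear function of the decoration of a ternary vertex gives a relation of the
quadratic dual. -/
lemma tern_mem_dual {φ : DTree Q.operad → k} (hφ : DTree.IsMultilin φ) (A B C : DTree Q.operad) :
    ((fun ab => φ (Q.ternL ab.2 ab.1 A B C)), fun ab => φ (Q.ternR ab.1 ab.2 A B C)) ∈
      Q.dual.rel := by
  rintro ⟨u, v⟩ huv
  let L : Q.operad.obj 3 →ₗ[k] k := hφ.rootMap (m := 1) ![A, B, C]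
  have hz : (Submodule.Quotient.mk (relator u v) : FreeOp.Obj k X 3 ⧸ Q.ideal 3) = 0 :=
    (Submodule.Quotient.mk_eq_zero _).2 (MemIdeal.rel u v huv)
  have h1 : ∀ a b : X, φ (Q.ternL b a A B C) = L (Submodule.Quotient.mk
      (FreeOp.mono k (.node b (.node a .leaf .leaf) .leaf) rfl) : FreeOp.Obj k X 3 ⧸ Q.ideal 3) :=
    fun a b => congrArg L (Q.comp_mk_mono (l := 3) 0 two_pos rfl (.node b .leaf .leaf)
      (.node a .leaf .leaf) rfl rfl rfl)
  have h2 : ∀ a b : X, φ (Q.ternR a b A B C) = L (Submodule.Quotient.mk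
      (FreeOp.mono k (.node a .leaf (.node b .leaf .leaf)) rfl) : FreeOp.Obj k X 3 ⧸ Q.ideal 3) :=
    fun a b => congrArg L (Q.comp_mk_mono (l := 3) 1 one_lt_two rfl (.node a .leaf .leaf)
      (.node b .leaf .leaf) rfl rfl rfl)
  have h3 : (L ∘ₗ (Q.ideal 3).mkQ) (relator u v) = 0 := (congrArg L hz).trans (map_zero L)
  simp only [relator, map_sum, map_sub, map_smul, smul_eq_mul, Finset.sum_sub_distrib] at h3
  simp only [h1, h2]
  rw [← h3]
  congr 1 <;> exact Finset.sum_congr rfl fun _ _ => mul_comm _ _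

/-- For fixed subtrees `A, B, C` the two kinds of root edges combine to a dual relation, by
`tern_mem_dual`. The other terms are sums of the same form inside one subtree of the root. Since the
other subtree has at least one leaf, the bound `M` drops there. -/
lemma sum_dEval_mem_totalIdeal (N M : ℕ) (hMN : M ≤ N) {φ : DTree Q.operad → k}
    (hφ : DTree.IsMultilin φ) (hM : ∀ t, M < t.leaves → φ t = 0) :
    ∑ t ∈ BTree.upTo X N, (Q.toDTree t).dEval φ • Finsupp.single t (1 : k) ∈
      Q.dual.totalIdeal := by
  induction M generalizing φ with
  | zero =>
    refine Submodule.sum_mem _ fun t _ => ?_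
    rw [DTree.dEval_eq_zero _ _ fun t' h _ => hM t' ?_, zero_smul]
    · exact Submodule.zero_mem _
    · rw [h, leaves_toDTree]
      exact t.leaves_pos
  | succ M ih =>
    rw [BTree.sum_upTo]
    swap
    · intro t ht
      rw [DTree.dEval_eq_zero _ _ fun t' h _ => hM t' ?_, zero_smul]
      rw [h, leaves_toDTree]
      omega
    have h0 : (Q.toDTree .leaf).dEval φ = 0 := rfl
    rw [h0, zero_smul, zero_add]
    simp only [dEval_toDTree_node, add_smul, Finset.sum_add_distrib]
    refine Submodule.add_mem _ (Submodule.add_mem _ ?_ ?_) ?_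
    · simp only [sub_smul, Finset.sum_sub_distrib]
      have hL : ∀ x, ∀ C : BTree X, ∑ l ∈ BTree.upTo X N, Q.leftTerm φ x l (Q.toDTree C) •
          Finsupp.single (BTree.node x l C) (1 : k) = ∑ a, ∑ A ∈ BTree.upTo X N,
          ∑ B ∈ BTree.upTo X N, φ (Q.ternL x a (Q.toDTree A) (Q.toDTree B) (Q.toDTree C)) •
          Finsupp.single (BTree.node x (.node a A B) C) (1 : k) := by
        intro x C
        rw [BTree.sum_upTo]
        · simp [leftTerm]
        · intro t ht
          cases t with
          | leaf => simp [leftTerm]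
          | node a A B =>
            rw [leftTerm, hM, zero_smul]
            rw [leaves_ternL, leaves_toDTree, leaves_toDTree]
            simp only [BTree.leaves] at ht
            omega
      have hR : ∀ x, ∀ A : BTree X, ∑ r ∈ BTree.upTo X N, Q.rightTerm φ x (Q.toDTree A) r •
          Finsupp.single (BTree.node x A r) (1 : k) = ∑ b, ∑ B ∈ BTree.upTo X N,
          ∑ C ∈ BTree.upTo X N, φ (Q.ternR x b (Q.toDTree A) (Q.toDTree B) (Q.toDTree C)) •
          Finsupp.single (BTree.node x A (.node b B C)) (1 : k) := by
        intro x A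
        rw [BTree.sum_upTo]
        · simp [rightTerm]
        · intro t ht
          cases t with
          | leaf => simp [rightTerm]
          | node b B C =>
            rw [rightTerm, hM, zero_smul]
            simp only [leaves_ternR, leaves_toDTree]
            simp only [BTree.leaves] at ht
            omega
      have hS : ∑ A ∈ BTree.upTo X N, ∑ B ∈ BTree.upTo X N, ∑ C ∈ BTree.upTo X N,
          ∑ ab : X × X, (φ (Q.ternL ab.2 ab.1 (Q.toDTree A) (Q.toDTree B) (Q.toDTree C)) •
            Finsupp.single (BTree.node ab.2 (.node ab.1 A B) C) (1 : k) -
            φ (Q.ternR ab.1 ab.2 (Q.toDTree A) (Q.toDTree B) (Q.toDTree C)) •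
            Finsupp.single (BTree.node ab.1 A (.node ab.2 B C)) (1 : k)) ∈ Q.dual.totalIdeal :=
        Submodule.sum_mem _ fun A _ => Submodule.sum_mem _ fun B _ => Submodule.sum_mem _ fun C _ =>
          Q.dual.relator_mem_totalIdeal (Q.tern_mem_dual hφ _ _ _) A B C
      convert hS using 1
      simp only [Finset.sum_sub_distrib]
      congr 1
      · rw [Finset.sum_congr rfl fun x _ => Finset.sum_comm]
        simp only [hL, Fintype.sum_prod_type]
        refine Eq.trans ?_ (sum_tail_comm (BTree.upTo X N) (Finset.univ : Finset X) _).symm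
        refine Eq.trans ?_ Finset.sum_comm
        refine Finset.sum_congr rfl fun x _ => ?_
        rw [Finset.sum_comm]
        refine Finset.sum_congr rfl fun a _ => ?_
        exact Finset.sum_comm_cycle.symm
      · simp only [hR, Fintype.sum_prod_type]
        refine Eq.trans ?_ (sum_tail_comm (BTree.upTo X N) (Finset.univ : Finset X) _).symm
        refine Finset.sum_congr rfl fun x _ => Finset.sum_comm
    · refine Submodule.sum_mem _ fun x _ => ?_
      rw [Finset.sum_comm]
      refine Submodule.sum_mem _ fun r _ => ?_
      have h1 := Q.dual.mapDomain_node_left_mem x r (ih (by omega)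
        (hφ.bin_left (Q.gen x) (Q.toDTree r)) fun t ht => hM _ ?_)
      · simpa only [Finsupp.mapDomain_finsetSum, Finsupp.mapDomain_smul, Finsupp.mapDomain_single]
          using h1
      · rw [DTree.leaves_bin, leaves_toDTree]
        have := r.leaves_pos
        omega
    · refine Submodule.sum_mem _ fun x _ => Submodule.sum_mem _ fun l _ => ?_
      have h1 := Q.dual.mapDomain_node_right_mem x l (ih (by omega)
        (hφ.bin_right (Q.gen x) (Q.toDTree l)) fun t ht => hM _ ?_)
      · simpa only [Finsupp.mapDomain_finsetSum, Finsupp.mapDomain_smul, Finsupp.mapDomain_single]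
          using h1
      · rw [DTree.leaves_bin, leaves_toDTree]
        have := l.leaves_pos
        omega

lemma mapDomain_eq_sum_upTo (n : ℕ) (g : BTree X → k) (hg : ∀ t, t.leaves ≠ n → g t = 0) :
    ((Finsupp.linearEquivFunOnFinite k k {t : BTree X // t.leaves = n}).symm
      fun t => g t.1).mapDomain Subtype.val =
      ∑ t ∈ BTree.upTo X n, g t • Finsupp.single t (1 : k) := by
  classical
  ext s
  rw [Finset.sum_apply', Finset.sum_eq_single s (fun t _ ht => by simp [ht])]
  · by_cases hs : s.leaves = n
    · exact (Finsupp.mapDomain_apply Subtype.val_injective _ ⟨s, hs⟩).trans (by simp)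
    · rw [hg s hs, Finsupp.mapDomain_of_notMem_range]
      · simp
      · rintro ⟨t, rfl⟩
        exact hs t.2
  · intro h
    rw [BTree.mem_upTo] at h
    rw [hg s (by omega)]
    simp

lemma apply_toDTree_eq_zero {n i : ℕ} (φ : Q.operad.bar n i) (t : BTree X) (ht : t.leaves ≠ n) :
    φ.1 (Q.toDTree t) = 0 :=
  φ.2.2 _ fun h => ht (by rw [← h.1, leaves_toDTree])

lemma barAug_barD (n : ℕ) (ψ : Q.operad.bar n (0 + 1)) :
    Q.barAug n (Q.operad.barD n 0 ψ) = 0 := by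
  refine (Submodule.Quotient.mk_eq_zero _).2 (Q.dual.mem_ideal_of_mapDomain_mem ?_)
  have h := Q.sum_dEval_mem_totalIdeal n n le_rfl ψ.2.1 fun t ht => ψ.2.2 t fun h => by omega
  have h1 := mapDomain_eq_sum_upTo n (fun t => (Q.operad.barD n 0 ψ).1 (Q.toDTree t))
    (Q.apply_toDTree_eq_zero _)
  exact h1 ▸ h

/-! ### Surjectivity of the augmentation -/

/-- The tree of linear forms attached to a binary tree, given a linear form for every generator. -/
def toFTree (ξ : X → Q.operad.obj 2 →ₗ[k] k) : BTree X → FTree Q.operad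
  | .leaf => .leaf
  | .node x l r => .node 0 (ξ x) ![toFTree ξ l, toFTree ξ r]

variable {Q} {ξ : X → Q.operad.obj 2 →ₗ[k] k}

lemma leaves_toFTree (t : BTree X) : (Q.toFTree ξ t).leaves = t.leaves := by
  induction t with
  | leaf => rfl
  | node x l r hl hr =>
    rw [toFTree, FTree.leaves, BTree.leaves, ← hl, ← hr]
    exact Fin.sum_univ_two _

lemma vertices_toFTree (t : BTree X) : (Q.toFTree ξ t).vertices + 1 = t.leaves := by
  induction t with
  | leaf => rfl
  | node x l r hl hr =>
    rw [toFTree, FTree.vertices, BTree.leaves, ← hl, ← hr]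
    have : ∑ i : Fin (0 + 2), (![Q.toFTree ξ l, Q.toFTree ξ r] i).vertices =
      (Q.toFTree ξ l).vertices + (Q.toFTree ξ r).vertices := Fin.sum_univ_two _
    omega

lemma pair_toFTree [DecidableEq X] [DecidableEq (BTree X)] (hξ : ∀ x x', ξ x (Q.gen x') = if x = x' then 1 else 0)
    (t t' : BTree X) :
    (Q.toFTree ξ t).pair (Q.toDTree t') = if t = t' then 1 else 0 := by
  induction t generalizing t' with
  | leaf =>
    cases t' with
    | leaf => rw [if_pos rfl]; rfl
    | node x l r => rw [if_neg nofun]; rfl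
  | node x l r hl hr =>
    cases t' with
    | leaf => rw [if_neg nofun]; rfl
    | node x' l' r' =>
      rw [toFTree, toDTree_node, DTree.bin, FTree.pair_node, hξ]
      have : ∏ i : Fin (0 + 2), (![Q.toFTree ξ l, Q.toFTree ξ r] i).pair
          (![Q.toDTree l', Q.toDTree r'] i) =
          (Q.toFTree ξ l).pair (Q.toDTree l') * (Q.toFTree ξ r).pair (Q.toDTree r') :=
        Fin.prod_univ_two _
      rw [this, hl, hr]
      simp only [BTree.node.injEq]
      split_ifs <;> simp_all

/-- Trees of the forms `ξ` are dual to the monomial trees, so already the free operad on the dual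
generators is attained before passing to the quotient. -/
lemma barAug_surjective [DecidableEq X]
    (hξ : ∀ x x', ξ x (Q.gen x') = if x = x' then 1 else 0) (n : ℕ) :
    Function.Surjective (Q.barAug n) := by
  classical
  intro p
  obtain ⟨p, rfl⟩ := Submodule.Quotient.mk_surjective _ p
  have := Fintype.ofFinite {t : BTree X // t.leaves = n}
  refine ⟨⟨∑ t : {t : BTree X // t.leaves = n}, p t • (Q.toFTree ξ t.1).pair,
    Submodule.sum_mem _ fun t _ => Submodule.smul_mem _ _ (FTree.pair_mem_bar _ _ _
      (by rw [leaves_toFTree, t.2]) (by rw [add_zero, vertices_toFTree, t.2]))⟩, ?_⟩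
  refine congrArg Submodule.Quotient.mk ?_
  ext s
  simp [Finset.sum_apply, pair_toFTree hξ, Subtype.val_inj]

end BinQuadData

end

noncomputable section

/-! ### Change of generators -/

section BaseChange

variable {k : Type u} [Field k] {P : NSOperad.{u, w} k}

/-- The decorated tree defined by a binary tree labelled by binary operations. -/
def DTree.ofBTree {X : Type*} (ω : X → P.obj 2) : BTree X → DTree P
  | .leaf => .leaf
  | .node x l r => .bin (ω x) (ofBTree ω l) (ofBTree ω r)

lemma DTree.leaves_ofBTree {X : Type*} (ω : X → P.obj 2) (t : BTree X) :
    (DTree.ofBTree ω t).leaves = t.leaves := by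
  induction t with
  | leaf => rfl
  | node x l r hl hr => rw [ofBTree, leaves_bin, hl, hr, BTree.leaves]

lemma BinQuadData.toDTree_eq {X : Type*} [Fintype X] (Q : BinQuadData k X) (t : BTree X) :
    Q.toDTree t = DTree.ofBTree Q.gen t := by
  induction t with
  | leaf => rfl
  | node x l r hl hr => rw [toDTree_node, DTree.ofBTree, hl, hr]

/-- A multilinear function, as a linear function of the decoration of a binary root. -/
def DTree.IsMultilin.binMap {φ : DTree P → k} (hφ : IsMultilin φ) (l r : DTree P) :
    P.obj 2 →ₗ[k] k := hφ.rootMap (m := 0) ![l, r]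

lemma DTree.IsMultilin.binMap_apply {φ : DTree P → k} (hφ : IsMultilin φ) (l r : DTree P)
    (p : P.obj 2) : hφ.binMap l r p = φ (.bin p l r) := rfl

/-- The element `∑ φ(t) t` does not depend on the basis of binary operations: the arguments `ω` of
`φ` and the operations `o` transform contragrediently. One vertex is changed at a time, with an
induction on the size of the trees at which `φ` may be nonzero. -/
lemma sum_algEval_eq {X Y : Type*} [Fintype X] [Fintype Y] {ω : X → P.obj 2} {ω' : Y → P.obj 2}
    {τ : X → Y → k} (hω : ∀ x, ω x = ∑ y, τ x y • ω' y) {F : Type*} [AddCommGroup F] [Module k F]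
    {o : X → F →ₗ[k] F →ₗ[k] F} {o' : Y → F →ₗ[k] F →ₗ[k] F} (ho : ∀ y, o' y = ∑ x, τ x y • o x)
    (a : F) (N M : ℕ) (hMN : M ≤ N) {φ : DTree P → k} (hφ : DTree.IsMultilin φ)
    (hM : ∀ t, M < t.leaves → φ t = 0) :
    ∑ t ∈ BTree.upTo X N, φ (.ofBTree ω t) • algEval o (fun _ => a) t =
      ∑ t ∈ BTree.upTo Y N, φ (.ofBTree ω' t) • algEval o' (fun _ => a) t := by
  induction M generalizing φ with
  | zero =>
    rw [Finset.sum_eq_zero, Finset.sum_eq_zero]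
    · intro t _
      rw [hM _ (by rw [DTree.leaves_ofBTree]; exact t.leaves_pos), zero_smul]
    · intro t _
      rw [hM _ (by rw [DTree.leaves_ofBTree]; exact t.leaves_pos), zero_smul]
  | succ M ih =>
    have ih1 : ∀ (p : P.obj 2) (r : DTree P), 0 < r.leaves →
        ∑ l ∈ BTree.upTo X N, φ (.bin p (.ofBTree ω l) r) • algEval o (fun _ => a) l =
        ∑ l ∈ BTree.upTo Y N, φ (.bin p (.ofBTree ω' l) r) • algEval o' (fun _ => a) l :=
      fun p r hr => ih (by omega) (hφ.bin_left p r) fun t ht => hM _ (by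
        rw [DTree.leaves_bin]; omega)
    have ih2 : ∀ (p : P.obj 2) (l : DTree P), 0 < l.leaves →
        ∑ r ∈ BTree.upTo X N, φ (.bin p l (.ofBTree ω r)) • algEval o (fun _ => a) r =
        ∑ r ∈ BTree.upTo Y N, φ (.bin p l (.ofBTree ω' r)) • algEval o' (fun _ => a) r :=
      fun p r hr => ih (by omega) (hφ.bin_right p r) fun t ht => hM _ (by
        rw [DTree.leaves_bin]; omega)
    have h1 : ∀ x, ∑ l ∈ BTree.upTo X N, ∑ r ∈ BTree.upTo X N,
        φ (.bin (ω x) (.ofBTree ω l) (.ofBTree ω r)) •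
          o x (algEval o (fun _ => a) l) (algEval o (fun _ => a) r) =
        ∑ l ∈ BTree.upTo Y N, ∑ r ∈ BTree.upTo Y N,
        φ (.bin (ω x) (.ofBTree ω' l) (.ofBTree ω' r)) •
          o x (algEval o' (fun _ => a) l) (algEval o' (fun _ => a) r) := by
      intro x
      rw [Finset.sum_comm]
      have e1 : ∀ r, ∑ l ∈ BTree.upTo X N, φ (.bin (ω x) (.ofBTree ω l) (.ofBTree ω r)) •
          o x (algEval o (fun _ => a) l) (algEval o (fun _ => a) r) =
          ∑ l ∈ BTree.upTo Y N, φ (.bin (ω x) (.ofBTree ω' l) (.ofBTree ω r)) •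
          o x (algEval o' (fun _ => a) l) (algEval o (fun _ => a) r) := by
        intro r
        have := congrArg (fun v => o x v (algEval o (fun _ => a) r)) (ih1 (ω x) (.ofBTree ω r)
          (by rw [DTree.leaves_ofBTree]; exact r.leaves_pos))
        simpa only [map_sum, map_smul, LinearMap.sum_apply, LinearMap.smul_apply] using this
      rw [Finset.sum_congr rfl fun r _ => e1 r, Finset.sum_comm]
      refine Finset.sum_congr rfl fun l _ => ?_
      have := congrArg (o x (algEval o' (fun _ => a) l)) (ih2 (ω x) (.ofBTree ω' l)
          (by rw [DTree.leaves_ofBTree]; exact l.leaves_pos))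
      simpa only [map_sum, map_smul] using this
    rw [BTree.sum_upTo, BTree.sum_upTo]
    · simp only [DTree.ofBTree, algEval, h1]
      congr 1
      have h2 : ∀ x l r, φ (.bin (ω x) l r) = ∑ y, τ x y * φ (.bin (ω' y) l r) := by
        intro x l r
        rw [← hφ.binMap_apply, hω, map_sum]
        refine Finset.sum_congr rfl fun y _ => ?_
        rw [map_smul, smul_eq_mul, hφ.binMap_apply]
      simp only [h2, ho, Finset.sum_smul, LinearMap.sum_apply, LinearMap.smul_apply,
        Finset.smul_sum, smul_smul]
      rw [Finset.sum_congr rfl fun x _ => (Finset.sum_congr rfl fun l _ =>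
        Finset.sum_comm).trans Finset.sum_comm, Finset.sum_comm]
      refine Finset.sum_congr rfl fun y _ => ?_
      rw [Finset.sum_comm]
      refine Finset.sum_congr rfl fun l _ => ?_
      rw [Finset.sum_comm]
      refine Finset.sum_congr rfl fun r _ => Finset.sum_congr rfl fun x _ => ?_
      rw [mul_comm]
    · intro t ht
      rw [hM _ (by rw [DTree.leaves_ofBTree]; omega), zero_smul]
    · intro t ht
      rw [hM _ (by rw [DTree.leaves_ofBTree]; omega), zero_smul]

end BaseChange

/-- A binary tree, seen as a tree with binary vertices decorated by monomials. -/
def MTree.ofBTree {X : Type w} : BTree X → MTree X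
  | .leaf => .leaf
  | .node x l r => .node 0 (pt x) ![ofBTree l, ofBTree r]

lemma MTree.flatten_ofBTree {X : Type w} (t : BTree X) : (ofBTree t).flatten = t := by
  induction t with
  | leaf => rfl
  | node x l r hl hr =>
    refine Eq.trans ?_ (congrArg₂ (BTree.node x) hl hr)
    rfl

lemma MTree.normal_ofBTree {X : Type w} (bad : X → X → Prop) (t : BTree X) :
    (ofBTree t).Normal bad := by
  induction t with
  | leaf => trivial
  | node x l r hl hr =>
    refine ⟨⟨trivial, trivial, fun _ _ _ h => by cases h⟩, fun i => ?_⟩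
    fin_cases i
    · exact hl
    · exact hr

lemma MTree.Crit.ofBTree_flatten {X : Type w} {bad : X → X → Prop} {t : MTree X}
    (h : Crit bad t) : ofBTree t.flatten = t := by
  induction h with
  | leaf => rfl
  | up x t _ _ ih =>
    rw [flatten_up, ofBTree, ih]
    rfl

lemma LeftPBW.toD_ofBTree {k : Type u} [Field k] {P : NSOperad.{u, w} k} {X : Type*} [Fintype X]
    (B : LeftPBW P X) (t : BTree X) : B.toD (.ofBTree t) = .ofBTree B.gen t := by
  induction t with
  | leaf => rfl
  | node x l r hl hr =>
    rw [MTree.ofBTree, toD, DTree.ofBTree, DTree.bin, ← hl, ← hr]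
    congr 1
    · exact P.eval_corolla _ _ _
    · funext j
      fin_cases j <;> rfl

end

noncomputable section

/-! ### The quadratic dual of the operad of quadri-algebras -/

section Marks

/-- The position of the marked leaf of a product, where `l` is the number of leaves of the left
factor and `p, q` are the positions of the marked leaves of the factors. -/
def dendMark : DendOp → ℕ → ℕ → ℕ → ℕ
  | .prec, _, p, _ => p
  | .succ, l, _, q => l + q

/-- The factor of `(x a y) b z` in which the mark lies. -/
def dendLeft : DendOp → DendOp → Fin 3
  | _, .succ => 2
  | .prec, .prec => 0
  | .succ, .prec => 1

/-- The factor of `x a (y b z)` in which the mark lies. -/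
def dendRight : DendOp → DendOp → Fin 3
  | .prec, _ => 0
  | .succ, .prec => 1
  | .succ, .succ => 2

lemma dendMark_left (a b : DendOp) (l l' p p' p'' : ℕ) :
    dendMark b (l + l') (dendMark a l p p') p'' = ![p, l + p', l + l' + p''] (dendLeft a b) := by
  cases a <;> cases b <;> rfl

lemma dendMark_right (a b : DendOp) (l l' p p' p'' : ℕ) :
    dendMark a l p (dendMark b l' p' p'') = ![p, l + p', l + l' + p''] (dendRight a b) := by
  cases a <;> cases b <;> simp [dendMark, dendRight, add_assoc]

variable (k : Type u) [Field k]

/-- Each dendriform relation collects exactly the products in which a marked leaf lies in one given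
factor. This is why marked rows of leaves form an algebra over the dual. -/
lemma dend_rel_indicator (c : Fin 3) :
    ((fun ab : DendOp × DendOp => if dendLeft ab.1 ab.2 = c then (1 : k) else 0),
      fun ab : DendOp × DendOp => if dendRight ab.1 ab.2 = c then (1 : k) else 0) ∈
      (dend k).rel := by
  simp only [dend, Submodule.mem_span_triple]
  fin_cases c
  · refine ⟨1, 0, 0, Prod.ext (funext fun xy => ?_) (funext fun xy => ?_)⟩ <;>
      rcases xy with ⟨_ | _, _ | _⟩ <;> simp [opPair, dendLeft, dendRight]
  · refine ⟨0, 1, 0, Prod.ext (funext fun xy => ?_) (funext fun xy => ?_)⟩ <;>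
      rcases xy with ⟨_ | _, _ | _⟩ <;> simp [opPair, dendLeft, dendRight]
  · refine ⟨0, 0, 1, Prod.ext (funext fun xy => ?_) (funext fun xy => ?_)⟩ <;>
      rcases xy with ⟨_ | _, _ | _⟩ <;> simp [opPair, dendLeft, dendRight]

variable {k}

/-- Orthogonality to products of two indicator relations says that the total coefficients agree for
each pair of factors containing the two marks. -/
lemma sum_smul_eq_of_mem_dual {u v : (DendOp × DendOp) × (DendOp × DendOp) → k}
    (h : (u, v) ∈ (quad k).dual.rel) {M : Type*} [AddCommGroup M] [Module k M]
    (W : Fin 3 → Fin 3 → M) :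
    ∑ ab, u ab • W (dendLeft ab.1.1 ab.2.1) (dendLeft ab.1.2 ab.2.2) =
      ∑ ab, v ab • W (dendRight ab.1.1 ab.2.1) (dendRight ab.1.2 ab.2.2) := by
  have hW : ∀ i j, W i j = ∑ c, ∑ d, ((if i = c then (1 : k) else 0) *
      if j = d then (1 : k) else 0) • W c d := by
    intro i j
    simp [ite_smul]
  have hr : ∀ c d, ∑ ab : (DendOp × DendOp) × (DendOp × DendOp), u ab *
      ((if dendLeft ab.1.1 ab.2.1 = c then (1 : k) else 0) *
        if dendLeft ab.1.2 ab.2.2 = d then (1 : k) else 0) = ∑ ab, v ab *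
      ((if dendRight ab.1.1 ab.2.1 = c then (1 : k) else 0) *
        if dendRight ab.1.2 ab.2.2 = d then (1 : k) else 0) := fun c d =>
    sub_eq_zero.1 (h _ (Submodule.subset_span
      ⟨_, dend_rel_indicator k c, _, dend_rel_indicator k d, rfl⟩))
  have hs : ∀ (w : (DendOp × DendOp) × (DendOp × DendOp) → k) (g : DendOp → DendOp → Fin 3),
      ∑ ab, w ab • W (g ab.1.1 ab.2.1) (g ab.1.2 ab.2.2) = ∑ c, ∑ d, (∑ ab, w ab *
        ((if g ab.1.1 ab.2.1 = c then (1 : k) else 0) *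
          if g ab.1.2 ab.2.2 = d then (1 : k) else 0)) • W c d := by
    intro w g
    simp only [Finset.sum_smul]
    refine Eq.trans (Finset.sum_congr rfl fun ab _ => ?_) Finset.sum_comm_cycle.symm
    rw [hW]
    simp only [Finset.smul_sum, smul_smul]
  rw [hs, hs]
  simp only [hr]

variable (k)

/-- The operations on the space with basis the triples `(l, p, q)`, which stand for `l` leaves,
of which those in the positions `p` and `q` are marked. -/
def markMul (x : DendOp × DendOp) :
    (ℕ × ℕ × ℕ →₀ k) →ₗ[k] (ℕ × ℕ × ℕ →₀ k) →ₗ[k] (ℕ × ℕ × ℕ →₀ k) :=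
  Finsupp.linearCombination k fun s => Finsupp.linearCombination k fun t =>
    Finsupp.single (s.1 + t.1, dendMark x.1 s.1 s.2.1 t.2.1, dendMark x.2 s.1 s.2.2 t.2.2) 1

lemma markMul_single (x : DendOp × DendOp) (s t : ℕ × ℕ × ℕ) (a b : k) :
    markMul k x (Finsupp.single s a) (Finsupp.single t b) =
      (a * b) • Finsupp.single
        (s.1 + t.1, dendMark x.1 s.1 s.2.1 t.2.1, dendMark x.2 s.1 s.2.2 t.2.2) 1 := by
  simp [markMul, Finsupp.linearCombination_single]

lemma satisfiesRel_markMul : SatisfiesRel (markMul k) (quad k).dual := by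
  intro u v huv x y z
  induction x using Finsupp.induction_linear with
  | zero => simp
  | add f g hf hg =>
    simp only [map_add, LinearMap.add_apply, smul_add, Finset.sum_add_distrib, hf, hg]
  | single s a =>
    induction y using Finsupp.induction_linear with
    | zero => simp
    | add f g hf hg =>
      simp only [map_add, LinearMap.add_apply, smul_add, Finset.sum_add_distrib, hf, hg]
    | single t b =>
      induction z using Finsupp.induction_linear with
      | zero => simp
      | add f g hf hg =>
        simp only [map_add, smul_add, Finset.sum_add_distrib, hf, hg]
      | single r c =>
        simp only [markMul_single, map_smul, LinearMap.smul_apply, dendMark_left, dendMark_right,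
          one_mul, mul_one, smul_smul]
        have := sum_smul_eq_of_mem_dual huv fun i j => (a * b * c) • Finsupp.single
          (s.1 + t.1 + r.1, ![s.2.1, s.1 + t.2.1, s.1 + t.1 + r.2.1] i,
            ![s.2.2, s.1 + t.2.2, s.1 + t.1 + r.2.2] j) (1 : k)
        simp only [smul_smul] at this
        refine Eq.trans ?_ (this.trans ?_)
        · exact Finset.sum_congr rfl fun ab _ => by congr 1
        · refine Finset.sum_congr rfl fun ab _ => ?_
          rw [add_assoc]
          congr 1
          ring

/-- The operations dual to the new basis of the operad of quadri-algebras. -/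
def newMarkMul (y : DendOp × DendOp) :
    (ℕ × ℕ × ℕ →₀ k) →ₗ[k] (ℕ × ℕ × ℕ →₀ k) →ₗ[k] (ℕ × ℕ × ℕ →₀ k) :=
  ∑ x, quadToNew k x y • markMul k x

/-- The indicator function of `p ≤ i`. -/
def leInd (i p : ℕ) : k := if p ≤ i then 1 else 0

/-- The linear form that detects the triples `(l, p, q)` with `p ≤ i` and `q ≤ j`. -/
def markForm (i j : ℕ) : (ℕ × ℕ × ℕ →₀ k) →ₗ[k] k :=
  Finsupp.linearCombination k fun s => leInd k i s.2.1 * leInd k j s.2.2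

/-- The span of the triples with `l` leaves. -/
def markSpan (l : ℕ) : Submodule k (ℕ × ℕ × ℕ →₀ k) :=
  Submodule.span k {v | ∃ p q, p < l ∧ q < l ∧ v = Finsupp.single (l, p, q) 1}

/-- Dually to `≺, *` the operations are the difference of the two mark operations and the second of
them. The second one tests the position `l` of the new leaf; the difference vanishes when both
positions are at most `i`, and otherwise tests `p`. -/
lemma sum_dendToNew_mul_leInd (y : DendOp) (i l p : ℕ) (hp : p < l) :
    ∑ x, (dendToNew x y : k) * leInd k i (dendMark x l p 0) =
      (if y = .succ ↔ l ≤ i then 1 else 0) * leInd k i p := by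
  rw [DendOp.sum_eq]
  by_cases h : l ≤ i
  · have h' : p ≤ i := by omega
    cases y <;> simp [dendToNew, dendMark, leInd, h, h']
  · by_cases h' : p ≤ i <;> cases y <;> simp [dendToNew, dendMark, leInd, h, h']

lemma newMarkMul_single_mem (y : DendOp × DendOp) (l : ℕ) {v : ℕ × ℕ × ℕ →₀ k}
    (hv : v ∈ markSpan k l) :
    newMarkMul k y v (Finsupp.single (1, 0, 0) 1) ∈ markSpan k (l + 1) := by
  have h : markSpan k l ≤ (markSpan k (l + 1)).comap
      ((newMarkMul k y).flip (Finsupp.single (1, 0, 0) 1)) := by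
    refine Submodule.span_le.2 ?_
    rintro _ ⟨p, q, hp, hq, rfl⟩
    have hm : ∀ x p, p < l → dendMark x l p 0 < l + 1 := by
      intro x p hp
      cases x <;> simp [dendMark]
      omega
    simp only [newMarkMul, SetLike.mem_coe, Submodule.mem_comap, LinearMap.flip_apply,
      LinearMap.sum_apply, LinearMap.smul_apply, markMul_single]
    exact Submodule.sum_mem _ fun x _ => Submodule.smul_mem _ _ (Submodule.smul_mem _ _
      (Submodule.subset_span ⟨_, _, hm _ _ hp, hm _ _ hq, rfl⟩))
  exact h hv

/-- Right multiplication by a single leaf multiplies the form by 0 or 1. On a left comb the form is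
therefore a product of independent tests of its labels. -/
lemma markForm_newMarkMul (y : DendOp × DendOp) (i j l : ℕ) {v : ℕ × ℕ × ℕ →₀ k}
    (hv : v ∈ markSpan k l) :
    markForm k i j (newMarkMul k y v (Finsupp.single (1, 0, 0) 1)) =
      (if y.1 = .succ ↔ l ≤ i then 1 else 0) * (if y.2 = .succ ↔ l ≤ j then 1 else 0) *
        markForm k i j v := by
  induction hv using Submodule.span_induction with
  | mem v hv =>
    obtain ⟨p, q, hp, hq, rfl⟩ := hv
    simp only [newMarkMul, LinearMap.sum_apply, LinearMap.smul_apply, markMul_single, map_sum,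
      map_smul, smul_eq_mul, markForm, Finsupp.linearCombination_single, mul_one, one_mul]
    have h := congrArg₂ (· * ·) (sum_dendToNew_mul_leInd k y.1 i l p hp)
      (sum_dendToNew_mul_leInd k y.2 j l q hq)
    simp only [← sum_prod_mul] at h
    refine Eq.trans (Finset.sum_congr rfl fun x _ => ?_) (h.trans ?_)
    · simp only [quadToNew]
      push_cast
      ring
    · ring
  | zero => simp
  | add v w _ _ hv hw => rw [map_add, LinearMap.add_apply, map_add, hv, hw, map_add, mul_add]
  | smul a v _ hv => rw [map_smul, LinearMap.smul_apply, map_smul, hv, map_smul, smul_eq_mul,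
      smul_eq_mul, mul_left_comm]

end Marks

/-! ### Critical trees -/

namespace BTree

variable {Y : Type w}

/-- The left combs. -/
inductive LeftComb : BTree Y → Prop
  | leaf : LeftComb leaf
  | node (x : Y) (t : BTree Y) : LeftComb t → LeftComb (node x t leaf)

/-- The vertices on the left branch are labelled by `≻` if and only if at most `i` leaves are on
their left. -/
def HasPattern (f : Y → DendOp) (i : ℕ) : BTree Y → Prop
  | leaf => True
  | node x l _ => (f x = .succ ↔ l.leaves ≤ i) ∧ HasPattern f i l

/-- With at most `i + 1` leaves every vertex of the left branch has at most `i` leaves on its left,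
so the pattern is constantly `succ` and the exact bound is immaterial. -/
lemma HasPattern.congr {f : Y → DendOp} {i i' : ℕ} (t : BTree Y) (h : HasPattern f i t)
    (hi : t.leaves ≤ i + 1) (hi' : t.leaves ≤ i' + 1) : HasPattern f i' t := by
  induction t with
  | leaf => trivial
  | node x l r hl hr =>
    have := r.leaves_pos
    simp only [leaves] at hi hi'
    refine ⟨h.1.trans ⟨fun _ => by omega, fun _ => by omega⟩, hl h.2 (by omega) (by omega)⟩

lemma LeftComb.eq_of_hasPattern {t t' : BTree (DendOp × DendOp)} (h : LeftComb t)
    (h' : LeftComb t') (hl : t.leaves = t'.leaves) {i j : ℕ} (h₁ : HasPattern Prod.fst i t)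
    (h₂ : HasPattern Prod.snd j t) (h₁' : HasPattern Prod.fst i t')
    (h₂' : HasPattern Prod.snd j t') : t = t' := by
  have key : ∀ (a b : DendOp), (a = .succ ↔ b = .succ) → a = b := by decide
  induction h generalizing t' with
  | leaf =>
    cases h' with
    | leaf => rfl
    | node x t' h' =>
      have := t'.leaves_pos
      simp only [leaves] at hl
      omega
  | node x t h ih =>
    cases h' with
    | leaf =>
      have := t.leaves_pos
      simp only [leaves] at hl
      omega
    | node x' t' h' =>
      simp only [leaves, Nat.add_right_cancel_iff] at hl
      obtain rfl := ih h' hl h₁.2 h₂.2 h₁'.2 h₂'.2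
      rw [Prod.ext (key x.1 x'.1 (h₁.1.trans h₁'.1.symm)) (key x.2 x'.2 (h₂.1.trans h₂'.1.symm))]

open Classical in
lemma LeftComb.markForm_algEval (k : Type u) [Field k] {t : BTree (DendOp × DendOp)}
    (h : LeftComb t) (i j : ℕ) :
    markForm k i j (algEval (newMarkMul k) (fun _ => Finsupp.single (1, 0, 0) 1) t) =
      if HasPattern Prod.fst i t ∧ HasPattern Prod.snd j t then 1 else 0 := by
  suffices H : algEval (newMarkMul k) (fun _ => Finsupp.single (1, 0, 0) 1) t ∈
      markSpan k t.leaves ∧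
      markForm k i j (algEval (newMarkMul k) (fun _ => Finsupp.single (1, 0, 0) 1) t) =
      if HasPattern Prod.fst i t ∧ HasPattern Prod.snd j t then 1 else 0 from H.2
  induction h with
  | leaf =>
    refine ⟨Submodule.subset_span ⟨0, 0, one_pos, one_pos, rfl⟩, ?_⟩
    simp [algEval, markForm, leInd, HasPattern]
  | node x t h ih =>
    obtain ⟨h1, h2⟩ := ih
    refine ⟨newMarkMul_single_mem k x _ h1, ?_⟩
    have := markForm_newMarkMul k x i j _ h1
    rw [h2] at this
    refine this.trans ?_
    by_cases h3 : x.1 = .succ ↔ t.leaves ≤ i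
    · by_cases h4 : x.2 = .succ ↔ t.leaves ≤ j
      · by_cases h5 : HasPattern Prod.fst i t ∧ HasPattern Prod.snd j t
        · rw [if_pos h3, if_pos h4, if_pos h5, one_mul, one_mul]
          exact (if_pos ⟨⟨h3, h5.1⟩, h4, h5.2⟩).symm
        · rw [if_neg h5, mul_zero]
          exact (if_neg fun h => h5 ⟨h.1.2, h.2.2⟩).symm
      · rw [if_neg h4, mul_zero, zero_mul]
        exact (if_neg fun h => h4 h.2.1).symm
    · rw [if_neg h3, zero_mul, zero_mul]
      exact (if_neg fun h => h3 h.1.1).symm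

end BTree

lemma MTree.Crit.leftComb {X : Type w} {bad : X → X → Prop} {t : MTree X} (h : Crit bad t) :
    t.flatten.LeftComb := by
  induction h with
  | leaf => exact .leaf
  | up x t _ _ ih => exact .node x _ ih

/-- A bad pair never has inner label `prec` and outer label `succ`. So from the innermost vertex
outwards the labels are a run of `succ` followed by a run of `prec`, and the first run determines
`i`. -/
lemma MTree.Crit.exists_hasPattern {X : Type w} {bad : X → X → Prop} {t : MTree X}
    (h : Crit bad t) (f : X → DendOp) (hf : ∀ a b, bad a b → dendBad (f a) (f b)) :
    ∃ i, t.flatten.HasPattern f i := by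
  -- The last alternative records whether all labels so far are `succ` or the run of `prec` has
  -- begun.
  suffices H : ∃ i, i < t.flatten.leaves ∧ t.flatten.HasPattern f i ∧
      (i + 1 = t.flatten.leaves ∨ ∀ a, t.root = some a → f a = .prec) by
    obtain ⟨i, -, h, -⟩ := H
    exact ⟨i, h⟩
  induction h with
  | leaf => exact ⟨0, one_pos, trivial, Or.inl rfl⟩
  | up x t ht hc ih =>
    obtain ⟨i, hi, hp, h⟩ := ih
    rw [leaves_flatten_up, flatten_up]
    cases hx : f x with
    | prec =>
      exact ⟨i, by omega, ⟨⟨fun e => absurd (hx.symm.trans e) nofun, fun e => by omega⟩, hp⟩,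
        Or.inr fun a ha => by cases ha; exact hx⟩
    | succ =>
      have hl : i + 1 = t.flatten.leaves := by
        rcases h with h | h
        · exact h
        · cases hc with
          | leaf => simp only [flatten, BTree.leaves] at hi ⊢; omega
          | up y t' _ _ =>
            have h1 := h y rfl
            have h2 := hf _ _ (ht y rfl)
            rw [h1, hx] at h2
            rcases h2 with h2 | h2 <;> cases h2
      exact ⟨t.flatten.leaves, by omega, ⟨⟨fun _ => le_rfl, fun _ => hx⟩,
        hp.congr _ (by omega) (by omega)⟩, Or.inl rfl⟩

/-! ### The main theorem -/

lemma freeEval_eq_sum_upTo {k : Type u} [Field k] {X : Type w} [Fintype X] {F : Type*}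
    [AddCommGroup F] [Module k F] (o : X → F →ₗ[k] F →ₗ[k] F) (a : ℕ → F) (n : ℕ)
    (g : BTree X → k) (hg : ∀ t, t.leaves ≠ n → g t = 0) :
    freeEval o a n ((Finsupp.linearEquivFunOnFinite k k {t : BTree X // t.leaves = n}).symm
      fun t => g t.1) = ∑ t ∈ BTree.upTo X n, g t • algEval o a t := by
  have h := congrArg (Finsupp.linearCombination k fun t => algEval o a t)
    (BinQuadData.mapDomain_eq_sum_upTo n g hg)
  rw [Finsupp.linearCombination_mapDomain] at h
  refine h.trans ?_
  simp [map_sum, Finsupp.linearCombination_single]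

section Quad

variable (k : Type u) [Field k] [CharZero k]

/-- An element of degree `0` in the kernel of the augmentation, which vanishes at the trees that
are not critical, is zero. -/
lemma eq_zero_of_barAug_eq_zero (n : ℕ) (χ : (quad k).operad.bar n 0)
    (h : ∀ t, t.Normal (quadPBW k).bad → ¬ MTree.Crit (quadPBW k).bad t →
      χ.1 ((quadPBW k).toD t) = 0) (hχ : (quad k).barAug n χ = 0) : χ = 0 := by
  classical
  refine Subtype.ext ((quadPBW k).eq_zero_of_normal χ.2.1 fun C hC => ?_)
  by_cases hcrit : MTree.Crit (quadPBW k).bad C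
  swap
  · exact h C hC hcrit
  by_cases hn : C.flatten.leaves = n
  swap
  · exact χ.2.2 _ fun h => hn (by rw [← h.1, LeftPBW.leaves_toD])
  obtain ⟨i, hi⟩ := hcrit.exists_hasPattern Prod.fst fun a b hab => hab.1
  obtain ⟨j, hj⟩ := hcrit.exists_hasPattern Prod.snd fun a b hab => hab.2
  have h1 : ∑ t ∈ BTree.upTo (DendOp × DendOp) n, χ.1 ((quad k).toDTree t) •
      algEval (markMul k) (fun _ => Finsupp.single (1, 0, 0) 1) t = 0 := by
    rw [← freeEval_eq_sum_upTo _ _ _ _ ((quad k).apply_toDTree_eq_zero χ)]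
    have := congrArg (operadEval (satisfiesRel_markMul k)
      (fun _ => Finsupp.single (1, 0, 0) 1) n) hχ
    rwa [map_zero] at this
  simp only [BinQuadData.toDTree_eq] at h1
  -- The vanishing sum is written in the original generators, while critical trees are defined
  -- through the new ones.
  rw [sum_algEval_eq (gen_eq_sum_quadGen k) (o' := newMarkMul k) (fun _ => rfl) _ n n le_rfl χ.2.1
    fun t ht => χ.2.2 _ fun h => by omega] at h1
  have h2 := congrArg (markForm k i j) h1
  simp only [map_sum, map_smul, map_zero, smul_eq_mul] at h2
  have h3 : ∀ t, DTree.ofBTree (quadGen k) t = (quadPBW k).toD (.ofBTree t) := fun t =>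
    ((quadPBW k).toD_ofBTree t).symm
  -- The form belonging to the patterns of `C` detects `C` alone: `χ` vanishes at noncritical trees,
  -- and two left combs of the same size with the same patterns are equal.
  rw [Finset.sum_eq_single C.flatten, h3, hcrit.ofBTree_flatten,
    hcrit.leftComb.markForm_algEval k i j, if_pos ⟨hi, hj⟩, mul_one] at h2
  · exact h2
  · intro t _ hne
    by_cases ht : MTree.Crit (quadPBW k).bad (.ofBTree t) ∧ t.leaves = n
    · have hcomb := ht.1.leftComb
      rw [MTree.flatten_ofBTree] at hcomb
      rw [hcomb.markForm_algEval k i j, if_neg, mul_zero]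
      exact fun hp => hne (hcomb.eq_of_hasPattern hcrit.leftComb (ht.2.trans hn.symm)
        hp.1 hp.2 hi hj)
    · rw [h3]
      rcases not_and_or.1 ht with ht | ht
      · rw [h _ (MTree.normal_ofBTree _ _) ht, zero_mul]
      · rw [χ.2.2 _ fun h => ht (by rw [← h.1, LeftPBW.leaves_toD, MTree.flatten_ofBTree]),
          zero_mul]
  · intro hC
    exact absurd (BTree.mem_upTo.2 hn.le) hC

lemma quad_exact_barAug (n : ℕ) :
    Function.Exact ((quad k).operad.barD n 0) ((quad k).barAug n) := by
  intro φ
  constructor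
  · intro h
    obtain ⟨ψ, hψ⟩ := (quadPBW k).exists_sub_barD n φ
    refine ⟨ψ, (sub_eq_zero.1 (eq_zero_of_barAug_eq_zero k n _ hψ ?_)).symm⟩
    rw [map_sub, h, BinQuadData.barAug_barD, sub_zero]
  · rintro ⟨ψ, rfl⟩
    exact (quad k).barAug_barD n ψ

/-- The basis of linear forms dual to the generators. -/
def quadDualForm (x : DendOp × DendOp) : (quad k).operad.obj 2 →ₗ[k] k :=
  ∑ y, quadOfNew k y x • (quadPBW k).coord 2 (.node y .leaf .leaf)

lemma coord_quadGen (y y' : DendOp × DendOp) :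
    (quadPBW k).coord 2 (.node y .leaf .leaf) (quadGen k y') = if y = y' then 1 else 0 := by
  have hn : (BTree.node y' .leaf .leaf).Normal (quadPBW k).bad :=
    ⟨trivial, trivial, fun _ _ _ h => by cases h⟩
  have he : (quad k).operad.eval (quadPBW k).gen (.node y' .leaf .leaf) 2 rfl = quadGen k y' :=
    (quad k).operad.eval_corolla _ _ _
  rw [← he]
  split_ifs with h
  · subst h
    exact (quadPBW k).coord_self _ _ _ hn
  · exact (quadPBW k).coord_of_ne _ _ _ _ hn fun e => h (by cases e; rfl)

lemma quadDualForm_gen (x x' : DendOp × DendOp) :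
    quadDualForm k x ((quad k).gen x') = if x = x' then 1 else 0 := by
  rw [gen_eq_sum_quadGen]
  simp only [quadDualForm, map_sum, map_smul, LinearMap.sum_apply, LinearMap.smul_apply,
    coord_quadGen, smul_eq_mul]
  simp only [mul_ite, mul_one, mul_zero, Finset.sum_ite_eq', Finset.mem_univ, if_true]
  rw [quadToNew_ofNew]
  simp only [eq_comm]

end Quad

end

theorem theorem4p1 (k : Type*) [Field k] [IsAlgClosed k] [CharZero k] :
    (quad k).IsKoszul := fun n =>
  ⟨fun i => (quadPBW k).exact_barD n i, quad_exact_barAug k n,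
    BinQuadData.barAug_surjective (quadDualForm_gen k) n⟩
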